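/- **Setting.** Let $n\ge 3$, $d\ge 2$, and let $(\mathbf W,S)$ be an affine Coxeter system of type $\tilde B_n$, with $S=\{0,1,\dots,n\}$: the edges of the Coxeter graph $\Gamma$ are $0-2$, $1-2$, $2-3$, …, $(n-1)-n$, and the last one has label $4$. Let $K_n$ be the set of all $\sigma\subseteq S$ (including $\varnothing$) such that the parabolic subgroup $\mathbf W_\sigma$ generated by $\sigma$ is finite. For $\sigma\in K_n$ let $v_{\varphi_d}(\sigma)$ be the multiplicity of the cyclotomic polynomial $\varphi_d$ in the Poincaré polynomial $\mathbf W_\sigma(q)=\sum_{w\in \mathbf W_\sigma}q^{\ell(w)}$. Write $\tau\lhd\sigma$ if $\tau\subseteq\sigma$ and $|\sigma|=|\tau|+1$, and $\sigma\veebar v=\sigma\cup\{v\}$ if $v\notin\sigma$, $\sigma\veebar v=\sigma\setminus\{v\}$ if $v\in\sigma$. A *matching* $\mathcal M$ is a set of edges $\sigma\to\tau$ (with $\tau\lhd\sigma$ in $K_n$) such that each simplex is in at most one edge; simplices in no edge of $\mathcal M$ are *critical*. $\mathcal M$ is *acyclic* if there is no closed alternating path $\sigma_0\rhd\tau_1\lhd\sigma_1\rhd\dots\rhd\tau_m\lhd\sigma_m=\sigma_0$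 with $m\ge1$, where $(\sigma_i\to\tau_i)\in\mathcal M$ and $(\sigma_{i-1}\to\tau_i)\notin\mathcal M$; it is *$\varphi_d$-weighted* if $v_{\varphi_d}(\sigma)=v_{\varphi_d}(\tau)$ for all $(\sigma\to\tau)\in\mathcal M$; it is *$\varphi_d$-precise* if it is acyclic, $\varphi_d$-weighted, and $v_{\varphi_d}(\sigma)=v_{\varphi_d}(\tau)+1$ for all critical $\sigma,\tau$ with $[\sigma:\tau]^{\mathcal M}\ne0$. Here $[\sigma:\tau]^{\mathcal M}$ is the sum of $(-1)^m[\sigma:\tau_1][\sigma_1:\tau_1][\sigma_1:\tau_2]\cdots[\sigma_m:\tau_m][\sigma_m:\tau]$ over all alternating paths $\sigma\rhd\tau_1\lhd\sigma_1\rhd\dots\rhd\tau_m\lhd\sigma_m\rhd\tau$ ($m\geq 0$; upward edges in $\mathcal M$, downward edges not in $\mathcal M$), with $[\cdot:\cdot]$ the simplicial incidence numbers. The matchings are given by rules, read in order: the first one that applies decides with which simplex $\sigma$ is matched, or that it is critical. **Matching $A$** on $K^A_{n,f,g}=\{\sigma\subseteq\{1,\dots,n\} : \{1,\dots,f\}\cup\{n-g+1,\dots,n\}\subseteq\sigma\}$.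 (a) If $f+g\ge n$, the matching is empty. (b) If $f\ge d$, remove the first $d$ vertices, relabel, and use the matching on $K^A_{n-d,f-d,g}$. (c) If $n\ge d+g$: (c1) if $\{1,\dots,d-1\}\subseteq\sigma$, match with $\sigma\veebar d$; (c2) if $f+1\in\sigma$, match with $\sigma\setminus\{f+1\}$; (c3) if $\{f+2,\dots,d-1\}\nsubseteq\sigma$, match with $\sigma\cup\{f+1\}$; (c4) otherwise ignore the vertices $\le f+1$, relabel, and use the matching on $K^A_{n-f-1,\,d-2-f,\,g}$. (d) If $n<d+g$: if $n\equiv-1,0,\dots,f-1\pmod d$ and $\sigma$ is $\{1,\dots,n\}$ or $\{1,\dots,n\}\setminus\{f+1\}$, then $\sigma$ is critical; otherwise match with $\sigma\veebar(f+1)$. **Matching $D$** ($d$ even) on $K^D_{n,g}=\{\sigma\subseteq\{1,\dots,n\} : \{n-g+1,\dots,n\}\subseteq\sigma\}$, with edges $1-3$, $2-3$, $3-4$, …, $(n-1)-n$. If $g\ge n$ the matching is empty. Otherwise: (a) If $2\notin\sigma$, relabel $1,3,4,\dots,n$ as $1,\dots,n-1$ and use $K^A_{n-1,0,g}$. (b)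 If $d=2$ and $\{1,2,3,4\}\nsubseteq\sigma$: if $\{1,2,4\}\subseteq\sigma$, match with $\sigma\veebar5$ if $n-g\ge5$, else $\sigma$ is critical; if $\{1,2,4\}\nsubseteq\sigma$, match with $\sigma\veebar3$ if $n-g\ge3$, else $\sigma$ is critical. (c) If $d\ge4$ and $3\notin\sigma$, match with $\sigma\veebar1$. (d) If $d=4$ and $4\notin\sigma$, ignore the vertices $\le4$, relabel, and use $K^A_{n-4,0,g}$ (the empty matching if $n<4$). (e) If $d\ge6$ and $4\notin\sigma$, match with $\sigma\veebar1$. (f) If $d\ge4$ and $1\notin\sigma$: if $\{2,\dots,\frac d2+1\}\subseteq\sigma$, relabel $2,\dots,n$ as $1,\dots,n-1$ and use $K^A_{n-1,\max(d/2,3),g}$; otherwise match with $\sigma\cup\{1\}$. (g) Otherwise let $k$ be the size of the connected component of $1$ in the subgraph induced by $\sigma$; write $k=q\frac d2+r$ with $0<r<\frac d2$ if $\frac d2\nmid k$, and with $r\in\{0,\frac d2\}$ and $q$ even if $\frac d2\mid k$. Let $v=q\frac d2+1$ if $q$ is even, $v=q\frac d2+2$ if $q$ is odd. If $v\in\sigma$,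 match with $\sigma\setminus\{v\}$ if $v\le n-g$, else $\sigma$ is critical. If $v\notin\sigma$: if $v>n$, $\sigma$ is critical; if $q$ is even and $\{q\frac d2+2,\dots,(q+1)\frac d2+1\}\subseteq\sigma$, ignore the vertices $\le q\frac d2+1$, relabel, and use $K^A_{n-qd/2-1,\,d/2,\,g}$; if $q$ is odd and $\{q\frac d2+3,\dots,(q+1)\frac d2\}\subseteq\sigma$, ignore the vertices $\le q\frac d2+2$, relabel, and use $K^A_{n-qd/2-2,\,d/2-2,\,g}$; otherwise match with $\sigma\cup\{v\}$. **Matching on $K_n$, $d$ odd.** For $\sigma\ne\{0,1,\dots,n-1\}$, match $\sigma$ with $\sigma\veebar n$; $\{0,1,\dots,n-1\}$ is critical. **Matching on $K_n$, $d$ even.** For $\sigma\in K_n$ let $k$ be the size of the connected component of the vertex $n$ in the subgraph of $\Gamma$ induced by $\sigma$ ($k=0$ if $n\notin\sigma$), and write $k=q\frac d2+r$ with $0\le r<\frac d2$, $m=n-q\frac d2$. (a) If $r\ge1$, match with $\sigma\veebar m$, unless $\sigma=\{0,2,3,\dots,n\}$ and $r=1$ (then $\sigma$ is critical). (b) If $r=0$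 and $\{m-\frac d2+1,\dots,m-1\}\subseteq\sigma$, ignore the vertices $\ge m$, relabel $0,\dots,m-1$ as $1,\dots,m$, and use matching $D$ on $K^D_{m,\,d/2-1}$. (c) If $r=0$ and $\{m-\frac d2+1,\dots,m-1\}\nsubseteq\sigma$: if $|\sigma|=n$, $\sigma$ is critical; if $n=(q+1)\frac d2$ and $\sigma=\{0,2,3,\dots,n\}\setminus\{m\}$, $\sigma$ is critical; otherwise match with $\sigma\veebar m$. **Lemma.** These rules define matchings on $K_n$, and these matchings are acyclic and $\varphi_d$-weighted. For $d$ odd there is exactly one critical simplex $\sigma$, and it satisfies $|\sigma|-v_{\varphi_d}(\sigma)=n-\lfloor n/d\rfloor$. For $d$ even, every critical simplex $\sigma$ satisfies $|\sigma|-v_{\varphi_d}(\sigma)=n-\big\lfloor \frac n{d/2}\big\rfloor$. In particular both matchings are $\varphi_d$-precise. -/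

import Mathlib

open Polynomial

namespace ArtinMorse

/-! ## Parabolic subgroups, the complex of finite parabolics, and weights

Throughout, `cs : CoxeterSystem M W` is a Coxeter system with generators indexed by `B`. -/

/-- The parabolic subgroup `W_σ` generated by the simple reflections in `σ`. -/
def parabolic {B W : Type*} [Group W] {M : CoxeterMatrix B} (cs : CoxeterSystem M W)
    (σ : Finset B) : Subgroup W :=
  Subgroup.closure (cs.simple '' (σ : Set B))

/-- The simplicial complex `K_W` (with the empty simplex included): the sets `σ` of generators
such that the parabolic subgroup `W_σ` is finite. -/
def finiteComplex {B W : Type*} [Group W] {M : CoxeterMatrix B} (cs : CoxeterSystem M W) :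
    Set (Finset B) :=
  {σ | Finite (parabolic cs σ)}

/-- The Poincaré polynomial `W_σ(q) = ∑_{w ∈ W_σ} q ^ ℓ(w)` (meaningful for `W_σ` finite). -/
noncomputable def poincarePolynomial {B W : Type*} [Group W] {M : CoxeterMatrix B}
    (cs : CoxeterSystem M W) (σ : Finset B) : ℚ[X] :=
  ∑ᶠ w : parabolic cs σ, X ^ cs.length (w : W)

/-- The `φ_d`-weight `v_{φ_d}(σ)`: the multiplicity of the `d`-th cyclotomic polynomial in the
factorization of the Poincaré polynomial of `W_σ`. -/
noncomputable def weight {B W : Type*} [Group W] {M : CoxeterMatrix B}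
    (cs : CoxeterSystem M W) (d : ℕ) (σ : Finset B) : ℕ :=
  multiplicity (cyclotomic d ℚ) (poincarePolynomial cs σ)

/-! ## Matchings on the incidence graph of a simplicial complex

A set of edges `σ → τ` of the incidence graph is represented by a set of pairs `(σ, τ)`. -/

/-- `τ` is a facet of `σ`, written `τ ⊲ σ`. -/
def IsFacet {B : Type*} (τ σ : Finset B) : Prop :=
  τ ⊆ σ ∧ σ.card = τ.card + 1

/-- `E` is a set of edges of the incidence graph of `K` such that each simplex is adjacent to at
most one edge in `E`. -/
def IsMatching {B : Type*} (K : Set (Finset B)) (E : Set (Finset B × Finset B)) : Prop :=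
  (∀ e ∈ E, e.1 ∈ K ∧ e.2 ∈ K ∧ IsFacet e.2 e.1) ∧
  ∀ ρ ∈ K, ∀ e ∈ E, ∀ e' ∈ E, (e.1 = ρ ∨ e.2 = ρ) → (e'.1 = ρ ∨ e'.2 = ρ) → e = e'

/-- A simplex is critical if none of its adjacent edges is in the matching. -/
def IsCritical {B : Type*} (K : Set (Finset B)) (E : Set (Finset B × Finset B))
    (ρ : Finset B) : Prop :=
  ρ ∈ K ∧ ∀ e ∈ E, e.1 ≠ ρ ∧ e.2 ≠ ρ

/-- A step `σ ▷ e.2 ◁ e.1` of an alternating path: the edge `σ → e.2` is not in the matching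
and the edge `e.1 → e.2` is in the matching. -/
def AltStep {B : Type*} (E : Set (Finset B × Finset B)) (σ : Finset B)
    (e : Finset B × Finset B) : Prop :=
  IsFacet e.2 σ ∧ (σ, e.2) ∉ E ∧ e ∈ E

/-- A matching is acyclic if there are no non-trivial alternating cycles
`σ₀ ▷ τ₁ ◁ σ₁ ▷ τ₂ ◁ ⋯ ▷ τ_m ◁ σ_m = σ₀`, `m ≥ 1`. -/
def IsAcyclic {B : Type*} (E : Set (Finset B × Finset B)) : Prop :=
  ∀ σ, ¬ Relation.TransGen (fun ρ ρ' => ∃ τ, AltStep E ρ (ρ', τ)) σ σ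

/-- A matching is `v`-weighted if `v` agrees on matched simplices. -/
def IsWeighted {B : Type*} (v : Finset B → ℕ) (E : Set (Finset B × Finset B)) : Prop :=
  ∀ e ∈ E, v e.1 = v e.2

/-- The list `[(σ₁, τ₁), …, (σ_m, τ_m)]` gives an alternating path
`σ ▷ τ₁ ◁ σ₁ ▷ τ₂ ◁ σ₂ ▷ ⋯ ▷ τ_m ◁ σ_m ▷ τ` from `σ` to `τ`. -/
def IsAltPath {B : Type*} (E : Set (Finset B × Finset B)) :
    Finset B → List (Finset B × Finset B) → Finset B → Prop
  | σ, [], τ => IsFacet τ σ ∧ (σ, τ) ∉ E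
  | σ, e :: p, τ => AltStep E σ e ∧ IsAltPath E e.1 p τ

/-- The simplicial incidence number `[σ : τ]` with respect to the order of the vertices: it is
`(-1) ^ i` if `τ` is obtained from `σ` by removing the vertex that has exactly `i` predecessors
in `σ`, and `0` if `τ` is not a facet of `σ`. -/
def incidence {B : Type*} [LinearOrder B] (σ τ : Finset B) : ℤ :=
  ∑ v ∈ σ, if σ.erase v = τ then (-1) ^ (σ.filter (· < v)).card else 0

/-- The contribution
`(-1)^m [σ : τ₁] [σ₁ : τ₁] [σ₁ : τ₂] [σ₂ : τ₂] ⋯ [σ_m : τ_m] [σ_m : τ]` of an alternating path. -/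
def pathSign {B : Type*} [LinearOrder B] :
    Finset B → List (Finset B × Finset B) → Finset B → ℤ
  | σ, [], τ => incidence σ τ
  | σ, e :: p, τ => -(incidence σ e.2 * incidence e.1 e.2 * pathSign e.1 p τ)

/-- The incidence number `[σ : τ]^E` in the Morse complex of an acyclic matching `E`: the sum of
the contributions of all alternating paths from `σ` to `τ`. -/
noncomputable def morseIncidence {B : Type*} [LinearOrder B] (E : Set (Finset B × Finset B))
    (σ τ : Finset B) : ℤ :=
  ∑ᶠ p ∈ {p | IsAltPath E σ p τ}, pathSign σ p τ

/-- A matching is `v`-precise if it is acyclic and `v`-weighted, and `v σ = v τ + 1` for all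
critical simplices `σ`, `τ` with non-zero incidence number in the Morse complex. -/
def IsPrecise {B : Type*} [LinearOrder B] (K : Set (Finset B)) (v : Finset B → ℕ)
    (E : Set (Finset B × Finset B)) : Prop :=
  IsAcyclic E ∧ IsWeighted v E ∧
  ∀ σ τ, IsCritical K E σ → IsCritical K E τ → morseIncidence E σ τ ≠ 0 → v σ = v τ + 1

/-! ## Affine Coxeter systems of type `B̃ₙ` -/

/-- The edges `i — j` (listed with `i < j`) of the graph
```
  0
   \
    2 --- 3 --- 4 ⋯
   /
  1
``` -/
abbrev ForkEdge (i j : ℕ) : Prop := (i = 0 ∧ j = 2) ∨ (1 ≤ i ∧ j = i + 1)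

/-- The Coxeter matrix of type `B̃ₙ` (`n ≥ 3`) with vertices `0, 1, …, n`: the Coxeter graph has
the edges `0 — 2`, `1 — 2`, `2 — 3`, …, `(n-1) — n`, the last of which has label `4`. -/
def affineB (n : ℕ) : CoxeterMatrix (Fin (n + 1)) where
  M := Matrix.of fun i j : Fin (n + 1) =>
    if i = j then 1
    else if ForkEdge i j ∨ ForkEdge j i then (if (i : ℕ) = n ∨ (j : ℕ) = n then 4 else 3)
    else 2
  isSymm := by
    ext i j
    simp only [Matrix.transpose_apply, Matrix.of_apply, eq_comm (a := j) (b := i),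
      or_comm (a := ForkEdge j i), or_comm (a := (j : ℕ) = n)]
  diagonal i := by simp
  off_diagonal i j h := by
    simp only [Matrix.of_apply, if_neg h]
    split_ifs <;> decide

/-! ## The matchings

Vertices are natural numbers. A matching is described by a pivot function, which sends a simplex
`σ` to `some v` if `σ` is matched with `σ ⊻ v` (that is `σ ∪ {v}` if `v ∉ σ`, and `σ \ {v}` if
`v ∈ σ`), and to `none` if `σ` is critical. -/

/-- The simplex obtained by ignoring the vertices `≤ c` and relabelling `c + 1, c + 2, …`
as `1, 2, …`. -/
def shiftDown (c : ℕ) (σ : Finset ℕ) : Finset ℕ := (σ.filter (c < ·)).image (· - c)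

/-- The size of the connected component of the vertex `v` in the subgraph of `Γ` induced by `σ`
(`0` if `v ∉ σ`). -/
noncomputable def componentSize (Γ : SimpleGraph ℕ) (σ : Finset ℕ) (v : ℕ) : ℕ :=
  Set.ncard {u : ℕ | ∃ (hv : v ∈ (σ : Set ℕ)) (hu : u ∈ (σ : Set ℕ)),
    (Γ.induce (σ : Set ℕ)).Reachable ⟨v, hv⟩ ⟨u, hu⟩}

/-- The `φ_d`-matching (`d ≥ 2`) on the set `K^A_{n,f,g}` of the simplices `σ ⊆ {1, …, n}` of
type `A_n` that contain the first `f` and the last `g` vertices. -/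
def pivotA (d n f g : ℕ) (σ : Finset ℕ) : Option ℕ :=
  if h₀ : d < 2 ∨ n ≤ f + g then none
  else if hf : d ≤ f then
    (pivotA d (n - d) (f - d) g (shiftDown d σ)).map (· + d)
  else if d + g ≤ n then
    if Finset.Icc 1 (d - 1) ⊆ σ then some d
    else if f + 1 ∈ σ then some (f + 1)
    else if ¬ Finset.Icc (f + 2) (d - 1) ⊆ σ then some (f + 1)
    else (pivotA d (n - f - 1) (d - 2 - f) g (shiftDown (f + 1) σ)).map (· + (f + 1))
  else
    -- the congruence is `n ≡ -1, 0, …, f - 1 (mod d)`; here `f ≤ d - 2`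
    if (n + 1) % d ≤ f ∧
        (σ = Finset.Icc 1 n ∨ σ = (Finset.Icc 1 n).erase (f + 1)) then none
    else some (f + 1)
termination_by n
decreasing_by all_goals omega

/-- The Coxeter graph of type `D`: edges `1 — 3`, `2 — 3`, `3 — 4`, `4 — 5`, …. -/
def graphD : SimpleGraph ℕ :=
  SimpleGraph.fromRel fun i j => (i = 1 ∧ j = 3) ∨ (2 ≤ i ∧ j = i + 1)

/-- The `φ_d`-matching (`d ≥ 2` even) on the set `K^D_{n,g}` of the simplices
`σ ⊆ {1, …, n}` of type `D_n` that contain the last `g` vertices. If `g ≥ n` this set has at most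
one element and the matching is empty. -/
noncomputable def pivotD (d n g : ℕ) (σ : Finset ℕ) : Option ℕ :=
  let h := d / 2
  if n ≤ g then none
  else if 2 ∉ σ then
    -- relabel `1, 3, 4, …, n` as `1, 2, 3, …, n - 1`
    (pivotA d (n - 1) 0 g (σ.image fun i => if i = 1 then 1 else i - 1)).map
      fun p => if p = 1 then 1 else p + 1
  else if d = 2 ∧ ¬ {1, 2, 3, 4} ⊆ σ then
    if {1, 2, 4} ⊆ σ then (if 5 ≤ n - g then some 5 else none)
    else (if 3 ≤ n - g then some 3 else none)
  else if 4 ≤ d ∧ 3 ∉ σ then some 1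
  else if d = 4 ∧ 4 ∉ σ then (pivotA d (n - 4) 0 g (shiftDown 4 σ)).map (· + 4)
  else if 6 ≤ d ∧ 4 ∉ σ then some 1
  else if 4 ≤ d ∧ 1 ∉ σ then
    if Finset.Icc 2 (h + 1) ⊆ σ then
      (pivotA d (n - 1) (max h 3) g (shiftDown 1 σ)).map (· + 1)
    else some 1
  else
    -- `k = q * h + r`, where `0 < r < h` if `h ∤ k`, and `r ∈ {0, h}` with `q` even if `h ∣ k`
    let k := componentSize graphD σ 1
    let q := if k % h = 0 ∧ Odd (k / h) then k / h - 1 else k / h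
    let v := if Even q then q * h + 1 else q * h + 2
    if v ∈ σ then (if v ≤ n - g then some v else none)
    else if n < v then none
    else if Even q ∧ Finset.Icc (q * h + 2) ((q + 1) * h + 1) ⊆ σ then
      (pivotA d (n - q * h - 1) h g (shiftDown (q * h + 1) σ)).map (· + (q * h + 1))
    else if Odd q ∧ Finset.Icc (q * h + 3) ((q + 1) * h) ⊆ σ then
      (pivotA d (n - q * h - 2) (h - 2) g (shiftDown (q * h + 2) σ)).map (· + (q * h + 2))
    else some v

/-- The graph underlying the Coxeter graphs of type `B̃`: edges `0 — 2`, `1 — 2`, `2 — 3`, …. -/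
def graphAffineB : SimpleGraph ℕ := SimpleGraph.fromRel ForkEdge

/-- The `φ_d`-matching for `B̃ₙ`, `d` odd: `σ` is matched with `σ ⊻ n`, except for the critical
simplex `{0, …, n - 1}`. -/
def pivotAffineBOdd (n : ℕ) (σ : Finset ℕ) : Option ℕ :=
  if σ = Finset.range n then none else some n

/-- The `φ_d`-matching for `B̃ₙ`, `d` even. -/
noncomputable def pivotAffineBEven (d n : ℕ) (σ : Finset ℕ) : Option ℕ :=
  let h := d / 2
  let k := componentSize graphAffineB σ n
  let q := k / h
  let r := k % h
  let m := n - q * h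
  if 1 ≤ r then
    if σ = (Finset.range (n + 1)).erase 1 ∧ r = 1 then none else some m
  -- the integers `m - h + 1, …, m - 1` are all vertices, and they belong to `σ`
  else if h ≤ m + 1 ∧ Finset.Ico (m + 1 - h) m ⊆ σ then
    -- ignore the vertices `≥ m` and relabel `0, 1, …, m - 1` as `1, 2, …, m`
    (pivotD d m (h - 1) ((σ.filter (· < m)).image (· + 1))).map (· - 1)
  else if σ.card = n then none
  else if n = (q + 1) * h ∧ σ = ((Finset.range (n + 1)).erase 1).erase m then none
  else some m

/-- The `φ_d`-matching on `K = K_W`, where `W` is of type `B̃ₙ`: the set of the edges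
`σ → σ \ {v}` such that `σ` is matched with `σ ⊻ v`, or `σ \ {v}` is matched with
`(σ \ {v}) ⊻ v`. -/
def affineBMatching (d n : ℕ) (K : Set (Finset (Fin (n + 1)))) :
    Set (Finset (Fin (n + 1)) × Finset (Fin (n + 1))) :=
  let pivot (σ : Finset (Fin (n + 1))) : Option ℕ :=
    if Odd d then pivotAffineBOdd n (σ.map Fin.valEmbedding)
    else pivotAffineBEven d n (σ.map Fin.valEmbedding)
  {e | e.1 ∈ K ∧ e.2 ∈ K ∧ ∃ v ∈ e.1, e.2 = e.1.erase v ∧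
    (pivot e.1 = some (v : ℕ) ∨ pivot e.2 = some (v : ℕ))}

end ArtinMorse

/-! There are two ingredients: an explicit formula for the weights, and a calculus of acyclic
matchings in which one numerical invariant is carried along.

Weights. Remove a suitable end vertex from one component of `σ` to get `τ`. The minimal
representatives of the cosets of `W_τ` in `W_σ` then form a path, or, in type `D`, a path with one
extra coset in the middle level. So the Poincaré polynomial is multiplied by a geometric sum `[L] =
1 + q + ⋯ + q^(L-1)`, or by `[2b][b+1]/[b]` in passing from `D_b` to `D_(b+1)`, and `φ_d` divides
`[L]` exactly once if `d ∣ L` and not at all otherwise. To know that such a factorization holds it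
is enough to have a family of elements closed under the generators up to `W_τ` and lying in distinct
cosets (`finite_and_poincarePolynomial_eq`, resting on the exchange condition); the cosets are told
apart by the action on affine functionals. Induction gives `⌊(k+1)/d⌋` for `A_k`, the number of `i ≤
k` with `d ∣ 2i` for `B_k`, and this number for `k - 1` plus `[d ∣ k]` for `D_k`. The same induction
shows that all proper parabolic subgroups are finite, while the whole group contains translations;
hence `K_n` consists of the proper subsets (`hasWeight_weightB`, `infinite_parabolic_univ`).

Matchings. An alternating path from `σ` to `τ` forces `|σ| = |τ| + 1`. If `|σ| - v(σ)` takes the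
same value on all critical simplices, the matching is therefore precise. The property proved by
recursion is the package `IsPivotal`: the pivot is compatible with toggling, the weight is
preserved, there are no cycles, and `|σ| - v(σ) = c` on critical simplices. It passes from the
fibres of a monotone map to the whole complex (`IsPivotal.of_fiber`, `IsPivotal.of_upper`) and along
relabellings (`IsPivotal.transport`); a matching with one constant pivot is always acyclic
(`IsPivotal.of_const`).

With these tools each rule reduces to arithmetic of floor functions. For `d` odd, `B_k` and
`A_(k-1)` have equal weights, so the vertex `n` can be toggled. For `d = 2h`, `B_k` has weight
`⌊k/h⌋`, and `D_k` has constant weight `q` for `qh ≤ k ≤ qh + h` with `q` even and for `qh < k < qh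
+ h` with `q` odd. The rules toggle the first vertex of such a range as long as the block stays
inside it, and otherwise hand the remaining vertices over to a matching of type `D` or `A`. -/

namespace ArtinMorse

/-! ### Exchange condition and coset factorization of Poincaré polynomials. -/

section Exchange

variable {B W : Type*} [Group W] {M : CoxeterMatrix B} (cs : CoxeterSystem M W)

open Classical in
/-- The permutation of `W × ℤ/2` attached to a simple reflection `s`: it conjugates the first
component by `s` and changes the second one if the first one is `s`. -/
noncomputable def reflectionPerm (i : B) : Equiv.Perm (W × ZMod 2) where
  toFun x := (cs.simple i * x.1 * cs.simple i, x.2 + if x.1 = cs.simple i then 1 else 0)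
  invFun x := (cs.simple i * x.1 * cs.simple i, x.2 + if x.1 = cs.simple i then 1 else 0)
  left_inv x := by
    have h : cs.simple i * x.1 * cs.simple i = cs.simple i ↔ x.1 = cs.simple i := by
      constructor
      · intro h
        have := congrArg (fun y => cs.simple i * y * cs.simple i) h
        simpa [mul_assoc] using this
      · intro h; simp [h]
    ext
    · simp [mul_assoc]
    · simp only [h, add_assoc, ← two_mul]
      simp [show (2 : ZMod 2) = 0 from rfl]
  right_inv x := by
    have h : cs.simple i * x.1 * cs.simple i = cs.simple i ↔ x.1 = cs.simple i := by
      constructor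
      · intro h
        have := congrArg (fun y => cs.simple i * y * cs.simple i) h
        simpa [mul_assoc] using this
      · intro h; simp [h]
    ext
    · simp [mul_assoc]
    · simp only [h, add_assoc, ← two_mul]
      simp [show (2 : ZMod 2) = 0 from rfl]

-- The second coordinate changes once for each occurrence of `t` in the right inversion sequence.
-- Once the action is known to factor through `W`, the parity of this number is an invariant of the
-- group element.
open Classical in
theorem prod_map_reflectionPerm_apply (ω : List B) (t : W) (e : ZMod 2) :
    (ω.map (reflectionPerm cs)).prod (t, e) =
      (cs.wordProd ω * t * (cs.wordProd ω)⁻¹, e + ((cs.rightInvSeq ω).count t : ℕ)) := by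
  induction ω with
  | nil => simp
  | cons i ω ih =>
    rw [List.map_cons, List.prod_cons, Equiv.Perm.mul_apply, ih]
    have h : cs.wordProd ω * t * (cs.wordProd ω)⁻¹ = cs.simple i ↔
        (cs.wordProd ω)⁻¹ * cs.simple i * cs.wordProd ω = t := by
      constructor
      · intro h; rw [← h]; group
      · intro h; rw [← h]; group
    simp only [reflectionPerm, Equiv.coe_fn_mk, CoxeterSystem.rightInvSeq, List.count_cons, h,
      cs.wordProd_cons, mul_inv_rev, cs.inv_simple, beq_iff_eq, Prod.mk.injEq]
    refine ⟨by group, ?_⟩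
    split_ifs <;> push_cast <;> ring

theorem simple_mul_pow_mul_simple (i j : B) (k : ℕ) :
    cs.simple j * (cs.simple i * cs.simple j) ^ k =
      ((cs.simple i * cs.simple j) ^ k)⁻¹ * cs.simple j := by
  induction k with
  | zero => simp
  | succ k ih =>
    rw [pow_succ, ← mul_assoc, ih, mul_inv_rev, ← inv_pow, mul_inv_rev, cs.inv_simple,
      cs.inv_simple, ← pow_succ', pow_succ]
    simp [mul_assoc]

-- Prepending another pair `i, j` to the alternating word contributes the reflections with the next
-- two exponents `l = 2m` and `l = 2m + 1`.
open Classical in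
theorem count_rightInvSeq_flatten_replicate (i j : B) (m : ℕ) (t : W) :
    (cs.rightInvSeq (List.replicate m [i, j]).flatten).count t =
      ∑ l ∈ Finset.range (2 * m),
        if t = cs.simple j * (cs.simple i * cs.simple j) ^ l then 1 else 0 := by
  have hw : ∀ m, cs.wordProd (List.replicate m [i, j]).flatten =
      (cs.simple i * cs.simple j) ^ m := by
    intro m
    induction m with
    | zero => simp
    | succ m ih =>
      simp [List.replicate_succ, cs.wordProd_cons, ih, pow_succ', mul_assoc]
  induction m with
  | zero => simp
  | succ m ih =>
    have h1 : ((cs.simple i * cs.simple j) ^ m)⁻¹ * cs.simple j * (cs.simple i * cs.simple j) ^ m =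
        cs.simple j * (cs.simple i * cs.simple j) ^ (2 * m) := by
      rw [← simple_mul_pow_mul_simple, mul_assoc, ← pow_add, two_mul]
    have h2 : (cs.simple j * (cs.simple i * cs.simple j) ^ m)⁻¹ * cs.simple i *
        (cs.simple j * (cs.simple i * cs.simple j) ^ m) =
        cs.simple j * (cs.simple i * cs.simple j) ^ (2 * m + 1) := by
      rw [mul_inv_rev, cs.inv_simple, ← simple_mul_pow_mul_simple]
      rw [two_mul, add_assoc, pow_add, pow_succ']
      simp only [mul_assoc]
    rw [mul_add, mul_one, Finset.sum_range_succ, Finset.sum_range_succ, ← ih]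
    simp only [List.replicate_succ, List.flatten_cons, List.cons_append, List.nil_append,
      CoxeterSystem.rightInvSeq, List.count_cons, cs.wordProd_cons, hw, h1, h2, beq_iff_eq]
    simp only [eq_comm (a := t)]

/-- For `m = M i j` the inversions number `l` and `l + m` of the word `(ij)^m` coincide, because
`(s_i s_j)^m = 1`. Every reflection is counted an even number of times, so the word acts trivially.
-/
theorem isLiftable_reflectionPerm : M.IsLiftable (reflectionPerm cs) := by
  classical
  intro i j
  have h : (reflectionPerm cs i * reflectionPerm cs j) ^ M i j =
      ((List.replicate (M i j) [i, j]).flatten.map (reflectionPerm cs)).prod := by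
    generalize M i j = m
    induction m with
    | zero => simp
    | succ m ih =>
      rw [pow_succ', ih, List.replicate_succ, List.flatten_cons, List.map_append, List.prod_append]
      simp only [List.map_cons, List.map_nil, List.prod_cons, List.prod_nil, mul_one]
  have hw : ∀ m, cs.wordProd (List.replicate m [i, j]).flatten =
      (cs.simple i * cs.simple j) ^ m := by
    intro m
    induction m with
    | zero => simp
    | succ m ih =>
      simp [List.replicate_succ, cs.wordProd_cons, ih, pow_succ', mul_assoc]
  rw [h]
  ext1 ⟨t, e⟩
  rw [prod_map_reflectionPerm_apply, hw, cs.simple_mul_simple_pow,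
    count_rightInvSeq_flatten_replicate, two_mul, Finset.sum_range_add]
  simp only [pow_add, cs.simple_mul_simple_pow, one_mul, inv_one, mul_one, Equiv.Perm.one_apply,
    Prod.mk.injEq, true_and]
  rw [← two_mul, Nat.cast_mul, show ((2 : ℕ) : ZMod 2) = 0 from rfl, zero_mul, add_zero]

open Classical in
/-- The parity of the multiplicity of an element in the inversion sequence of a word depends only
on the product of the word. -/
theorem count_rightInvSeq_congr {ω ω' : List B} (h : cs.wordProd ω = cs.wordProd ω') (t : W) :
    ((cs.rightInvSeq ω).count t : ZMod 2) = ((cs.rightInvSeq ω').count t : ℕ) := by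
  have key : ∀ ω : List B, (ω.map (reflectionPerm cs)).prod =
      cs.lift ⟨_, isLiftable_reflectionPerm cs⟩ (cs.wordProd ω) := by
    intro ω
    induction ω with
    | nil => simp
    | cons i ω ih =>
      rw [List.map_cons, List.prod_cons, cs.wordProd_cons, map_mul, cs.lift_apply_simple, ih]
  have := congrArg (fun p : Equiv.Perm (W × ZMod 2) => (p (t, 0)).2)
    ((key ω).trans ((congrArg _ h).trans (key ω').symm))
  simpa [prod_map_reflectionPerm_apply] using this

/-- The exchange condition. -/
theorem exists_eraseIdx_of_isRightDescent (ω : List B) (i : B)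
    (h : cs.IsRightDescent (cs.wordProd ω) i) :
    ∃ j < ω.length, cs.wordProd ω * cs.simple i = cs.wordProd (ω.eraseIdx j) := by
  classical
  obtain ⟨α, hα, hαw⟩ := cs.exists_isReduced (cs.wordProd ω * cs.simple i)
  have hw : cs.wordProd ω = cs.wordProd (α.concat i) := by
    rw [cs.wordProd_concat, ← hαw]; simp [mul_assoc]
  -- Otherwise `w = (w s_i) s_i` would be shorter than `w s_i`, against the descent.
  have hni : cs.simple i ∉ cs.rightInvSeq α := by
    intro hi
    have h2 := (cs.isRightInversion_of_mem_rightInvSeq hα hi).2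
    rw [← hαw] at h2
    have h3 : cs.length (cs.wordProd ω * cs.simple i) < cs.length (cs.wordProd ω) := h
    simp only [mul_assoc, cs.simple_mul_simple_self, mul_one] at h2
    omega
  -- An odd count, so by parity `s_i` occurs in the inversion sequence of every word for `w`, in
  -- particular of `ω`.
  have hc : (cs.rightInvSeq (α.concat i)).count (cs.simple i) = 1 := by
    rw [cs.rightInvSeq_concat, List.concat_eq_append, List.count_append, List.count_singleton_self,
      List.count_eq_zero.2, zero_add]
    intro hm
    obtain ⟨u, hu, hui⟩ := List.mem_map.1 hm
    have : u = cs.simple i := by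
      have := congrArg (fun y => cs.simple i * y * cs.simple i) hui
      simpa [mul_assoc] using this
    exact hni (this ▸ hu)
  have hm : cs.simple i ∈ cs.rightInvSeq ω := by
    by_contra hm
    have := count_rightInvSeq_congr cs hw (cs.simple i)
    rw [hc, List.count_eq_zero.2 hm] at this
    exact absurd this (by decide)
  obtain ⟨j, hj, hji⟩ := List.mem_iff_getElem.1 hm
  refine ⟨j, by simpa using hj, ?_⟩
  rw [← cs.wordProd_mul_getD_rightInvSeq, List.getD_eq_getElem _ _ hj, hji]

/-- The deletion condition: every word has a reduced subword with the same product. -/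
theorem exists_sublist_isReduced (ω : List B) :
    ∃ ω', ω'.Sublist ω ∧ cs.IsReduced ω' ∧ cs.wordProd ω' = cs.wordProd ω := by
  induction ω using List.reverseRecOn with
  | nil => exact ⟨[], by simp, by simp [CoxeterSystem.IsReduced], rfl⟩
  | append_singleton ω i ih =>
    obtain ⟨α, hs, hr, hp⟩ := ih
    rcases cs.length_mul_simple (cs.wordProd α) i with h | h
    · refine ⟨α ++ [i], hs.append_right _, ?_, ?_⟩
      · rw [CoxeterSystem.IsReduced, ← List.concat_eq_append, cs.wordProd_concat, h, hr]
        simp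
      · rw [cs.wordProd_append, cs.wordProd_append, hp]
    · obtain ⟨j, hj, he⟩ := exists_eraseIdx_of_isRightDescent cs α i
        (by unfold CoxeterSystem.IsRightDescent; omega)
      refine ⟨α.eraseIdx j, ((List.eraseIdx_sublist _ _).trans hs).trans
        (List.sublist_append_left _ _), ?_, ?_⟩
      · have h1 := List.length_eraseIdx_add_one hj
        rw [CoxeterSystem.IsReduced, ← he]
        have := hr.eq
        omega
      · rw [← he, hp, cs.wordProd_append, cs.wordProd_singleton]

theorem mem_parabolic_of_mem {σ : Finset B} {i : B} (h : i ∈ σ) :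
    cs.simple i ∈ parabolic cs σ :=
  Subgroup.subset_closure ⟨i, h, rfl⟩

theorem parabolic_mono {τ σ : Finset B} (h : τ ⊆ σ) : parabolic cs τ ≤ parabolic cs σ :=
  Subgroup.closure_mono (Set.image_mono (by exact_mod_cast h))

theorem wordProd_mem_parabolic {σ : Finset B} {ω : List B} (h : ∀ i ∈ ω, i ∈ σ) :
    cs.wordProd ω ∈ parabolic cs σ := by
  induction ω with
  | nil => simp [one_mem]
  | cons i ω ih =>
    rw [cs.wordProd_cons]
    exact mul_mem (mem_parabolic_of_mem cs (h i (by simp))) (ih fun j hj => h j (by simp [hj]))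

/-- Every element of a parabolic subgroup has a reduced word in the given generators. -/
theorem exists_isReduced_of_mem_parabolic {σ : Finset B} {w : W} (hw : w ∈ parabolic cs σ) :
    ∃ ω, (∀ i ∈ ω, i ∈ σ) ∧ cs.IsReduced ω ∧ cs.wordProd ω = w := by
  have : ∃ ω, (∀ i ∈ ω, i ∈ σ) ∧ cs.wordProd ω = w := by
    induction hw using Subgroup.closure_induction with
    | mem x hx =>
      obtain ⟨i, hi, rfl⟩ := hx
      exact ⟨[i], by simpa using hi, by simp⟩
    | one => exact ⟨[], by simp, by simp⟩
    | mul x y _ _ hx hy =>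
      obtain ⟨α, hα, rfl⟩ := hx
      obtain ⟨β, hβ, rfl⟩ := hy
      refine ⟨α ++ β, ?_, cs.wordProd_append _ _⟩
      simp only [List.mem_append]
      rintro i (h | h)
      exacts [hα i h, hβ i h]
    | inv x _ hx =>
      obtain ⟨α, hα, rfl⟩ := hx
      exact ⟨α.reverse, by simpa using hα, cs.wordProd_reverse _⟩
  obtain ⟨ω, hω, rfl⟩ := this
  obtain ⟨ω', hs, hr, hp⟩ := exists_sublist_isReduced cs ω
  exact ⟨ω', fun i hi => hω i (hs.subset hi), hr, hp⟩

/-- Lengths add up in the coset decomposition of a parabolic subgroup. -/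
theorem length_mul_of_minimal {τ : Finset B} {x u : W}
    (hx : ∀ w ∈ parabolic cs τ, cs.length x ≤ cs.length (x * w)) (hu : u ∈ parabolic cs τ) :
    cs.length (x * u) = cs.length x + cs.length u := by
  obtain ⟨α, hα, rfl⟩ := cs.exists_isReduced x
  obtain ⟨β, hβτ, hβ, rfl⟩ := exists_isReduced_of_mem_parabolic cs hu
  obtain ⟨γ, hs, hr, hp⟩ := exists_sublist_isReduced cs (α ++ β)
  obtain ⟨α', β', rfl, hα', hβ'⟩ := List.sublist_append_iff.1 hs
  rw [cs.wordProd_append, cs.wordProd_append] at hp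
  have hβm : cs.wordProd β' ∈ parabolic cs τ :=
    wordProd_mem_parabolic cs fun i hi => hβτ i (hβ'.subset hi)
  -- The element represented by `α'` lies in the coset `x W_τ`, so minimality of `x` forbids any
  -- deletion from `α`; then no letter of `β` can be deleted either.
  have h1 := hx (cs.wordProd β * (cs.wordProd β')⁻¹) (mul_mem hu (inv_mem hβm))
  rw [← mul_assoc, ← hp, mul_inv_cancel_right] at h1
  have h2 := cs.length_wordProd_le α'
  have h3 := hα.eq
  have hαα : α' = α := hα'.eq_of_length_le (by omega)
  subst hαα
  have h4 : cs.wordProd β' = cs.wordProd β := mul_left_cancel hp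
  have h5 := cs.length_wordProd_le β'
  rw [h4, hβ.eq] at h5
  have hββ : β' = β := hβ'.eq_of_length_le h5
  subst hββ
  rw [← cs.wordProd_append, hr.eq, hα.eq, hβ.eq, List.length_append]

/-- Reading the word from right to left, each letter either leads to another coset, with level
raised by at most one, or is absorbed into `W_τ`. Thus the level of the coset reached is at most the
length of the word. -/
theorem exists_coset_of_word {ι : Type*} {τ σ : Finset B} (x : ι → W) (lev : ι → ℕ)
    (i₀ : ι) (hx₀ : x i₀ = 1) (hl₀ : lev i₀ = 0)
    (step : ∀ i, ∀ j ∈ σ, (∃ l, cs.simple j * x i = x l ∧ lev l ≤ lev i + 1) ∨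
      ∃ t ∈ τ, cs.simple j * x i = x i * cs.simple t)
    (ω : List B) (hω : ∀ j ∈ ω, j ∈ σ) :
    ∃ i, ∃ u ∈ parabolic cs τ, cs.wordProd ω = x i * u ∧ lev i ≤ ω.length := by
  induction ω with
  | nil => exact ⟨i₀, 1, one_mem _, by simp [hx₀], by simp [hl₀]⟩
  | cons j ω ih =>
    obtain ⟨i, u, hu, hp, hl⟩ := ih fun k hk => hω k (by simp [hk])
    rw [cs.wordProd_cons, hp, ← mul_assoc]
    rcases step i j (hω j (by simp)) with ⟨l, h, hle⟩ | ⟨t, ht, h⟩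
    · exact ⟨l, u, hu, by rw [h], by rw [List.length_cons]; omega⟩
    · exact ⟨i, cs.simple t * u, mul_mem (mem_parabolic_of_mem cs ht) hu,
        by rw [h, mul_assoc], by rw [List.length_cons]; omega⟩

/-- The decomposition of a parabolic subgroup `W_σ` into cosets of `W_τ`, and the corresponding
factorization of the Poincaré polynomial, from a family of coset representatives that is closed
under the generators up to `W_τ`. -/
theorem finite_and_poincarePolynomial_eq {ι : Type*} [Fintype ι] {τ σ : Finset B} (hτσ : τ ⊆ σ)
    (hfin : Finite (parabolic cs τ)) (x : ι → W) (lev : ι → ℕ)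
    (i₀ : ι) (hx₀ : x i₀ = 1) (hl₀ : lev i₀ = 0) (hmem : ∀ i, x i ∈ parabolic cs σ)
    (step : ∀ i, ∀ j ∈ σ, (∃ l, cs.simple j * x i = x l ∧ lev l ≤ lev i + 1) ∨
      ∃ t ∈ τ, cs.simple j * x i = x i * cs.simple t)
    (hlen : ∀ i, cs.length (x i) ≤ lev i)
    (inj : ∀ i l, ∀ u ∈ parabolic cs τ, x i = x l * u → i = l) :
    Finite (parabolic cs σ) ∧
      poincarePolynomial cs σ = (∑ i, (X : ℚ[X]) ^ lev i) * poincarePolynomial cs τ := by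
  -- The level bounds the length from below on the whole coset. Together with `hlen` this makes `x
  -- i` a minimal representative of length exactly `lev i`.
  have key : ∀ i, ∀ u ∈ parabolic cs τ, lev i ≤ cs.length (x i * u) := by
    intro i u hu
    obtain ⟨ω, hω, hr, hp⟩ := exists_isReduced_of_mem_parabolic cs
      (mul_mem (hmem i) (parabolic_mono cs hτσ hu))
    obtain ⟨l, u', hu', hp', hl⟩ := exists_coset_of_word cs x lev i₀ hx₀ hl₀ step ω hω
    have : i = l := inj i l (u' * u⁻¹) (mul_mem hu' (inv_mem hu)) (by
      rw [← mul_assoc, ← hp', hp, mul_inv_cancel_right])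
    rw [this, ← this, ← hp, hr.eq, this]
    exact hl
  have hlev : ∀ i, cs.length (x i) = lev i := fun i =>
    le_antisymm (hlen i) (by simpa using key i 1 (one_mem _))
  have hadd : ∀ i, ∀ u ∈ parabolic cs τ, cs.length (x i * u) = lev i + cs.length u := by
    intro i u hu
    rw [length_mul_of_minimal cs _ hu, hlev]
    intro w hw
    rw [hlev]; exact key i w hw
  let F : ι × parabolic cs τ → parabolic cs σ := fun p =>
    ⟨x p.1 * p.2, mul_mem (hmem p.1) (parabolic_mono cs hτσ p.2.2)⟩
  have hF : Function.Bijective F := by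
    constructor
    · rintro ⟨i, u, hu⟩ ⟨l, v, hv⟩ h
      have h' : x i * u = x l * v := congrArg Subtype.val h
      obtain rfl : i = l := inj i l (v * u⁻¹) (mul_mem hv (inv_mem hu)) (by
        rw [← mul_assoc, ← h', mul_inv_cancel_right])
      simpa using h'
    · rintro ⟨w, hw⟩
      obtain ⟨ω, hω, hr, hp⟩ := exists_isReduced_of_mem_parabolic cs hw
      obtain ⟨l, u', hu', hp', hl⟩ := exists_coset_of_word cs x lev i₀ hx₀ hl₀ step ω hω
      exact ⟨(l, ⟨u', hu'⟩), Subtype.ext (hp'.symm.trans hp)⟩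
  have := hfin
  refine ⟨Finite.of_surjective F hF.2, ?_⟩
  have := Fintype.ofFinite (parabolic cs τ)
  unfold poincarePolynomial
  rw [← finsum_eq_of_bijective (f := fun p : ι × parabolic cs τ =>
    (X : ℚ[X]) ^ lev p.1 * X ^ cs.length (p.2 : W)) F hF (fun p => by
      simp only [F, hadd p.1 p.2 p.2.2, pow_add]), finsum_eq_sum_of_fintype,
    finsum_eq_sum_of_fintype, Fintype.sum_mul_sum, Fintype.sum_prod_type]

end Exchange

/-! ### Multiplicity of cyclotomic polynomials in Poincaré polynomials. -/

section Weight

/-- The geometric sum `1 + q + ⋯ + q ^ (L - 1)` is divisible at most once by `φ_d`. -/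
theorem emultiplicity_cyclotomic_geom_sum {d L : ℕ} (hd : 2 ≤ d) (hL : L ≠ 0) :
    emultiplicity (cyclotomic d ℚ) (∑ i ∈ Finset.range L, (X : ℚ[X]) ^ i) =
      ((if d ∣ L then 1 else 0 : ℕ) : ℕ∞) := by
  have hirr : Irreducible (cyclotomic d ℚ) := cyclotomic.irreducible_rat (by omega)
  have hmul : (∑ i ∈ Finset.range L, (X : ℚ[X]) ^ i) * (X - 1) = X ^ L - 1 := geom_sum_mul X L
  split_ifs with h
  · refine emultiplicity_eq_coe.2 ⟨by
      simpa using cyclotomic_dvd_geom_sum_of_dvd ℚ h (by omega : d ≠ 1), fun hdvd => ?_⟩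
    have hsq : Squarefree ((X : ℚ[X]) ^ L - 1) :=
      (separable_X_pow_sub_C (1 : ℚ) (by exact_mod_cast hL) one_ne_zero).squarefree
    refine hirr.not_isUnit (hsq _ ?_)
    rw [← pow_two, ← hmul]
    exact hdvd.mul_right _
  · rw [Nat.cast_zero, emultiplicity_eq_zero]
    intro hdvd
    have h1 : cyclotomic d ℚ ∣ ∏ i ∈ L.divisors, cyclotomic i ℚ := by
      rw [prod_cyclotomic_eq_X_pow_sub_one (by omega), ← hmul]
      exact hdvd.mul_right _
    obtain ⟨e, he, hde⟩ := (Prime.dvd_finsetProd_iff hirr.prime _).1 h1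
    have hed : d ≠ e := by rintro rfl; exact h (Nat.dvd_of_mem_divisors he)
    exact hirr.not_isUnit ((cyclotomic.isCoprime_rat hed).isUnit_of_dvd' dvd_rfl hde)

variable {B W : Type*} [Group W] {M : CoxeterMatrix B} (cs : CoxeterSystem M W)

/-- `W_σ` is finite of `φ_d`-weight `w`. -/
def HasWeight (d : ℕ) (σ : Finset B) (w : ℕ) : Prop :=
  Finite (parabolic cs σ) ∧
    emultiplicity (cyclotomic d ℚ) (poincarePolynomial cs σ) = (w : ℕ∞)

variable {cs}

theorem HasWeight.weight_eq {d : ℕ} {σ : Finset B} {w : ℕ} (h : HasWeight cs d σ w) :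
    weight cs d σ = w :=
  multiplicity_eq_of_emultiplicity_eq_some h.2

variable (cs)

theorem hasWeight_empty {d : ℕ} (hd : 2 ≤ d) : HasWeight cs d ∅ 0 := by
  have h : parabolic cs ∅ = ⊥ := by simp [parabolic]
  have hirr : Irreducible (cyclotomic d ℚ) := cyclotomic.irreducible_rat (by omega)
  refine ⟨by rw [h]; infer_instance, ?_⟩
  have : poincarePolynomial cs ∅ = 1 := by
    unfold poincarePolynomial
    rw [h, finsum_eq_sum_of_fintype]
    have : cs.length ((default : (⊥ : Subgroup W)) : W) = 0 := by
      rw [cs.length_eq_zero_iff]; exact (default : (⊥ : Subgroup W)).2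
    simp [this]
  rw [this, Nat.cast_zero, emultiplicity_eq_zero]
  exact fun h => hirr.not_isUnit (isUnit_of_dvd_one h)

variable {cs}

theorem HasWeight.of_cosets {d : ℕ} (hd : 2 ≤ d) {ι : Type*} [Fintype ι] {τ σ : Finset B} {w m : ℕ}
    (hw : HasWeight cs d τ w) (hτσ : τ ⊆ σ) (x : ι → W) (lev : ι → ℕ)
    (i₀ : ι) (hx₀ : x i₀ = 1) (hl₀ : lev i₀ = 0) (hmem : ∀ i, x i ∈ parabolic cs σ)
    (step : ∀ i, ∀ j ∈ σ, (∃ l, cs.simple j * x i = x l ∧ lev l ≤ lev i + 1) ∨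
      ∃ t ∈ τ, cs.simple j * x i = x i * cs.simple t)
    (hlen : ∀ i, cs.length (x i) ≤ lev i)
    (inj : ∀ i l, ∀ u ∈ parabolic cs τ, x i = x l * u → i = l)
    (hm : emultiplicity (cyclotomic d ℚ) (∑ i, (X : ℚ[X]) ^ lev i) = m) :
    HasWeight cs d σ (w + m) := by
  have hirr : Irreducible (cyclotomic d ℚ) := cyclotomic.irreducible_rat (by omega)
  obtain ⟨h1, h2⟩ := finite_and_poincarePolynomial_eq cs hτσ hw.1 x lev i₀ hx₀ hl₀ hmem step hlen
    inj
  refine ⟨h1, ?_⟩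
  rw [h2, emultiplicity_mul hirr.prime, hm, hw.2, add_comm, Nat.cast_add]

end Weight

/-! ### The affine action of the group of type `B̃ₙ`. -/

/-- The action of the `i`-th generator of the affine Weyl group of type `B̃ₙ` on affine functionals
`e xⱼ + k`, given as triples `(j, e, k)`. -/
def affineStep (n i : ℕ) (y : ℕ × ℤ × ℤ) : ℕ × ℤ × ℤ :=
  -- The generator `0` is the reflection in `x₁ + x₂ = 1`, that is `x₁ ↦ 1 - x₂`, `x₂ ↦ 1 - x₁`; the
  -- generator `n` changes the sign of `xₙ`; the others interchange `xᵢ` and `xᵢ₊₁`.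
  if i = 0 then
    if y.1 = 1 then (2, -y.2.1, y.2.2 + y.2.1)
    else if y.1 = 2 then (1, -y.2.1, y.2.2 + y.2.1) else y
  else if i = n then
    if y.1 = n then (n, -y.2.1, y.2.2) else y
  else if y.1 = i then (i + 1, y.2) else if y.1 = i + 1 then (i, y.2) else y

theorem affineStep_involutive (n i : ℕ) : Function.Involutive (affineStep n i) := by
  rintro ⟨j, e, k⟩
  unfold affineStep
  grind

theorem affineStep_comm {n i j : ℕ} (hn : 3 ≤ n) (hij : i < j) (h : ¬ ForkEdge i j)
    (y) : affineStep n i (affineStep n j y) = affineStep n j (affineStep n i y) := by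
  obtain ⟨l, e, k⟩ := y
  simp only [ForkEdge] at h
  unfold affineStep
  grind

theorem affineStep_braid {n i : ℕ} (hi : i + 1 < n) (h0 : 0 < i)
    (y) : affineStep n i (affineStep n (i+1) (affineStep n i y)) = affineStep n (i+1) (affineStep n i (affineStep n (i+1) y)) := by
  obtain ⟨l, e, k⟩ := y
  unfold affineStep
  grind

theorem affineStep_braid_zero {n : ℕ} (hn : 3 ≤ n) 
    (y) : affineStep n 0 (affineStep n 2 (affineStep n 0 y)) = affineStep n 2 (affineStep n 0 (affineStep n 2 y)) := by
  obtain ⟨l, e, k⟩ := y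
  unfold affineStep
  grind

theorem affineStep_braid_last {n : ℕ} (hn : 2 ≤ n) 
    (y) : affineStep (n+1) n (affineStep (n+1) (n+1) (affineStep (n+1) n (affineStep (n+1) (n+1) y))) = affineStep (n+1) (n+1) (affineStep (n+1) n (affineStep (n+1) (n+1) (affineStep (n+1) n y))) := by
  obtain ⟨l, e, k⟩ := y
  unfold affineStep
  grind

section AffineAction

variable {W : Type*} [Group W] {n : ℕ} (cs : CoxeterSystem (affineB n) W)

/-- The set of the elements of `Fin (n + 1)` whose value is in `σ`. -/
def toFin (n : ℕ) (σ : Finset ℕ) : Finset (Fin (n + 1)) := Finset.univ.filter fun i => (i : ℕ) ∈ σ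

@[simp] theorem mem_toFin {σ : Finset ℕ} {i : Fin (n + 1)} : i ∈ toFin n σ ↔ (i : ℕ) ∈ σ := by
  simp [toFin]

theorem toFin_subset {τ σ : Finset ℕ} (h : τ ⊆ σ) : toFin n τ ⊆ toFin n σ := fun i hi => by
  rw [mem_toFin] at *; exact h hi

/-- The generators of a Coxeter system of type `B̃ₙ`, indexed by natural numbers. -/
noncomputable def gen (i : ℕ) : W := if h : i < n + 1 then cs.simple ⟨i, h⟩ else 1

theorem gen_eq {i : ℕ} (h : i < n + 1) : gen cs i = cs.simple ⟨i, h⟩ := dif_pos h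

@[simp] theorem gen_val (i : Fin (n + 1)) : gen cs i = cs.simple i := dif_pos i.2

theorem affineB_apply (i j : Fin (n + 1)) : affineB n i j =
    if i = j then 1
    else if ForkEdge i j ∨ ForkEdge j i then (if (i : ℕ) = n ∨ (j : ℕ) = n then 4 else 3)
    else 2 := rfl

theorem gen_comm {i j : ℕ} (hi : i ≤ n) (hj : j ≤ n) (h : ¬ ForkEdge i j) (h' : ¬ ForkEdge j i) :
    gen cs i * gen cs j = gen cs j * gen cs i := by
  rw [gen_eq cs (Nat.lt_succ_of_le hi), gen_eq cs (Nat.lt_succ_of_le hj)]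
  by_cases hij : i = j
  · subst hij; rfl
  have h2 := cs.simple_mul_simple_pow ⟨i, Nat.lt_succ_of_le hi⟩ ⟨j, Nat.lt_succ_of_le hj⟩
  rw [affineB_apply, if_neg (by simpa using hij), if_neg (fun hf => hf.elim h h'), pow_two] at h2
  have := congrArg (fun y => cs.simple ⟨i, Nat.lt_succ_of_le hi⟩ * y *
    cs.simple ⟨j, Nat.lt_succ_of_le hj⟩) h2
  simpa [mul_assoc] using this.symm

theorem gen_braid {i j : ℕ} (hi : i < n) (hj : j < n) (h : ForkEdge i j ∨ ForkEdge j i) :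
    gen cs i * (gen cs j * gen cs i) = gen cs j * (gen cs i * gen cs j) := by
  rw [gen_eq cs (Nat.lt_succ_of_lt hi), gen_eq cs (Nat.lt_succ_of_lt hj)]
  have hij : i ≠ j := by simp only [ForkEdge] at h; omega
  have h2 := cs.simple_mul_simple_pow ⟨i, Nat.lt_succ_of_lt hi⟩ ⟨j, Nat.lt_succ_of_lt hj⟩
  rw [affineB_apply, if_neg (by simpa using hij), if_pos (by simpa using h),
    if_neg (by simp; omega), pow_three] at h2
  have := congrArg (fun y => y * cs.simple ⟨j, Nat.lt_succ_of_lt hj⟩ *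
    cs.simple ⟨i, Nat.lt_succ_of_lt hi⟩ * cs.simple ⟨j, Nat.lt_succ_of_lt hj⟩) h2
  simpa [mul_assoc] using this

theorem gen_braid_last {i j : ℕ} (hi : i ≤ n) (hj : j ≤ n) (hn : i = n ∨ j = n)
    (h : ForkEdge i j ∨ ForkEdge j i) :
    gen cs i * (gen cs j * (gen cs i * gen cs j)) =
      gen cs j * (gen cs i * (gen cs j * gen cs i)) := by
  rw [gen_eq cs (Nat.lt_succ_of_le hi), gen_eq cs (Nat.lt_succ_of_le hj)]
  have hij : i ≠ j := by simp only [ForkEdge] at h; omega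
  have h2 := cs.simple_mul_simple_pow ⟨i, Nat.lt_succ_of_le hi⟩ ⟨j, Nat.lt_succ_of_le hj⟩
  rw [affineB_apply, if_neg (by simpa using hij), if_pos (by simpa using h),
    if_pos (by simpa using hn), pow_succ', pow_three] at h2
  have := congrArg (fun y => y * cs.simple ⟨j, Nat.lt_succ_of_le hj⟩ *
    cs.simple ⟨i, Nat.lt_succ_of_le hi⟩ * cs.simple ⟨j, Nat.lt_succ_of_le hj⟩ *
    cs.simple ⟨i, Nat.lt_succ_of_le hi⟩) h2
  simpa [mul_assoc] using this

/-- The permutation of the affine functionals given by a generator. -/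
def affinePerm (n i : ℕ) : Equiv.Perm (ℕ × ℤ × ℤ) where
  toFun := affineStep n i
  invFun := affineStep n i
  left_inv := affineStep_involutive n i
  right_inv := affineStep_involutive n i

theorem affinePerm_mul_self (n i : ℕ) : affinePerm n i * affinePerm n i = 1 := by
  ext1 y; exact affineStep_involutive n i y

theorem isLiftable_affinePerm (hn : 3 ≤ n) :
    (affineB n).IsLiftable fun i => affinePerm n i := by
  have hsq := affinePerm_mul_self n
  have hsq' : ∀ i x, affinePerm n i * (affinePerm n i * x) = x := fun i x => by
    rw [← mul_assoc, hsq, one_mul]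
  have key : ∀ i j : ℕ, i < j → j ≤ n →
      (affinePerm n i * affinePerm n j) ^
        (if ForkEdge i j ∨ ForkEdge j i then (if i = n ∨ j = n then 4 else 3) else 2) = 1 := by
    intro i j hij hj
    split_ifs with h1 h2
    · obtain ⟨m, rfl⟩ : ∃ m, n = m + 1 := ⟨n - 1, by omega⟩
      obtain rfl : j = m + 1 := by omega
      obtain rfl : m = i := by simp only [ForkEdge] at h1; omega
      have e : affinePerm (m + 1) m * (affinePerm (m + 1) (m + 1) *
          (affinePerm (m + 1) m * affinePerm (m + 1) (m + 1))) = affinePerm (m + 1) (m + 1) *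
          (affinePerm (m + 1) m * (affinePerm (m + 1) (m + 1) * affinePerm (m + 1) m)) := by
        ext1 y; exact affineStep_braid_last (by omega) y
      rw [pow_succ, pow_three]
      simp only [mul_assoc]
      rw [e]
      simp only [hsq', hsq]
    · have e : affinePerm n i * (affinePerm n j * affinePerm n i) =
          affinePerm n j * (affinePerm n i * affinePerm n j) := by
        ext1 y
        rcases h1 with h1 | h1 <;> simp only [ForkEdge] at h1
        · rcases h1 with ⟨rfl, rfl⟩ | ⟨h0, rfl⟩
          · exact affineStep_braid_zero hn y
          · exact affineStep_braid (by omega) h0 y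
        · omega
      rw [pow_three]
      simp only [mul_assoc]
      rw [← e]
      simp only [hsq', hsq]
    · have : affinePerm n i * affinePerm n j = affinePerm n j * affinePerm n i :=
        Equiv.ext (affineStep_comm hn hij fun h => h1 (Or.inl h))
      rw [pow_two]
      nth_rw 2 [this]
      simp only [mul_assoc, hsq', hsq]
  intro i j
  rw [affineB_apply]
  rcases lt_trichotomy (i : ℕ) j with h | h | h
  · rw [if_neg (Fin.ne_of_lt h)]
    exact key i j h (by omega)
  · obtain rfl := Fin.ext h
    rw [if_pos rfl, pow_one, hsq]
  · have := key j i h (by omega)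
    rw [if_neg (Fin.ne_of_gt h), ← inv_eq_one, ← inv_pow, mul_inv_rev]
    have hinv : ∀ i, (affinePerm n i)⁻¹ = affinePerm n i := fun i => inv_eq_of_mul_eq_one_left (hsq i)
    rw [hinv, hinv]
    simpa only [or_comm] using this

/-- The action of an affine Coxeter group of type `B̃ₙ` on affine functionals. -/
noncomputable def affineHom (hn : 3 ≤ n) : W →* Equiv.Perm (ℕ × ℤ × ℤ) :=
  cs.lift ⟨_, isLiftable_affinePerm hn⟩

theorem affineHom_gen (hn : 3 ≤ n) {i : ℕ} (hi : i ≤ n) (y : ℕ × ℤ × ℤ) :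
    affineHom cs hn (gen cs i) y = affineStep n i y := by
  rw [gen_eq cs (Nat.lt_succ_of_le hi), affineHom, cs.lift_apply_simple]; rfl

/-- The image of a functional fixed by `W_τ` depends only on the coset `x W_τ`; this is how
different cosets are distinguished. -/
theorem affineHom_apply_of_mem_parabolic (hn : 3 ≤ n) {τ : Finset ℕ} {y : ℕ × ℤ × ℤ}
    (hy : ∀ t ∈ τ, affineStep n t y = y) {u : W} (hu : u ∈ parabolic cs (toFin n τ)) :
    affineHom cs hn u y = y := by
  induction hu using Subgroup.closure_induction with
  | mem x hx =>
    obtain ⟨i, hi, rfl⟩ := hx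
    rw [← gen_val cs i, affineHom_gen cs hn (by omega)]
    exact hy _ (by simpa using hi)
  | one => simp
  | mul x z _ _ hx hz => rw [map_mul, Equiv.Perm.mul_apply, hz, hx]
  | inv x _ hx => rw [map_inv, Equiv.Perm.inv_eq_iff_eq, hx]

end AffineAction

/-! ### Coset spaces forming a path: types `A` and `B`. -/

section Path

variable {W : Type*} [Group W] {n : ℕ} (cs : CoxeterSystem (affineB n) W)

/-- The product `s_{c (i - 1)} ⋯ s_{c 1} s_{c 0}`. -/
noncomputable def pathProd (c : ℕ → ℕ) : ℕ → W
  | 0 => 1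
  | i + 1 => gen cs (c i) * pathProd c i

/-- Multiplication by `s_j` fixes the coset of `x` in the simplest possible way. -/
def Fixes (τ : Finset ℕ) (x : W) (j : ℕ) : Prop := ∃ t ∈ τ, gen cs j * x = x * gen cs t

/-- The vertices `i`, `j` of the graph of type `B̃ₙ` are not joined. -/
def Unlinked (n i j : ℕ) : Prop := i ≤ n ∧ j ≤ n ∧ ¬ ForkEdge i j ∧ ¬ ForkEdge j i

/-- The vertices `i`, `j` of the graph of type `B̃ₙ` are joined by an edge without label. -/
def Linked (n i j : ℕ) : Prop := i < n ∧ j < n ∧ (ForkEdge i j ∨ ForkEdge j i)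

/-- The vertices `i`, `j` of the graph of type `B̃ₙ` are joined by the edge with label `4`. -/
def LinkedLast (n i j : ℕ) : Prop :=
  i ≤ n ∧ j ≤ n ∧ (i = n ∨ j = n) ∧ (ForkEdge i j ∨ ForkEdge j i)

/-- The local rules that allow one to pass from `x` to `s x`. -/
theorem fixes_pathProd {τ : Finset ℕ} {c : ℕ → ℕ} {L : ℕ} {N : ℕ → ℕ → Prop}
    (h₀ : ∀ j, N 0 j → j ∈ τ)
    (hs : ∀ i < L, ∀ j, N (i + 1) j → (Unlinked n j (c i) ∧ N i j) ∨
      (1 ≤ i ∧ j = c (i - 1) ∧ Linked n j (c i) ∧ N (i - 1) (c i)) ∨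
      (2 ≤ i ∧ j = c (i - 1) ∧ c i = c (i - 2) ∧ LinkedLast n j (c i) ∧ N (i - 2) j)) :
    ∀ i ≤ L, ∀ j, N i j → Fixes cs τ (pathProd cs c i) j := by
  intro i
  induction i using Nat.strong_induction_on with
  | _ i ih =>
    intro hi j hj
    rcases i with _ | i
    · exact ⟨j, h₀ j hj, by simp [pathProd]⟩
    -- The generator `s_j` is moved to the right through the last letters of the path: past one
    -- letter by commutation, past two by the braid relation (where it becomes `s_(c i)`), or past
    -- three by the relation of length four. Each time the question is reduced to a shorter path.
    rcases hs i hi j hj with ⟨⟨h1, h2, h3, h4⟩, h⟩ | ⟨h1, h2, ⟨h3, h4, h5⟩, h⟩ |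
      ⟨h1, h2, h3, ⟨h4, h5, h6, h7⟩, h⟩
    · obtain ⟨t, ht, he⟩ := ih i (by omega) (by omega) j h
      refine ⟨t, ht, ?_⟩
      rw [pathProd, ← mul_assoc, gen_comm cs h1 h2 h3 h4, mul_assoc, he, mul_assoc]
    · obtain ⟨i, rfl⟩ : ∃ l, i = l + 1 := ⟨i - 1, by omega⟩
      rw [Nat.add_sub_cancel] at h2 h
      obtain ⟨t, ht, he⟩ := ih i (by omega) (by omega) _ h
      refine ⟨t, ht, ?_⟩
      have hb := gen_braid cs h3 h4 h5
      have : pathProd cs c (i + 1 + 1) = gen cs (c (i + 1)) * (gen cs j * pathProd cs c i) := by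
        rw [h2]; rfl
      rw [this]
      calc gen cs j * (gen cs (c (i + 1)) * (gen cs j * pathProd cs c i))
          = gen cs j * (gen cs (c (i + 1)) * gen cs j) * pathProd cs c i := by
            simp only [mul_assoc]
        _ = gen cs (c (i + 1)) * (gen cs j * (gen cs (c (i + 1)) * pathProd cs c i)) := by
            rw [hb]; simp only [mul_assoc]
        _ = _ := by rw [he]; simp only [mul_assoc]
    · obtain ⟨i, rfl⟩ : ∃ l, i = l + 2 := ⟨i - 2, by omega⟩
      rw [Nat.add_sub_cancel] at h3 h
      obtain ⟨t, ht, he⟩ := ih i (by omega) (by omega) _ h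
      refine ⟨t, ht, ?_⟩
      have hb := gen_braid_last cs h4 h5 h6 h7
      have : pathProd cs c (i + 2 + 1) =
          gen cs (c i) * (gen cs j * (gen cs (c i) * pathProd cs c i)) := by
        rw [h2]
        change gen cs (c (i + 2)) * _ = _
        rw [h3]; rfl
      rw [h3] at hb
      rw [this]
      calc gen cs j * (gen cs (c i) * (gen cs j * (gen cs (c i) * pathProd cs c i)))
          = gen cs j * (gen cs (c i) * (gen cs j * gen cs (c i))) * pathProd cs c i := by
            simp only [mul_assoc]
        _ = gen cs (c i) * (gen cs j * (gen cs (c i) * (gen cs j * pathProd cs c i))) := by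
            rw [hb]; simp only [mul_assoc]
        _ = _ := by rw [he]; simp only [mul_assoc]

theorem length_pathProd_le {c : ℕ → ℕ} {L : ℕ} (hc : ∀ i < L, c i ≤ n) :
    ∀ i ≤ L, cs.length (pathProd cs c i) ≤ i := by
  intro i
  induction i with
  | zero => intro _; simp [pathProd]
  | succ i ih =>
    intro hi
    have h1 := cs.length_mul_le (gen cs (c i)) (pathProd cs c i)
    rw [gen_eq cs (Nat.lt_succ_of_le (hc i hi)), cs.length_simple] at h1
    have h2 := ih (by omega)
    rw [pathProd, gen_eq cs (Nat.lt_succ_of_le (hc i hi))]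
    omega

theorem gen_mem_parabolic {σ : Finset ℕ} {i : ℕ} (hi : i ∈ σ) (hn : i ≤ n) :
    gen cs i ∈ parabolic cs (toFin n σ) := by
  rw [gen_eq cs (Nat.lt_succ_of_le hn)]
  exact mem_parabolic_of_mem cs (by simpa using hi)

theorem pathProd_mem_parabolic {σ : Finset ℕ} {c : ℕ → ℕ} {L : ℕ} (hc : ∀ i < L, c i ∈ σ)
    (hσ : ∀ j ∈ σ, j ≤ n) : ∀ i ≤ L, pathProd cs c i ∈ parabolic cs (toFin n σ) := by
  intro i
  induction i with
  | zero => intro _; exact one_mem _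
  | succ i ih =>
    intro hi
    exact mul_mem (gen_mem_parabolic cs (hc i hi) (hσ _ (hc i hi))) (ih (by omega))

theorem affineHom_pathProd (hn : 3 ≤ n) {c : ℕ → ℕ} {L : ℕ} {y : ℕ → ℕ × ℤ × ℤ}
    (hc : ∀ i < L, c i ≤ n) (hy : ∀ i < L, affineStep n (c i) (y i) = y (i + 1)) :
    ∀ i ≤ L, affineHom cs hn (pathProd cs c i) (y 0) = y i := by
  intro i
  induction i with
  | zero => intro _; simp [pathProd]
  | succ i ih =>
    intro hi
    rw [pathProd, map_mul, Equiv.Perm.mul_apply, ih (by omega), affineHom_gen cs hn (hc i hi),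
      hy i hi]

variable {cs}

/-- The weight of a parabolic subgroup whose cosets of a smaller parabolic subgroup form a path. -/
theorem HasWeight.of_path {d : ℕ} (hd : 2 ≤ d) (hn : 3 ≤ n) {σ : Finset ℕ} {w : ℕ}
    (L : ℕ) (c : ℕ → ℕ) (y : ℕ → ℕ × ℤ × ℤ)
    (hw : HasWeight cs d (toFin n (σ.erase (c 0))) w) (hσ : ∀ j ∈ σ, j ≤ n) (hL : 1 ≤ L)
    (hc : ∀ i < L, c i ∈ σ) (hy : ∀ t ∈ σ, t ≠ c 0 → affineStep n t (y 0) = y 0)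
    (hstep : ∀ i < L, affineStep n (c i) (y i) = y (i + 1))
    (hinj : ∀ i ≤ L, ∀ l ≤ L, y i = y l → i = l)
    (hs : ∀ i < L, ∀ j ∈ σ, j ≠ c i → (i + 1 < L → j ≠ c (i + 1)) →
      (1 ≤ i ∧ j = c (i - 1) ∧ Linked n j (c i) ∧ c i ≠ c (i - 1) ∧ (2 ≤ i → c i ≠ c (i - 2))) ∨
      (2 ≤ i ∧ j = c (i - 1) ∧ c i = c (i - 2) ∧ LinkedLast n j (c i) ∧ j ≠ c (i - 2) ∧
        (3 ≤ i → j ≠ c (i - 3))) ∨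
      Unlinked n j (c i) ∧ (1 ≤ i → j ≠ c (i - 1))) :
    HasWeight cs d (toFin n σ) (w + if d ∣ L + 1 then 1 else 0) := by
  -- `N i j` says that `j` is neither the next nor the previous letter at position `i`. The next
  -- letter moves forward and the previous one backward along the path; all others must fix the
  -- coset.
  have hfix := fixes_pathProd cs (τ := σ.erase (c 0)) (c := c) (L := L)
    (N := fun i j => j ∈ σ ∧ (i < L → j ≠ c i) ∧ (1 ≤ i → j ≠ c (i - 1)))
    (fun j hj => Finset.mem_erase.2 ⟨hj.2.1 (by omega), hj.1⟩) (by
      rintro i hi j ⟨hj, h1, h2⟩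
      have h2 : j ≠ c i := h2 (by omega)
      rcases hs i hi j hj h2 h1 with ⟨k1, k2, k3, k4, k5⟩ | ⟨k1, k2, k3, k4, k5, k6⟩ | ⟨k1, k2⟩
      · exact Or.inr (Or.inl ⟨k1, k2, k3, hc i hi, fun _ => k4, fun h => by
          rw [Nat.sub_sub]; exact k5 (by omega)⟩)
      · exact Or.inr (Or.inr ⟨k1, k2, k3, k4, hj, fun _ => k5, fun h => by
          rw [Nat.sub_sub]; exact k6 (by omega)⟩)
      · exact Or.inl ⟨k1, hj, fun _ => h2, k2⟩)
  have hcn : ∀ i < L, c i ≤ n := fun i hi => hσ _ (hc i hi)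
  refine hw.of_cosets hd (toFin_subset (Finset.erase_subset _ _))
    (fun i : Fin (L + 1) => pathProd cs c i) (fun i => i) 0 rfl rfl
    (fun i => pathProd_mem_parabolic cs hc hσ i (by omega)) ?_
    (fun i => length_pathProd_le cs hcn i (by omega)) ?_ ?_
  · intro i j hj
    rw [mem_toFin] at hj
    by_cases hj1 : i < L ∧ (j : ℕ) = c i
    · exact Or.inl ⟨⟨i + 1, by omega⟩, by rw [← gen_val cs j, hj1.2]; rfl, le_rfl⟩
    by_cases hj2 : 1 ≤ (i : ℕ) ∧ (j : ℕ) = c (i - 1)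
    · refine Or.inl ⟨⟨i - 1, by omega⟩, ?_, by simp only; omega⟩
      obtain ⟨h, he⟩ := hj2
      obtain ⟨i, hi⟩ := i
      obtain ⟨i, rfl⟩ : ∃ l, i = l + 1 := ⟨i - 1, by simp only at h; omega⟩
      simp only [Nat.add_sub_cancel] at he ⊢
      rw [← gen_val cs j, he, pathProd, gen_eq cs (Nat.lt_succ_of_le (hcn i (by omega))),
        cs.simple_mul_simple_cancel_left]
    · obtain ⟨t, ht, he⟩ := hfix i (by omega) j
        ⟨hj, fun h h' => hj1 ⟨h, h'⟩, fun h h' => hj2 ⟨h, h'⟩⟩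
      refine Or.inr ⟨⟨t, Nat.lt_succ_of_le (hσ t (Finset.mem_of_mem_erase ht))⟩,
        by simpa using ht, ?_⟩
      rw [← gen_val cs j, he, gen_eq]
  · intro i l u hu he
    -- The functional `y 0` is fixed by the smaller parabolic subgroup, and the `i`-th
    -- representative moves it to `y i`; the `y i` are distinct.
    have h1 := congrArg (fun x => affineHom cs hn x (y 0)) he
    simp only [map_mul, Equiv.Perm.mul_apply] at h1
    rw [affineHom_apply_of_mem_parabolic cs hn
        (fun t ht => hy t (Finset.mem_of_mem_erase ht) (Finset.ne_of_mem_erase ht)) hu,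
      affineHom_pathProd cs hn hcn hstep i (by omega),
      affineHom_pathProd cs hn hcn hstep l (by omega)] at h1
    exact Fin.ext (hinj i (by omega) l (by omega) h1)
  · rw [Fin.sum_univ_eq_sum_range (fun i => (X : ℚ[X]) ^ i),
      emultiplicity_cyclotomic_geom_sum hd (by omega)]

/-- The block `{a, …, b}` is of type `A` and loses its end vertex `b`. The remaining generators fix
`x_{b+1}`, whose orbit `x_{b+1}, x_b, …, x_a` indexes the `b - a + 2` cosets. The condition on the
`j < a` says that nothing else is joined to the block. -/
theorem HasWeight.insert_max_linear {d : ℕ} (hd : 2 ≤ d) (hn : 3 ≤ n) {σ : Finset ℕ} {w a b : ℕ}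
    (ha : 1 ≤ a) (hab : a ≤ b) (hbn : b < n) (hσ : ∀ j ∈ σ, j ≤ b)
    (hI : ∀ j, a ≤ j → j ≤ b → j ∈ σ) (ha' : ∀ j ∈ σ, j < a → j + 1 < a ∧ (a = 2 → j ≠ 0))
    (hw : HasWeight cs d (toFin n (σ.erase b)) w) :
    HasWeight cs d (toFin n σ) (w + if d ∣ b - a + 2 then 1 else 0) := by
  refine hw.of_path hd hn (b - a + 1) (fun i => b - i) (fun i => (b + 1 - i, 1, 0))
    (fun j hj => (hσ j hj).trans hbn.le) (by omega) ?_ ?_ ?_ ?_ ?_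
  · intro i hi
    exact hI _ (by omega) (by omega)
  · intro t ht ht'
    have := hσ t ht
    unfold affineStep
    grind
  · intro i hi
    unfold affineStep
    grind
  · intro i hi l hl h
    simp only [Prod.mk.injEq] at h
    omega
  · rintro i hi j hj h1 h2
    have := ha' j hj
    have := hσ j hj
    by_cases hj' : 1 ≤ i ∧ j = b - (i - 1)
    · refine Or.inl ⟨hj'.1, hj'.2, ⟨?_, ?_, ?_⟩, ?_, ?_⟩
      · omega
      · omega
      · simp only [ForkEdge]; omega
      · omega
      · omega
    · refine Or.inr (Or.inr ⟨⟨?_, ?_, ?_, ?_⟩, fun h h' => hj' ⟨h, h'⟩⟩)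
      · omega
      · omega
      · simp only [ForkEdge]; omega
      · simp only [ForkEdge]; omega

/-- The vertices `b, b - 1, …, 2, 0` form a diagram of type `A` passing through `0`; the orbit is
`x_{b+1}, …, x_2, 1 - x_1`. For `b = 1` the set is `{0}` and the only letter is `0`, hence the
conditional. -/
theorem HasWeight.insert_max_zero {d : ℕ} (hd : 2 ≤ d) (hn : 3 ≤ n) {σ : Finset ℕ} {w b : ℕ}
    (hb : 1 ≤ b) (hbn : b < n) (hσ : ∀ j, j ∈ σ ↔ j ≤ b ∧ j ≠ 1)
    (hw : HasWeight cs d (toFin n (σ.erase (if b = 1 then 0 else b))) w) :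
    HasWeight cs d (toFin n σ) (w + if d ∣ b + 1 then 1 else 0) := by
  obtain ⟨c, hc⟩ : ∃ c : ℕ → ℕ, ∀ i, (i + 1 = b ∧ c i = 0) ∨ (i + 1 ≠ b ∧ c i = b - i) :=
    ⟨fun i => if i + 1 = b then 0 else b - i, fun i => by grind⟩
  refine HasWeight.of_path hd hn b c (fun i => if i = b then (1, -1, 1) else (b + 1 - i, 1, 0))
    ?_ (fun j hj => ((hσ j).1 hj).1.trans hbn.le) hb ?_ ?_ ?_ ?_ ?_
  · convert hw using 4
    grind
  · intro i hi
    rw [hσ]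
    have := hc i
    omega
  · intro t ht ht'
    rw [hσ] at ht
    have := hc 0
    unfold affineStep
    grind
  · intro i hi
    have := hc i
    unfold affineStep
    grind
  · intro i hi l hl h
    grind
  · rintro i hi j hj h1 h2
    rw [hσ] at hj
    have := hc i
    have := hc (i - 1)
    by_cases hj' : 1 ≤ i ∧ j = c (i - 1)
    · refine Or.inl ⟨hj'.1, hj'.2, ⟨?_, ?_, ?_⟩, ?_, ?_⟩
      · omega
      · omega
      · simp only [ForkEdge]; omega
      · omega
      · intro; have := hc (i - 2); omega
    · have := hc (i + 1)
      refine Or.inr (Or.inr ⟨⟨?_, ?_, ?_, ?_⟩, fun h h' => hj' ⟨h, h'⟩⟩)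
      · omega
      · omega
      · simp only [ForkEdge]; omega
      · simp only [ForkEdge]; omega

/-- The block `{a, …, n}` is of type `B_k` with `k = n - a + 1` and loses its inner end. The orbit
of `x_a` is `x_a, …, x_n, -x_n, …, -x_a`, with `2k` elements; the letters go from `a` up to `n` and
back. -/
theorem HasWeight.insert_start_linear {d : ℕ} (hd : 2 ≤ d) (hn : 3 ≤ n) {σ : Finset ℕ} {w a : ℕ}
    (ha : 1 ≤ a) (han : a ≤ n) (hσ : ∀ j ∈ σ, j ≤ n)
    (hI : ∀ j, a ≤ j → j ≤ n → j ∈ σ) (ha' : ∀ j ∈ σ, j < a → j + 1 < a ∧ (a = 2 → j ≠ 0))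
    (hw : HasWeight cs d (toFin n (σ.erase a)) w) :
    HasWeight cs d (toFin n σ) (w + if d ∣ 2 * (n - a + 1) then 1 else 0) := by
  obtain ⟨c, hc⟩ : ∃ c : ℕ → ℕ, ∀ i,
      (i ≤ n - a ∧ c i = a + i) ∨ (n - a < i ∧ c i = 2 * n - a - i) :=
    ⟨fun i => if i ≤ n - a then a + i else 2 * n - a - i, fun i => by grind⟩
  have hc0 : c 0 = a := by have := hc 0; omega
  have := HasWeight.of_path (cs := cs) (w := w) hd hn (σ := σ) (2 * (n - a) + 1) c
    (fun i => if i ≤ n - a then (a + i, 1, 0) else (2 * n - a - i + 1, -1, 0))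
    (by rwa [hc0]) hσ (by omega) ?_ ?_ ?_ ?_ ?_
  · rwa [show 2 * (n - a) + 1 + 1 = 2 * (n - a + 1) by ring] at this
  · intro i hi
    have := hc i
    exact hI _ (by omega) (by omega)
  · intro t ht ht'
    have := ha' t ht
    unfold affineStep
    grind
  · intro i hi
    have := hc i
    unfold affineStep
    grind
  · intro i hi l hl h
    grind
  · rintro i hi j hj h1 h2
    have := ha' j hj
    have := hσ j hj
    have := hc i
    have := hc (i - 1)
    by_cases hj' : 1 ≤ i ∧ j = c (i - 1)
    · by_cases hi' : i = n - a + 1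
      · refine Or.inr (Or.inl ⟨?_, hj'.2, ?_, ⟨?_, ?_, ?_, ?_⟩, ?_, ?_⟩)
        · have := hc (i + 1); omega
        · have := hc (i - 2); have := hc (i + 1); omega
        · omega
        · omega
        · omega
        · simp only [ForkEdge]; have := hc (i + 1); omega
        · have := hc (i - 2); omega
        · intro; have := hc (i - 3); omega
      · refine Or.inl ⟨hj'.1, hj'.2, ⟨?_, ?_, ?_⟩, ?_, ?_⟩
        · omega
        · have := hc (i + 1); omega
        · simp only [ForkEdge]; omega
        · omega
        · intro; have := hc (i - 2); omega
    · have := hc (i + 1)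
      refine Or.inr (Or.inr ⟨⟨?_, ?_, ?_, ?_⟩, fun h h' => hj' ⟨h, h'⟩⟩)
      · omega
      · omega
      · simp only [ForkEdge]; omega
      · simp only [ForkEdge]; omega

/-- Type `B_n` with inner end `0`: the orbit is `1 - x_1, x_2, …, x_n, -x_n, …, -x_2, x_1 - 1`. -/
theorem HasWeight.insert_start_zero {d : ℕ} (hd : 2 ≤ d) (hn : 3 ≤ n) {σ : Finset ℕ} {w : ℕ}
    (hσ : ∀ j, j ∈ σ ↔ j ≤ n ∧ j ≠ 1)
    (hw : HasWeight cs d (toFin n (σ.erase 0)) w) :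
    HasWeight cs d (toFin n σ) (w + if d ∣ 2 * n then 1 else 0) := by
  obtain ⟨c, hc⟩ : ∃ c : ℕ → ℕ, ∀ i,
      ((i = 0 ∨ i = 2 * n - 2) ∧ c i = 0) ∨ (0 < i ∧ i < n ∧ c i = i + 1) ∨
      (n ≤ i ∧ i ≠ 2 * n - 2 ∧ c i = 2 * n - 1 - i) :=
    ⟨fun i => if i = 0 ∨ i = 2 * n - 2 then 0 else if i < n then i + 1 else 2 * n - 1 - i,
      fun i => by grind⟩
  have hc0 : c 0 = 0 := by have := hc 0; omega
  have := HasWeight.of_path (cs := cs) (w := w) hd hn (σ := σ) (2 * n - 1) c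
    (fun i => if i = 0 then (1, -1, 1) else if i < n then (i + 1, 1, 0) else
      if i = 2 * n - 1 then (1, 1, -1) else (2 * n - i, -1, 0))
    (by rwa [hc0]) (fun j hj => ((hσ j).1 hj).1) (by omega) ?_ ?_ ?_ ?_ ?_
  · rwa [show 2 * n - 1 + 1 = 2 * n by omega] at this
  · intro i hi
    have := hc i
    rw [hσ]
    omega
  · intro t ht ht'
    rw [hσ] at ht
    unfold affineStep
    grind
  · intro i hi
    have := hc i
    unfold affineStep
    grind
  · intro i hi l hl h
    grind
  · rintro i hi j hj h1 h2
    rw [hσ] at hj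
    have := hc i
    have := hc (i - 1)
    by_cases hj' : 1 ≤ i ∧ j = c (i - 1)
    · by_cases hi' : i = n
      · refine Or.inr (Or.inl ⟨?_, hj'.2, ?_, ⟨?_, ?_, ?_, ?_⟩, ?_, ?_⟩)
        · have := hc (i + 1); omega
        · have := hc (i - 2); have := hc (i + 1); omega
        · omega
        · omega
        · omega
        · simp only [ForkEdge]; have := hc (i + 1); omega
        · have := hc (i - 2); omega
        · intro; have := hc (i - 3); omega
      · refine Or.inl ⟨hj'.1, hj'.2, ⟨?_, ?_, ?_⟩, ?_, ?_⟩
        · omega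
        · have := hc (i + 1); omega
        · simp only [ForkEdge]; omega
        · omega
        · intro; have := hc (i - 2); omega
    · have := hc (i + 1)
      refine Or.inr (Or.inr ⟨⟨?_, ?_, ?_, ?_⟩, fun h h' => hj' ⟨h, h'⟩⟩)
      · omega
      · omega
      · simp only [ForkEdge]; omega
      · simp only [ForkEdge]; omega

end Path

/-! ### Coset spaces in type `D`. -/

section Fork

variable {W : Type*} [Group W] {n : ℕ} (cs : CoxeterSystem (affineB n) W)

theorem pathProd_congr {c c' : ℕ → ℕ} {L : ℕ} (h : ∀ i < L, c i = c' i) :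
    pathProd cs c L = pathProd cs c' L := by
  induction L with
  | zero => rfl
  | succ L ih => rw [pathProd, pathProd, h L (by omega), ih fun i hi => h i (by omega)]

/-- The letters of a path through a diagram of type `D` with vertices `0, …, b`: from `b` down to
`2`, then `e`, then `1 - e`, then from `2` up to `b`. -/
def forkLetters (b e i : ℕ) : ℕ :=
  if i + 1 < b then b - i else if i + 1 = b then e else if i = b then 1 - e else i + 1 - b

theorem forkLetters_spec (b e i : ℕ) :
    (i + 1 < b ∧ forkLetters b e i = b - i) ∨ (i + 1 = b ∧ forkLetters b e i = e) ∨
    (i = b ∧ forkLetters b e i = 1 - e) ∨ (b < i ∧ forkLetters b e i = i + 1 - b) := by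
  unfold forkLetters
  grind

/-- Besides the neighbouring letters of the path, two kinds of letters are excluded. At level `b -
1` both `0` and `1` leave the coset. Beyond the fork the letter `e` escapes the local rules for this
order of `0` and `1`; it is treated with the opposite order, which gives the same group elements
there since `s_0` and `s_1` commute. -/
theorem fixes_fork {b e : ℕ} (hb : 2 ≤ b) (hbn : b < n) (he : e ≤ 1) :
    ∀ i ≤ 2 * b, ∀ j, (j ≤ b ∧ (i < 2 * b → j ≠ forkLetters b e i) ∧
      (1 ≤ i → j ≠ forkLetters b e (i - 1)) ∧ (i = b - 1 → 2 ≤ j) ∧ (b + 1 ≤ i → j ≠ e)) →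
      Fixes cs (Finset.range b) (pathProd cs (forkLetters b e) i) j := by
  refine fixes_pathProd cs ?_ ?_
  · rintro j ⟨h1, h2, -⟩
    have := forkLetters_spec b e 0
    rw [Finset.mem_range]
    omega
  · rintro i hi j ⟨h1, h2, h3, h4, h5⟩
    rw [Nat.add_sub_cancel] at h3
    have h6 := forkLetters_spec b e i
    have h7 := forkLetters_spec b e (i - 1)
    by_cases hj : 1 ≤ i ∧ j = forkLetters b e (i - 1)
    · refine Or.inr (Or.inl ⟨hj.1, hj.2, ⟨?_, ?_, ?_⟩, ?_, ?_, ?_, ?_, ?_⟩)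
      · omega
      · omega
      · simp only [ForkEdge]; omega
      · omega
      · omega
      · have := forkLetters_spec b e (i - 1 - 1); omega
      · omega
      · omega
    · have h8 := forkLetters_spec b e (i + 1)
      refine Or.inl ⟨⟨?_, ?_, ?_, ?_⟩, ?_, ?_, ?_, ?_, ?_⟩
      · omega
      · omega
      · simp only [ForkEdge]; omega
      · simp only [ForkEdge]; omega
      · omega
      · omega
      · exact fun h h' => hj ⟨h, h'⟩
      · omega
      · omega

theorem pathProd_forkLetters_of_lt {b e e' i : ℕ} (hi : i < b) :
    pathProd cs (forkLetters b e) i = pathProd cs (forkLetters b e') i :=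
  pathProd_congr cs fun l hl => by
    have := forkLetters_spec b e l
    have := forkLetters_spec b e' l
    omega

theorem pathProd_forkLetters_succ {b e : ℕ} (hb : 2 ≤ b) (hbn : b < n) (he : e ≤ 1) :
    pathProd cs (forkLetters b e) (b + 1) =
      gen cs (1 - e) * (gen cs e * pathProd cs (forkLetters b 0) (b - 1)) := by
  obtain ⟨b, rfl⟩ : ∃ l, b = l + 1 := ⟨b - 1, by omega⟩
  have h1 := forkLetters_spec (b + 1) e (b + 1)
  have h2 := forkLetters_spec (b + 1) e b
  rw [pathProd, pathProd, show forkLetters (b + 1) e (b + 1) = 1 - e by omega,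
    show forkLetters (b + 1) e b = e by omega, Nat.add_sub_cancel,
    pathProd_forkLetters_of_lt cs (e' := 0) (by omega)]

theorem gen_zero_gen_one (hn : 3 ≤ n) : gen cs 0 * gen cs 1 = gen cs 1 * gen cs 0 :=
  gen_comm cs (by omega) (by omega) (by simp) (by simp)

theorem gen_mul_gen {i : ℕ} (hi : i ≤ n) (x : W) : gen cs i * (gen cs i * x) = x := by
  rw [gen_eq cs (Nat.lt_succ_of_le hi), cs.simple_mul_simple_cancel_left]

theorem pathProd_forkLetters_of_gt {b i : ℕ} (hn : 3 ≤ n) (hb : 2 ≤ b) (hbn : b < n)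
    (hi : b + 1 ≤ i) :
    pathProd cs (forkLetters b 0) i = pathProd cs (forkLetters b 1) i := by
  induction i, hi using Nat.le_induction with
  | base =>
    rw [pathProd_forkLetters_succ cs hb hbn (by omega),
      pathProd_forkLetters_succ cs hb hbn (by omega), ← mul_assoc, ← mul_assoc, Nat.sub_self,
      Nat.sub_zero, gen_zero_gen_one cs hn]
  | succ i hi ih =>
    have h1 := forkLetters_spec b 0 i
    have h2 := forkLetters_spec b 1 i
    rw [pathProd, pathProd, ih, show forkLetters b 0 i = forkLetters b 1 i by omega]

/-- The sum is `(1 + q^b)[b+1] = [2b][b+1]/[b]`. Multiplying by `[b]` avoids the division, and `hm`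
is written additively for the same reason. -/
theorem emultiplicity_cyclotomic_fork {d b m : ℕ} (hd : 2 ≤ d) (hb : 1 ≤ b)
    (hm : m + (if d ∣ b then 1 else 0) = (if d ∣ 2 * b then 1 else 0) + if d ∣ b + 1 then 1 else 0) :
    emultiplicity (cyclotomic d ℚ) ((∑ i ∈ Finset.range (2 * b + 1), (X : ℚ[X]) ^ i) + X ^ b) =
      (m : ℕ∞) := by
  have hp : Prime (cyclotomic d ℚ) := (cyclotomic.irreducible_rat (by omega)).prime
  have key : ((∑ i ∈ Finset.range (2 * b + 1), (X : ℚ[X]) ^ i) + X ^ b) *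
      (∑ i ∈ Finset.range b, (X : ℚ[X]) ^ i) =
      (∑ i ∈ Finset.range (2 * b), (X : ℚ[X]) ^ i) * (∑ i ∈ Finset.range (b + 1), X ^ i) := by
    have h1 : (X - 1 : ℚ[X]) ≠ 0 := X_sub_C_ne_zero 1
    refine mul_right_cancel₀ h1 (mul_right_cancel₀ h1 ?_)
    have e := fun k => geom_sum_mul (X : ℚ[X]) k
    calc _ = ((∑ i ∈ Finset.range (2 * b + 1), (X : ℚ[X]) ^ i) * (X - 1) + X ^ b * (X - 1)) *
          ((∑ i ∈ Finset.range b, (X : ℚ[X]) ^ i) * (X - 1)) := by ring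
      _ = ((∑ i ∈ Finset.range (2 * b), (X : ℚ[X]) ^ i) * (X - 1)) *
          ((∑ i ∈ Finset.range (b + 1), X ^ i) * (X - 1)) := by rw [e, e, e, e]; ring
      _ = _ := by ring
  have h := congrArg (emultiplicity (cyclotomic d ℚ)) key
  rw [emultiplicity_mul hp, emultiplicity_mul hp, emultiplicity_cyclotomic_geom_sum hd (by omega),
    emultiplicity_cyclotomic_geom_sum hd (by omega),
    emultiplicity_cyclotomic_geom_sum hd (by omega), ← Nat.cast_add, ← hm, Nat.cast_add] at h
  exact (ENat.add_left_injective_of_ne_top (ENat.natCast_ne_top _)) h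

variable {cs}

/-- The orbit of `x_{b+1}` is `x_{b+1}, …, x_2`, then `x_1` and `1 - x_1` side by side at level `b`,
then `1 - x_2, …, 1 - x_{b+1}`. So the cosets are those of the path through `0` first, plus one
more, reached from level `b - 1` by `1` and from level `b + 1` by `0`. -/
theorem HasWeight.insert_max_fork {d : ℕ} (hd : 2 ≤ d) (hn : 3 ≤ n) {w b m : ℕ}
    (hb : 2 ≤ b) (hbn : b < n)
    (hm : m + (if d ∣ b then 1 else 0) = (if d ∣ 2 * b then 1 else 0) + if d ∣ b + 1 then 1 else 0)
    (hw : HasWeight cs d (toFin n (Finset.range b)) w) :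
    HasWeight cs d (toFin n (Finset.range (b + 1))) (w + m) := by
  have hspec := forkLetters_spec b
  have hc : ∀ e ≤ 1, ∀ i < 2 * b, forkLetters b e i ∈ Finset.range (b + 1) := by
    intro e he i hi
    have := hspec e i
    rw [Finset.mem_range]
    omega
  have hcn : ∀ e ≤ 1, ∀ i < 2 * b, forkLetters b e i ≤ n := by
    intro e he i hi
    have := Finset.mem_range.1 (hc e he i hi)
    omega
  have hσ : ∀ j ∈ Finset.range (b + 1), j ≤ n := fun j hj => by
    have := Finset.mem_range.1 hj; omega
  have hfix : ∀ {x : W} {j : Fin (n + 1)}, Fixes cs (Finset.range b) x j →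
      ∃ t ∈ toFin n (Finset.range b), cs.simple j * x = x * cs.simple t := by
    rintro x j ⟨t, ht, h⟩
    have := Finset.mem_range.1 ht
    exact ⟨⟨t, by omega⟩, by simpa using ht, by rw [← gen_val cs j, h, gen_eq]⟩
  have hr : pathProd cs (forkLetters b 1) b =
      gen cs 1 * pathProd cs (forkLetters b 0) (b - 1) := by
    obtain ⟨b, rfl⟩ : ∃ l, b = l + 1 := ⟨b - 1, by omega⟩
    have := hspec 1 b
    rw [pathProd, show forkLetters (b + 1) 1 b = 1 by omega, Nat.add_sub_cancel,
      pathProd_forkLetters_of_lt cs (e' := 0) (by omega)]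
  have hz : pathProd cs (forkLetters b 0) (b + 1) =
      gen cs 0 * pathProd cs (forkLetters b 1) b := by
    rw [pathProd_forkLetters_succ cs hb hbn (by omega), hr, ← mul_assoc, ← mul_assoc, Nat.sub_zero,
      gen_zero_gen_one cs hn]
  let y : ℕ → ℕ × ℤ × ℤ := fun i => if i < b then (b + 1 - i, 1, 0) else (i - b + 1, -1, 1)
  have hy0 : ∀ t ∈ Finset.range b, affineStep n t (y 0) = y 0 := by
    intro t ht
    have := Finset.mem_range.1 ht
    simp only [y]
    unfold affineStep
    grind
  have hy : ∀ i < 2 * b, affineStep n (forkLetters b 0 i) (y i) = y (i + 1) := by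
    intro i hi
    have := hspec 0 i
    simp only [y]
    unfold affineStep
    grind
  have hyi : ∀ i l, i ≤ 2 * b → l ≤ 2 * b → y i = y l → i = l := by
    intro i l hi hl h
    simp only [y] at h
    split_ifs at h <;> simp only [Prod.mk.injEq] at h <;> omega
  have hyn : ∀ i, y i ≠ (1, 1, 0) := by
    intro i h
    simp only [y] at h
    split_ifs at h <;> simp only [Prod.mk.injEq] at h <;> omega
  have hact : ∀ i ≤ 2 * b, affineHom cs hn (pathProd cs (forkLetters b 0) i) (y 0) = y i :=
    affineHom_pathProd cs hn (hcn 0 (by omega)) hy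
  have hact' : affineHom cs hn (pathProd cs (forkLetters b 1) b) (y 0) = (1, 1, 0) := by
    rw [hr, map_mul, Equiv.Perm.mul_apply, hact _ (by omega), affineHom_gen cs hn (by omega)]
    have : y (b - 1) = (2, 1, 0) := by
      simp only [y]
      rw [if_pos (by omega), show b + 1 - (b - 1) = 2 by omega]
    rw [this]
    simp [affineStep, show (1 : ℕ) ≠ n by omega]
  refine hw.of_cosets (m := m) hd (toFin_subset (Finset.range_subset_range.2 (by omega)))
    (Sum.elim (fun i : Fin (2 * b + 1) => pathProd cs (forkLetters b 0) i)
      (fun _ : Unit => pathProd cs (forkLetters b 1) b))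
    (Sum.elim (fun i => i) (fun _ => b)) (Sum.inl 0) rfl rfl ?_ ?_ ?_ ?_ ?_
  · rintro (i | _)
    · exact pathProd_mem_parabolic cs (hc 0 (by omega)) hσ i (by omega)
    · exact pathProd_mem_parabolic cs (hc 1 le_rfl) hσ b (by omega)
  · rintro (⟨i, hi⟩ | _) j hj
    · rw [mem_toFin, Finset.mem_range] at hj
      simp only [Sum.elim_inl]
      by_cases hj1 : i < 2 * b ∧ (j : ℕ) = forkLetters b 0 i
      · exact Or.inl ⟨Sum.inl ⟨i + 1, by omega⟩, by rw [← gen_val cs j, hj1.2]; rfl, le_rfl⟩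
      by_cases hj2 : 1 ≤ i ∧ (j : ℕ) = forkLetters b 0 (i - 1)
      · refine Or.inl ⟨Sum.inl ⟨i - 1, by omega⟩, ?_, by simp only [Sum.elim_inl]; omega⟩
        obtain ⟨h, he⟩ := hj2
        obtain ⟨i, rfl⟩ : ∃ l, i = l + 1 := ⟨i - 1, by omega⟩
        simp only [Nat.add_sub_cancel, Sum.elim_inl] at he ⊢
        rw [← gen_val cs j, he, pathProd, gen_mul_gen cs (hcn 0 (by omega) i (by omega))]
      by_cases hj3 : i = b - 1 ∧ (j : ℕ) = 1
      · refine Or.inl ⟨Sum.inr (), ?_, by simp only [Sum.elim_inr]; omega⟩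
        rw [Sum.elim_inr, hr, ← gen_val cs j, hj3.2, hj3.1]
      by_cases hj4 : i = b + 1 ∧ (j : ℕ) = 0
      · refine Or.inl ⟨Sum.inr (), ?_, by simp only [Sum.elim_inr]; omega⟩
        rw [Sum.elim_inr, ← gen_val cs j, hj4.2, hj4.1, hz, gen_mul_gen cs (by omega)]
      refine Or.inr (hfix ?_)
      have h0 := hspec 0 i
      have h1 := hspec 0 (i - 1)
      -- For the letter `0` beyond the fork, the path is rewritten with `1` before `0`.
      by_cases hj5 : b + 1 ≤ i ∧ (j : ℕ) = 0
      · rw [pathProd_forkLetters_of_gt cs hn hb hbn hj5.1]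
        have h0 := hspec 1 i
        have h1 := hspec 1 (i - 1)
        refine fixes_fork cs hb hbn le_rfl i (by omega) j ⟨?_, ?_, ?_, ?_, ?_⟩ <;> omega
      · refine fixes_fork cs hb hbn (by omega) i (by omega) j ⟨?_, ?_, ?_, ?_, ?_⟩
        · omega
        · exact fun h h' => hj1 ⟨h, h'⟩
        · exact fun h h' => hj2 ⟨h, h'⟩
        · omega
        · omega
    · rw [mem_toFin, Finset.mem_range] at hj
      simp only [Sum.elim_inr]
      by_cases hj1 : (j : ℕ) = 0
      · refine Or.inl ⟨Sum.inl ⟨b + 1, by omega⟩, ?_, by simp⟩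
        rw [Sum.elim_inl, hz, ← gen_val cs j, hj1]
      by_cases hj2 : (j : ℕ) = 1
      · refine Or.inl ⟨Sum.inl ⟨b - 1, by omega⟩, ?_, by simp only [Sum.elim_inl]; omega⟩
        rw [Sum.elim_inl, hr, ← gen_val cs j, hj2, gen_mul_gen cs (by omega)]
      · have h0 := hspec 1 b
        have h1 := hspec 1 (b - 1)
        refine Or.inr (hfix (fixes_fork cs hb hbn le_rfl b (by omega) j ⟨?_, ?_, ?_, ?_, ?_⟩)) <;>
          omega
  · rintro (i | _)
    · exact length_pathProd_le cs (hcn 0 (by omega)) i (by omega)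
    · exact length_pathProd_le cs (hcn 1 le_rfl) b (by omega)
  · intro i l u hu he
    have h1 := congrArg (fun x => affineHom cs hn x (y 0)) he
    simp only [map_mul, Equiv.Perm.mul_apply] at h1
    rw [affineHom_apply_of_mem_parabolic cs hn hy0 hu] at h1
    rcases i with i | _ <;> rcases l with l | _
    · simp only [Sum.elim_inl] at h1
      rw [hact i (by omega), hact l (by omega)] at h1
      exact congrArg Sum.inl (Fin.ext (hyi _ _ (by omega) (by omega) h1))
    · simp only [Sum.elim_inl, Sum.elim_inr] at h1
      rw [hact i (by omega), hact'] at h1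
      exact absurd h1 (hyn _)
    · simp only [Sum.elim_inl, Sum.elim_inr] at h1
      rw [hact l (by omega), hact'] at h1
      exact absurd h1.symm (hyn _)
    · rfl
  · rw [Fintype.sum_sum_type]
    simp only [Sum.elim_inl, Sum.elim_inr, Finset.univ_unique, Finset.sum_singleton]
    rw [Fin.sum_univ_eq_sum_range (fun i => (X : ℚ[X]) ^ i)]
    exact emultiplicity_cyclotomic_fork hd (by omega) hm

/-- The base case `D_2 = A_1 × A_1`. The subgroup generated by `s_0` moves `x_1` only to `x_1` or `1
- x_2`, whereas `s_1` moves it to `x_2`; hence `s_1` represents a second coset. -/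
theorem HasWeight.zero_one {d : ℕ} (hd : 2 ≤ d) (hn : 3 ≤ n) {w : ℕ}
    (hw : HasWeight cs d (toFin n {0}) w) :
    HasWeight cs d (toFin n {0, 1}) (w + if d ∣ 2 then 1 else 0) := by
  have h01 := gen_zero_gen_one cs hn
  have hs : ∀ u ∈ parabolic cs (toFin n {0}), affineHom cs hn u (1, 1, 0) = (1, 1, 0) ∨
      affineHom cs hn u (1, 1, 0) = (2, -1, 1) := by
    intro u hu
    obtain ⟨ω, hω, -, rfl⟩ := exists_isReduced_of_mem_parabolic cs hu
    clear hu
    induction ω with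
    | nil => simp
    | cons i ω ih =>
      have hi : (i : ℕ) = 0 := by simpa using hω i (by simp)
      rw [cs.wordProd_cons, map_mul, Equiv.Perm.mul_apply, ← gen_val cs i, hi,
        affineHom_gen cs hn (by omega)]
      rcases ih fun j hj => hω j (by simp [hj]) with h | h <;> rw [h] <;> simp [affineStep]
  have hne : ∀ u ∈ parabolic cs (toFin n {0}), gen cs 1 ≠ u := by
    rintro u hu rfl
    have := hs _ hu
    rw [affineHom_gen cs hn (by omega)] at this
    unfold affineStep at this
    grind
  refine hw.of_cosets hd (toFin_subset (by simp)) (fun i : Bool => if i then gen cs 1 else 1)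
    (fun i => if i then 1 else 0) false rfl rfl ?_ ?_ ?_ ?_ ?_
  · rintro (_ | _)
    · exact one_mem _
    · exact gen_mem_parabolic cs (by simp) (by omega)
  · intro i j hj
    rw [mem_toFin, Finset.mem_insert, Finset.mem_singleton] at hj
    rcases hj with hj | hj
    · refine Or.inr ⟨j, by simpa using hj, ?_⟩
      rcases i with _ | _
      · simp
      · rw [if_pos rfl, ← gen_val cs j, hj, h01]
    · refine Or.inl ⟨!i, ?_, by cases i <;> simp⟩
      have h := gen_mul_gen cs (show 1 ≤ n by omega) 1
      rcases i with _ | _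
      · simp [← gen_val cs j, hj]
      · simpa [← gen_val cs j, hj] using h
  · rintro (_ | _)
    · simp
    · simp [gen_eq cs (show 1 < n + 1 by omega)]
  · intro i l u hu he
    rcases i with _ | _ <;> rcases l with _ | _
    · rfl
    · refine absurd ?_ (hne _ (inv_mem hu))
      simp only [Bool.false_eq_true, if_false, if_true] at he
      exact eq_inv_of_mul_eq_one_left he.symm
    · exact absurd (by simpa using he) (hne u hu)
    · rfl
  · have := emultiplicity_cyclotomic_geom_sum hd (two_ne_zero)
    rw [← this]
    simp [Finset.sum_range_succ, add_comm]

end Fork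

/-! ### Combinatorial formulas for the weights. -/

section CombinatorialWeight

/-- The length of the run of consecutive elements of `σ` that ends at `j`. -/
def run (σ : Finset ℕ) : ℕ → ℕ
  | 0 => if 0 ∈ σ then 1 else 0
  | j + 1 => if j + 1 ∈ σ then run σ j + 1 else 0

/-- The `φ_d`-weight of a simplex in type `A`. -/
def weightA (d : ℕ) (σ : Finset ℕ) : ℕ := ∑ j ∈ σ, if d ∣ run σ j + 1 then 1 else 0

theorem run_congr {σ σ' : Finset ℕ} {j : ℕ} (h : ∀ i ≤ j, i ∈ σ ↔ i ∈ σ') :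
    run σ j = run σ' j := by
  induction j with
  | zero => simp [run, h 0 le_rfl]
  | succ j ih => rw [run, run, ih fun i hi => h i (by omega)]; simp [h (j + 1) le_rfl]

theorem run_eq_zero {σ : Finset ℕ} {j : ℕ} (h : j ∉ σ) : run σ j = 0 := by
  cases j <;> simp [run, h]

theorem run_congr_of_notMem {σ σ' : Finset ℕ} {a j : ℕ} (ha : a ∉ σ) (ha' : a ∉ σ')
    (hj : a ≤ j) (h : ∀ i, a < i → i ≤ j → (i ∈ σ ↔ i ∈ σ')) : run σ j = run σ' j := by
  induction j, hj using Nat.le_induction with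
  | base => rw [run_eq_zero ha, run_eq_zero ha']
  | succ j hj ih =>
    rw [run, run, ih fun i hi hij => h i hi (by omega)]
    simp [h (j + 1) (by omega) le_rfl]

theorem weightA_empty (d : ℕ) : weightA d ∅ = 0 := rfl

theorem weightA_gap (d : ℕ) {σ : Finset ℕ} {a : ℕ} (ha : a ∉ σ) :
    weightA d σ = weightA d (σ.filter (· < a)) + weightA d (σ.filter (a < ·)) := by
  have h : σ = σ.filter (· < a) ∪ σ.filter (a < ·) := by
    ext x
    simp only [Finset.mem_union, Finset.mem_filter]
    have : x ∈ σ → x ≠ a := fun h h' => ha (h' ▸ h)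
    grind
  have hd : Disjoint (σ.filter (· < a)) (σ.filter (a < ·)) :=
    Finset.disjoint_filter.2 fun x _ h => by omega
  unfold weightA
  conv_lhs => rw [h, Finset.sum_union hd]
  rw [← h]
  congr 1
  · refine Finset.sum_congr rfl fun x hx => ?_
    rw [run_congr (σ' := σ.filter (· < a))]
    intro i hi
    have := (Finset.mem_filter.1 hx).2
    simp only [Finset.mem_filter]
    exact ⟨fun h => ⟨h, by omega⟩, fun h => h.1⟩
  · refine Finset.sum_congr rfl fun x hx => ?_
    rw [run_congr_of_notMem (σ' := σ.filter (a < ·)) ha (by simp)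
      (Finset.mem_filter.1 hx).2.le]
    intro i hi _
    simp only [Finset.mem_filter]
    exact ⟨fun h => ⟨h, hi⟩, fun h => h.1⟩

/-- `weightA` of a union of two sets separated by a gap. -/
theorem weightA_union (d : ℕ) {σ τ : Finset ℕ} {a : ℕ} (hσ : ∀ x ∈ σ, x < a)
    (hτ : ∀ x ∈ τ, a < x) : weightA d (σ ∪ τ) = weightA d σ + weightA d τ := by
  rw [weightA_gap d (a := a)]
  · congr 2
    · ext x
      simp only [Finset.mem_filter, Finset.mem_union]
      have := hσ x; have := hτ x
      grind
    · ext x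
      simp only [Finset.mem_filter, Finset.mem_union]
      have := hσ x; have := hτ x
      grind
  · intro h
    rcases Finset.mem_union.1 h with h | h
    · exact lt_irrefl _ (hσ a h)
    · exact lt_irrefl _ (hτ a h)

/-- The translation by `c`. -/
abbrev addEmb (c : ℕ) : ℕ ↪ ℕ := addRightEmbedding c

theorem weightA_map (d c : ℕ) {σ : Finset ℕ} (h₀ : 0 ∉ σ) :
    weightA d (σ.map (addEmb c)) = weightA d σ := by
  have h : ∀ j, run (σ.map (addEmb c)) (j + c) = run σ j := by
    intro j
    induction j with
    | zero => rw [run_eq_zero h₀, run_eq_zero (by simpa using h₀)]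
    | succ j ih => rw [add_right_comm, run, ih, run]; simp [add_right_comm j c 1]
  unfold weightA
  rw [Finset.sum_map]
  refine Finset.sum_congr rfl fun j _ => ?_
  rw [addRightEmbedding_apply, h]

theorem run_Ioo {a j : ℕ} (k : ℕ) (h : a + j < k) : run (Finset.Ioo a k) (a + j) = j := by
  induction j with
  | zero => exact run_eq_zero (by simp)
  | succ j ih =>
    rw [← add_assoc, run, ih (by omega), if_pos (by simp; omega)]

/-- The runs in the interval are `1, …, e - a - 1`, so the weight counts the multiples of `d` among
`2, …, e - a`; nothing is lost at `1` since `d ≥ 2`. -/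
theorem weightA_Ioo {d : ℕ} (hd : 2 ≤ d) {a e : ℕ} (h : a < e) :
    weightA d (Finset.Ioo a e) = (e - a) / d := by
  obtain ⟨k, rfl⟩ : ∃ k, e = a + k + 1 := ⟨e - a - 1, by omega⟩
  have h1 : weightA d (Finset.Ioo a (a + k + 1)) =
      ∑ j ∈ Finset.range k, if d ∣ j + 1 + 1 then 1 else 0 := by
    have h2 : Finset.Ioo a (a + k + 1) = (Finset.range k).map (addEmb (a + 1)) := by
      ext x
      simp only [Finset.mem_Ioo, Finset.mem_map, Finset.mem_range, addRightEmbedding_apply]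
      exact ⟨fun h => ⟨x - (a + 1), by omega, by omega⟩, by rintro ⟨y, hy, rfl⟩; omega⟩
    unfold weightA
    conv_lhs => rw [h2, Finset.sum_map, ← h2]
    refine Finset.sum_congr rfl fun j hj => ?_
    have := Finset.mem_range.1 hj
    rw [addRightEmbedding_apply, show j + (a + 1) = a + (j + 1) by ring, run_Ioo _ (by omega)]
  rw [h1, show a + k + 1 - a = k + 1 by omega]
  clear h h1
  induction k with
  | zero => simp [Nat.div_eq_of_lt (show 1 < d by omega)]
  | succ k ih => rw [Finset.sum_range_succ, ih, Nat.succ_div (a := k + 1)]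

/-- A maximal interval of `σ` between the gaps `a` and `e` contributes `(e - a) / d`. -/
theorem weightA_interval {d : ℕ} (hd : 2 ≤ d) {σ : Finset ℕ} {a e : ℕ} (hae : a < e) (ha : a ∉ σ)
    (he : e ∉ σ) (h : ∀ i, a < i → i < e → i ∈ σ) :
    weightA d σ = weightA d (σ.filter (· < a)) + (e - a) / d + weightA d (σ.filter (e < ·)) := by
  rw [weightA_gap d ha, weightA_gap d (σ := σ.filter (a < ·)) (a := e)
    (fun h => he (Finset.mem_filter.1 h).1), ← add_assoc, ← weightA_Ioo hd hae]
  have h1 : (σ.filter (a < ·)).filter (· < e) = Finset.Ioo a e := by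
    ext x
    simp only [Finset.mem_filter, Finset.mem_Ioo]
    have := h x
    grind
  have h2 : (σ.filter (a < ·)).filter (e < ·) = σ.filter (e < ·) := by
    ext x
    simp only [Finset.mem_filter]
    grind
  rw [h1, h2]

/-- The change of `weightA` when a gap is filled. -/
theorem weightA_insert {d : ℕ} (hd : 2 ≤ d) {σ : Finset ℕ} {a v e : ℕ} (hav : a < v) (hve : v < e)
    (ha : a ∉ σ) (hv : v ∉ σ) (he : e ∉ σ) (h1 : ∀ i, a < i → i < v → i ∈ σ)
    (h2 : ∀ i, v < i → i < e → i ∈ σ) :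
    weightA d (insert v σ) + (v - a) / d + (e - v) / d = weightA d σ + (e - a) / d := by
  have e1 := weightA_interval hd (σ := insert v σ) (hav.trans hve)
    (by simp only [Finset.mem_insert, not_or]; exact ⟨by omega, ha⟩)
    (by simp only [Finset.mem_insert, not_or]; exact ⟨by omega, he⟩)
    (fun i hi hi' => by
      rcases lt_trichotomy i v with h | h | h
      · exact Finset.mem_insert_of_mem (h1 i hi h)
      · simp [h]
      · exact Finset.mem_insert_of_mem (h2 i h hi'))
  have e2 := weightA_interval hd hav ha hv h1
  have e3 := weightA_interval hd (σ := σ.filter (v < ·)) hve (by simp)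
    (fun h => he (Finset.mem_filter.1 h).1) (fun i hi hi' => by simp [hi, h2 i hi hi'])
  have e4 : (σ.filter (v < ·)).filter (· < v) = ∅ := by ext x; simp; grind
  have e5 : (σ.filter (v < ·)).filter (e < ·) = σ.filter (e < ·) := by ext x; simp; grind
  have e6 : (insert v σ).filter (· < a) = σ.filter (· < a) := by
    ext x; simp only [Finset.mem_filter, Finset.mem_insert]; grind
  have e7 : (insert v σ).filter (e < ·) = σ.filter (e < ·) := by
    ext x; simp only [Finset.mem_filter, Finset.mem_insert]; grind
  rw [e4, e5, weightA_empty] at e3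
  rw [e6, e7] at e1
  omega

theorem weightA_insert_max {d : ℕ} (hd : 2 ≤ d) {σ : Finset ℕ} {a b : ℕ} (hab : a < b)
    (ha : a ∉ σ) (hσ : ∀ x ∈ σ, x < b) (h : ∀ i, a < i → i < b → i ∈ σ) :
    weightA d (insert b σ) = weightA d σ + if d ∣ b - a + 1 then 1 else 0 := by
  have := weightA_insert hd hab (Nat.lt_succ_self b) ha (fun h => lt_irrefl _ (hσ b h))
    (fun h => by have := hσ _ h; omega) h (fun i hi hi' => by omega)
  rw [show b.succ - b = 1 by omega, Nat.div_eq_of_lt (show 1 < d by omega),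
    show b.succ - a = b - a + 1 by omega, Nat.succ_div (a := b - a)] at this
  omega

/-- The number of the `i` with `1 ≤ i ≤ k` such that `d ∣ 2 i`: the `φ_d`-weight in type `B_k`. -/
def weightBlockB (d : ℕ) : ℕ → ℕ
  | 0 => 0
  | k + 1 => weightBlockB d k + if d ∣ 2 * (k + 1) then 1 else 0

/-- The `φ_d`-weight in type `D_k`, `k ≥ 2`. -/
def weightBlockD (d k : ℕ) : ℕ := weightBlockB d (k - 1) + if d ∣ k then 1 else 0

theorem weightBlockB_even (h k : ℕ) : weightBlockB (2 * h) k = k / h := by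
  induction k with
  | zero => simp [weightBlockB]
  | succ k ih =>
    rw [weightBlockB, ih, Nat.succ_div]
    simp only [Nat.mul_dvd_mul_iff_left (show 0 < 2 by norm_num)]

theorem weightBlockB_odd {d : ℕ} (hd : Odd d) (k : ℕ) : weightBlockB d k = k / d := by
  induction k with
  | zero => simp [weightBlockB]
  | succ k ih =>
    rw [weightBlockB, ih, Nat.succ_div]
    simp only [(Nat.coprime_two_right.2 hd).dvd_mul_left]

/-- The length of the longest interval `{1, …, k}` contained in `σ`. -/
noncomputable def prefixLength (σ : Finset ℕ) : ℕ := sInf {k | k + 1 ∉ σ}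

theorem prefixLength_eq {σ : Finset ℕ} {k : ℕ} (h : ∀ i, 1 ≤ i → i ≤ k → i ∈ σ) (hk : k + 1 ∉ σ) :
    prefixLength σ = k := by
  refine le_antisymm (Nat.sInf_le hk) (le_csInf ⟨k, hk⟩ fun l hl => ?_)
  by_contra hlt
  exact hl (h _ (by omega) (by omega))

theorem exists_prefix (σ : Finset ℕ) (v : ℕ) :
    ∃ e, v < e ∧ e ∉ σ ∧ ∀ i, v < i → i < e → i ∈ σ := by
  have hex : ∃ e, v < e ∧ e ∉ σ := by
    obtain ⟨e, he⟩ := Infinite.exists_notMem_finset (σ ∪ Finset.range (v + 1))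
    simp only [Finset.mem_union, Finset.mem_range, not_or] at he
    exact ⟨e, by omega, he.1⟩
  classical
  refine ⟨Nat.find hex, (Nat.find_spec hex).1, (Nat.find_spec hex).2, fun i hi hlt => ?_⟩
  have := Nat.find_min hex hlt
  simp only [not_and, not_not] at this
  exact this hi

/-- The relabelling `1, 3, 4, … ↦ 1, 2, 3, …`. -/
def relabelD (i : ℕ) : ℕ := if i = 1 then 1 else i - 1

/-- The `φ_d`-weight of a simplex in type `D`, with edges `1 - 3`, `2 - 3`, `3 - 4`, …. -/
noncomputable def weightD (d : ℕ) (σ : Finset ℕ) : ℕ :=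
  if 2 ∉ σ then weightA d (σ.image relabelD)
  else if 1 ∉ σ then weightA d σ
  -- Here `{1, 2} ⊆ σ`. The initial interval `{1, …, k}` is of type `D_k`, with the conventions `D_2
  -- = A_1 × A_1` and `D_3 = A_3`.
  else weightBlockD d (prefixLength σ) + weightA d (σ.filter (prefixLength σ < ·))

theorem weightD_of_prefix (d : ℕ) {σ : Finset ℕ} {k : ℕ} (hk : 2 ≤ k)
    (h : ∀ i, 1 ≤ i → i ≤ k → i ∈ σ) (hk' : k + 1 ∉ σ) :
    weightD d σ = weightBlockD d k + weightA d (σ.filter (k < ·)) := by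
  rw [weightD, if_neg (not_not.2 (h 2 (by omega) hk)), if_neg (not_not.2 (h 1 le_rfl (by omega))),
    prefixLength_eq h hk']

theorem weightD_of_two_notMem (d : ℕ) {σ : Finset ℕ} (h : 2 ∉ σ) :
    weightD d σ = weightA d (σ.image relabelD) := by rw [weightD, if_pos h]

theorem weightD_of_one_notMem (d : ℕ) {σ : Finset ℕ} (h : 2 ∈ σ) (h1 : 1 ∉ σ) :
    weightD d σ = weightA d σ := by rw [weightD, if_neg (not_not.2 h), if_pos h1]

/-- The length of the longest interval `{n - k + 1, …, n}` contained in `σ`. -/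
noncomputable def suffixLength (n : ℕ) (σ : Finset ℕ) : ℕ := sInf {k | n - k ∉ σ}

theorem suffixLength_eq {n : ℕ} {σ : Finset ℕ} {k : ℕ} (h : ∀ i, n - k < i → i ≤ n → i ∈ σ)
    (hk : n - k ∉ σ) (hkn : k ≤ n) : suffixLength n σ = k := by
  refine le_antisymm (Nat.sInf_le hk) (le_csInf ⟨k, hk⟩ fun l hl => ?_)
  by_contra hlt
  exact hl (h _ (by omega) (by omega))

/-- The `φ_d`-weight of a proper subset of `{0, …, n}` in type `B̃ₙ`. -/
noncomputable def weightB (d n : ℕ) (σ : Finset ℕ) : ℕ :=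
  -- In `{0, 2, …, n}` the component of `n` does not stop at `2` but continues to `0`, so it is not
  -- a final interval.
  if (Finset.range (n + 1)).erase 1 ⊆ σ then weightBlockB d n
  else weightBlockB d (suffixLength n σ) +
    weightD d ((σ.filter (· < n - suffixLength n σ)).map (addEmb 1))

theorem weightB_of_suffix (d : ℕ) {n : ℕ} {σ : Finset ℕ} {k : ℕ}
    (hσ : ¬ (Finset.range (n + 1)).erase 1 ⊆ σ) (h : ∀ i, n - k < i → i ≤ n → i ∈ σ)
    (hk : n - k ∉ σ) (hkn : k ≤ n) :
    weightB d n σ = weightBlockB d k + weightD d ((σ.filter (· < n - k)).map (addEmb 1)) := by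
  rw [weightB, if_neg hσ, suffixLength_eq h hk hkn]

end CombinatorialWeight

/-! ### Finiteness and weights of the proper parabolic subgroups. -/

section WeightFormula

theorem weightD_empty (d : ℕ) : weightD d ∅ = 0 := by
  rw [weightD_of_two_notMem d (by simp), Finset.image_empty, weightA_empty]

/-- The numerical counterpart of `HasWeight.insert_max_linear`. The last run is `{a + 1, …, j}`; for
`a = 2` it starts at `3`, which is joined to `1`, so `1` has to be absent. -/
theorem weightD_erase_max {d : ℕ} (hd : 2 ≤ d) {ρ : Finset ℕ} {a j : ℕ} (ha1 : 1 ≤ a) (haj : a < j)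
    (ha : a ∉ ρ) (h0 : 0 ∉ ρ) (hI : ∀ i, a < i → i ≤ j → i ∈ ρ) (hmax : ∀ x ∈ ρ, x ≤ j)
    (h2 : a = 2 → 1 ∉ ρ) :
    weightD d ρ = weightD d (ρ.erase j) + if d ∣ j - a + 1 then 1 else 0 := by
  obtain ⟨τ, hτ⟩ : ∃ τ, τ = ρ.erase j := ⟨_, rfl⟩
  have hj : j ∈ ρ := hI j haj le_rfl
  have hρ : ρ = insert j τ := by rw [hτ, Finset.insert_erase hj]
  have hmem : ∀ x, x ∈ τ ↔ x ≠ j ∧ x ∈ ρ := fun x => by rw [hτ, Finset.mem_erase]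
  have hlt : ∀ x ∈ τ, x < j := fun x hx => by
    have := (hmem x).1 hx
    have := hmax x this.2
    omega
  rw [← hτ]
  by_cases hρ2 : 2 ∈ ρ
  · by_cases hρ1 : 1 ∈ ρ
    · obtain ⟨e, he0, he, hpre⟩ := exists_prefix ρ 0
      have he3 : 3 ≤ e := by
        by_contra hlt
        have : e ≠ 1 := fun h => he (h ▸ hρ1)
        have : e ≠ 2 := fun h => he (h ▸ hρ2)
        omega
      have hea : e ≤ a := by
        by_contra hlt
        exact ha (hpre a (by omega) (by omega))
      rw [weightD_of_prefix d (k := e - 1) (by omega) (fun i hi hi' => hpre i (by omega) (by omega))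
        (by rwa [Nat.sub_add_cancel (by omega)]), weightD_of_prefix d (σ := τ) (k := e - 1)
        (by omega) (fun i hi hi' => (hmem i).2 ⟨by omega, hpre i (by omega) (by omega)⟩)
        (fun h => by
          rw [Nat.sub_add_cancel (by omega)] at h
          exact he ((hmem e).1 h).2)]
      have : ρ.filter (e - 1 < ·) = insert j (τ.filter (e - 1 < ·)) := by
        ext x
        simp only [Finset.mem_filter, Finset.mem_insert, hmem]
        have : x = j → x ∈ ρ := fun h => h ▸ hj
        grind
      rw [this, weightA_insert_max hd haj, add_assoc]
      · simp [hmem, ha]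
      · intro x hx
        exact hlt x (Finset.mem_filter.1 hx).1
      · intro i hi hi'
        simp only [Finset.mem_filter, hmem]
        exact ⟨⟨by omega, hI i hi hi'.le⟩, by omega⟩
    · have h3 : weightD d τ = weightA d τ := by
        by_cases h : 2 ∈ τ
        · exact weightD_of_one_notMem d h fun h => hρ1 ((hmem 1).1 h).2
        · have hj2 : j = 2 := by
            by_contra hj2
            exact h ((hmem 2).2 ⟨Ne.symm hj2, hρ2⟩)
          have : τ = ∅ := by
            ext x
            simp only [Finset.notMem_empty, iff_false]
            intro hx
            have := hlt x hx
            have : x ≠ 0 := fun h => h0 (h ▸ ((hmem x).1 hx).2)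
            have : x ≠ 1 := fun h => hρ1 (h ▸ ((hmem x).1 hx).2)
            omega
          rw [this, weightD_empty, weightA_empty]
      rw [weightD_of_one_notMem d hρ2 hρ1, h3, hρ]
      exact weightA_insert_max hd haj (fun h => ha ((hmem a).1 h).2) hlt
        fun i hi hi' => (hmem i).2 ⟨by omega, hI i hi hi'.le⟩
  · have ha2 : 2 ≤ a := by
      by_contra hlt
      exact hρ2 (hI 2 (by omega) (by omega))
    rw [weightD_of_two_notMem d hρ2, weightD_of_two_notMem d fun h => hρ2 ((hmem 2).1 h).2, hρ,
      Finset.image_insert, show relabelD j = j - 1 by unfold relabelD; grind,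
      weightA_insert_max hd (a := a - 1) (by omega), show j - 1 - (a - 1) = j - a by omega]
    · simp only [Finset.mem_image, not_exists, not_and]
      intro x hx he
      have hx1 := ((hmem x).1 hx).2
      have : x ≠ a := fun h => ha (h ▸ hx1)
      have : a = 2 → x ≠ 1 := fun h h' => h2 h (h' ▸ hx1)
      unfold relabelD at he
      grind
    · intro x hx
      obtain ⟨y, hy, rfl⟩ := Finset.mem_image.1 hx
      have := hlt y hy
      unfold relabelD
      grind
    · intro i hi hi'
      refine Finset.mem_image.2 ⟨i + 1, (hmem _).2 ⟨by omega, hI _ (by omega) (by omega)⟩, ?_⟩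
      unfold relabelD
      grind

theorem mem_map_addEmb_one {σ : Finset ℕ} {x : ℕ} :
    x ∈ σ.map (addEmb 1) ↔ 1 ≤ x ∧ x - 1 ∈ σ := by
  simp only [Finset.mem_map, addRightEmbedding_apply]
  exact ⟨by rintro ⟨y, hy, rfl⟩; exact ⟨by omega, by simpa⟩,
    fun h => ⟨x - 1, h.2, by omega⟩⟩

/-- The first element of the run of consecutive elements that ends at `b`. -/
theorem exists_run_start {σ : Finset ℕ} {b : ℕ} (hb : b ∈ σ) :
    ∃ a ≤ b, (∀ i, a ≤ i → i ≤ b → i ∈ σ) ∧ (1 ≤ a → a - 1 ∉ σ) := by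
  classical
  have hex : ∃ a, a ≤ b ∧ ∀ i, a ≤ i → i ≤ b → i ∈ σ :=
    ⟨b, le_rfl, fun i hi hi' => by rwa [le_antisymm hi' hi]⟩
  refine ⟨Nat.find hex, (Nat.find_spec hex).1, (Nat.find_spec hex).2, fun h1 h => ?_⟩
  have hs := Nat.find_spec hex
  refine Nat.find_min hex (m := Nat.find hex - 1) (by omega) ⟨by omega, fun i hi hi' => ?_⟩
  rcases hi.eq_or_lt with h2 | h2
  · exact h2 ▸ h
  · exact hs.2 i (by omega) hi'

variable {W : Type*} [Group W] {n : ℕ} (cs : CoxeterSystem (affineB n) W)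

theorem weightD_map_range (d : ℕ) {k : ℕ} (hk : 2 ≤ k) :
    weightD d ((Finset.range k).map (addEmb 1)) = weightBlockD d k := by
  rw [weightD_of_prefix d hk]
  · rw [Finset.filter_false_of_mem, weightA_empty, add_zero]
    intro x hx
    have := mem_map_addEmb_one.1 hx
    rw [Finset.mem_range] at this
    omega
  · intro i hi hi'
    rw [mem_map_addEmb_one, Finset.mem_range]
    omega
  · rw [mem_map_addEmb_one, Finset.mem_range]
    omega

theorem weightD_map_zero_Ioo {d : ℕ} (hd : 2 ≤ d) {b : ℕ} (hb : 1 ≤ b) {σ : Finset ℕ}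
    (hσ : ∀ j, j ∈ σ ↔ j ≤ b ∧ j ≠ 1) :
    weightD d (σ.map (addEmb 1)) = (b + 1) / d := by
  rw [weightD_of_two_notMem d (by simp [hσ])]
  have : (σ.map (addEmb 1)).image relabelD = Finset.Ioo 0 (b + 1) := by
    ext x
    simp only [Finset.mem_image, mem_map_addEmb_one, Finset.mem_Ioo, hσ]
    constructor
    · rintro ⟨y, hy, rfl⟩
      unfold relabelD
      grind
    · intro hx
      refine ⟨if x = 1 then 1 else x + 1, ?_, ?_⟩
      · grind
      · unfold relabelD; grind
  rw [this, weightA_Ioo hd (by omega), Nat.sub_zero]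

/-- Induction by removing the largest vertex `b`, or `0` when `σ = {0}`. According to the start of
the run ending at `b`, its component is of type `D` (start `0`), of type `A` through `0` (start `2`
and `0 ∈ σ`), or an ordinary interval; runs from `0` of length at most two are treated apart. -/
theorem hasWeight_weightD {d : ℕ} (hd : 2 ≤ d) (hn : 3 ≤ n) (σ : Finset ℕ) (hσ : ∀ j ∈ σ, j < n) :
    HasWeight cs d (toFin n σ) (weightD d (σ.map (addEmb 1))) := by
  induction σ using Finset.strongInduction with
  | H σ ih =>
    rcases σ.eq_empty_or_nonempty with rfl | hne
    · have : toFin n ∅ = ∅ := by ext; simp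
      rw [this, Finset.map_empty, weightD_empty]
      exact hasWeight_empty cs hd
    obtain ⟨b, hb, hmax⟩ : ∃ b ∈ σ, ∀ j ∈ σ, j ≤ b :=
      ⟨σ.max' hne, σ.max'_mem hne, fun j hj => σ.le_max' j hj⟩
    have hbn := hσ b hb
    have hih : ∀ v ∈ σ, HasWeight cs d (toFin n (σ.erase v))
        (weightD d ((σ.erase v).map (addEmb 1))) := fun v hv =>
      ih _ (Finset.erase_ssubset hv) fun j hj => hσ j (Finset.mem_of_mem_erase hj)
    obtain ⟨a, hab, hI, ha⟩ := exists_run_start hb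
    have zero_case : ∀ c, 1 ≤ c → c < n → (∀ j, j ∈ σ ↔ j ≤ c ∧ j ≠ 1) →
        HasWeight cs d (toFin n σ) (weightD d (σ.map (addEmb 1))) := by
      intro c hc hcn hσc
      have h1 := HasWeight.insert_max_zero hd hn hc hcn hσc
        (hih _ (by rw [hσc]; split_ifs <;> omega))
      convert h1 using 1
      rw [weightD_map_zero_Ioo hd hc hσc, Nat.succ_div]
      congr 1
      rcases Nat.lt_or_ge 1 c with h | h
      · rw [weightD_map_zero_Ioo hd (b := c - 1) (by omega), Nat.sub_add_cancel hc]
        intro j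
        rw [Finset.mem_erase, hσc, if_neg (by omega)]
        omega
      · have : σ.erase (if c = 1 then 0 else c) = ∅ := by
          ext j
          rw [Finset.mem_erase, hσc, if_pos (by omega)]
          simp only [Finset.notMem_empty, iff_false]
          omega
        rw [this, Finset.map_empty, weightD_empty, Nat.div_eq_of_lt (by omega)]
    rcases Nat.eq_zero_or_pos a with rfl | ha1
    · have hσr : σ = Finset.range (b + 1) := by
        ext j
        rw [Finset.mem_range]
        exact ⟨fun h => by have := hmax j h; omega, fun h => hI j (by omega) (by omega)⟩
      rcases (by omega : b = 0 ∨ b = 1 ∨ 2 ≤ b) with rfl | rfl | hb2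
      -- `{0}` is the set of the `j ≤ 1` with `j ≠ 1`.
      · exact zero_case 1 le_rfl (by omega) fun j => by rw [hσr, Finset.mem_range]; omega
      · have h1 : ({0} : Finset ℕ) = σ.erase 1 := by
          rw [hσr]; rfl
        have h2 := hih 1 hb
        rw [← h1] at h2
        have h3 := HasWeight.zero_one hd hn h2
        have h4 : weightD d (({0} : Finset ℕ).map (addEmb 1)) = 2 / d :=
          weightD_map_zero_Ioo hd le_rfl (by intro j; simp; omega)
        have h5 : ({0, 1} : Finset ℕ) = σ := by rw [hσr]; rfl
        rw [h4, h5] at h3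
        convert h3 using 1
        rw [hσr, weightD_map_range d le_rfl, weightBlockD, Nat.succ_div,
          Nat.div_eq_of_lt (by omega)]
        simp [weightBlockB]
      · have h1 : σ.erase b = Finset.range b := by
          ext j
          rw [Finset.mem_erase, hσr, Finset.mem_range, Finset.mem_range]
          omega
        have h2 := hih b hb
        rw [h1, weightD_map_range d hb2] at h2
        have h3 : weightBlockD d (b + 1) + (if d ∣ b then 1 else 0) = weightBlockD d b +
            ((if d ∣ 2 * b then 1 else 0) + if d ∣ b + 1 then 1 else 0) := by
          obtain ⟨b, rfl⟩ : ∃ c, b = c + 1 := ⟨b - 1, by omega⟩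
          simp only [weightBlockD, Nat.add_sub_cancel, weightBlockB]
          ring
        -- This makes the difference of the two weights below a genuine one rather than a truncated
        -- one.
        have h4 : (if d ∣ b then 1 else 0) ≤ if d ∣ 2 * b then 1 else 0 := by
          split_ifs with h h'
          · exact le_rfl
          · exact absurd (h.mul_left 2) h'
          · omega
          · exact le_rfl
        have h5 := HasWeight.insert_max_fork (m := weightBlockD d (b + 1) - weightBlockD d b)
          hd hn hb2 hbn (by omega) h2
        rw [← hσr] at h5
        convert h5 using 1
        rw [hσr, weightD_map_range d (by omega)]
        omega
    · by_cases h0 : a = 2 ∧ 0 ∈ σ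
      · refine zero_case b (by omega) hbn fun j => ?_
        obtain ⟨rfl, h0⟩ := h0
        have h1 : 1 ∉ σ := ha (by omega)
        constructor
        · exact fun h => ⟨hmax j h, fun h' => h1 (by subst h'; exact h)⟩
        · rintro ⟨hj, hj'⟩
          rcases Nat.eq_zero_or_pos j with rfl | hj0
          · exact h0
          · exact hI j (by omega) hj
      · have ha' : ∀ j ∈ σ, j < a → j + 1 < a ∧ (a = 2 → j ≠ 0) := by
          intro j hj hja
          refine ⟨?_, fun h h' => h0 ⟨h, h' ▸ hj⟩⟩
          have : j ≠ a - 1 := fun h => ha ha1 (h ▸ hj)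
          omega
        have h1 := HasWeight.insert_max_linear hd hn ha1 hab hbn hmax hI ha' (hih b hb)
        convert h1 using 1
        have h2 : (σ.erase b).map (addEmb 1) = (σ.map (addEmb 1)).erase (b + 1) := by
          ext x
          simp only [mem_map_addEmb_one, Finset.mem_erase]
          grind
        rw [h2, weightD_erase_max hd ha1 (j := b + 1) (by omega)]
        · rw [show b + 1 - a + 1 = b - a + 2 by omega]
        · exact fun h => ha ha1 (mem_map_addEmb_one.1 h).2
        · simp
        · exact fun i hi hi' => mem_map_addEmb_one.2 ⟨by omega, hI _ (by omega) (by omega)⟩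
        · intro x hx
          have h := mem_map_addEmb_one.1 hx
          have := hmax _ h.2
          omega
        · exact fun h h' => h0 ⟨h, by simpa using (mem_map_addEmb_one.1 h').2⟩

/-- When `n ∈ σ`, the vertex to remove is not the largest one but the inner end of the component of
`n`, so that a block `B_k` shrinks to `B_(k-1)` and the cosets form a path with `2k` elements. -/
theorem hasWeight_weightB {d : ℕ} (hd : 2 ≤ d) (hn : 3 ≤ n) (σ : Finset ℕ)
    (hσ : σ ⊂ Finset.range (n + 1)) : HasWeight cs d (toFin n σ) (weightB d n σ) := by
  induction σ using Finset.strongInduction with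
  | H σ ih =>
    have hle : ∀ j ∈ σ, j ≤ n := fun j hj => by
      have := Finset.mem_range.1 (hσ.1 hj); omega
    by_cases hnσ : n ∉ σ
    · have hlt : ∀ j ∈ σ, j < n := fun j hj => by
        have := hle j hj
        have : j ≠ n := fun h => hnσ (h ▸ hj)
        omega
      rw [weightB_of_suffix d (k := 0) (fun h => hnσ (h (Finset.mem_erase.2 ⟨by omega, by simp⟩))) (by intros; omega)
        (by simpa) (by omega), Nat.sub_zero, Finset.filter_true_of_mem hlt, weightBlockB, zero_add]
      exact hasWeight_weightD cs hd hn σ hlt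
    rw [not_not] at hnσ
    have hih : ∀ v ∈ σ, HasWeight cs d (toFin n (σ.erase v)) (weightB d n (σ.erase v)) :=
      fun v hv => ih _ (Finset.erase_ssubset hv) ((Finset.erase_ssubset hv).trans hσ)
    by_cases hex : (Finset.range (n + 1)).erase 1 ⊆ σ
    · have hσe : ∀ j, j ∈ σ ↔ j ≤ n ∧ j ≠ 1 := by
        intro j
        refine ⟨fun h => ⟨hle j h, ?_⟩, fun h => hex (by simp; omega)⟩
        rintro rfl
        refine hσ.2 fun i hi => ?_
        by_cases h1 : i = 1
        · exact h1 ▸ h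
        · exact hex (Finset.mem_erase.2 ⟨h1, hi⟩)
      have h1 := HasWeight.insert_start_zero hd hn hσe (hih 0 ((hσe 0).2 (by omega)))
      convert h1 using 1
      rw [weightB, if_pos hex, weightB_of_suffix d (k := n - 1)]
      · have : (σ.erase 0).filter (· < n - (n - 1)) = ∅ := by
          ext x; grind
        rw [this, Finset.map_empty, weightD_empty, add_zero]
        obtain ⟨n, rfl⟩ : ∃ m, n = m + 1 := ⟨n - 1, by omega⟩
        rfl
      · exact fun h => absurd (h (show 0 ∈ _ by simp)) (by simp)
      · intro i hi hi'
        rw [Finset.mem_erase, hσe]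
        omega
      · rw [Finset.mem_erase, hσe]
        omega
      · omega
    · obtain ⟨a, han, hI, ha⟩ := exists_run_start hnσ
      have ha1 : 1 ≤ a := by
        by_contra h
        exact hσ.2 fun i hi => hI i (by omega) (by have := Finset.mem_range.1 hi; omega)
      have ha := ha ha1
      have h0 : a = 2 → 0 ∉ σ := by
        intro h2 h0
        refine hex fun i hi => ?_
        rw [Finset.mem_erase, Finset.mem_range] at hi
        rcases Nat.eq_zero_or_pos i with rfl | hi0
        · exact h0
        · exact hI i (by omega) (by omega)
      have haσ := hI a le_rfl han
      have h1 := HasWeight.insert_start_linear hd hn ha1 han hle hI (fun j hj hja =>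
        ⟨by have : j ≠ a - 1 := fun h => ha (h ▸ hj)
            omega, fun h h' => h0 h (h' ▸ hj)⟩) (hih a haσ)
      convert h1 using 1
      rw [weightB_of_suffix d (k := n - a + 1) hex (fun i hi hi' => hI i (by omega) hi')
        (by rwa [show n - (n - a + 1) = a - 1 by omega]) (by omega),
        weightB_of_suffix d (k := n - a)]
      · have : (σ.erase a).filter (· < n - (n - a)) = σ.filter (· < n - (n - a + 1)) := by
          ext x
          simp only [Finset.mem_filter, Finset.mem_erase]
          have : x ∈ σ → x ≠ a - 1 := fun h h' => ha (h' ▸ h)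
          grind
        rw [this, weightBlockB]
        ring
      · intro h
        by_cases ha1' : a = 1
        · subst ha1'
          have := h (show 0 ∈ _ by simp)
          exact ha (Finset.mem_of_mem_erase this)
        · exact Finset.notMem_erase a σ (h (Finset.mem_erase.2 ⟨ha1', by simp; omega⟩))
      · intro i hi hi'
        exact Finset.mem_erase.2 ⟨by omega, hI i (by omega) hi'⟩
      · rw [show n - (n - a) = a by omega]
        exact Finset.notMem_erase a σ
      · omega

/-- The affine Weyl group is infinite: it contains elements that add any constant to a given
affine functional. -/
theorem infinite_parabolic_univ (hn : 3 ≤ n) :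
    Infinite (parabolic cs (toFin n (Finset.range (n + 1)))) := by
  let P := parabolic cs (toFin n (Finset.range (n + 1)))
  let R : ℕ × ℤ × ℤ → Prop := fun y => ∃ u : P, affineHom cs hn (u : W) (2, 1, 0) = y
  have hR : ∀ i ≤ n, ∀ y, R y → R (affineStep n i y) := by
    rintro i hi _ ⟨u, rfl⟩
    exact ⟨⟨gen cs i * u, mul_mem (gen_mem_parabolic cs (by simp; omega) hi) u.2⟩, by
      rw [map_mul, Equiv.Perm.mul_apply, affineHom_gen cs hn hi]⟩
  have hup : ∀ (e k : ℤ) (j : ℕ), 2 ≤ j → j ≤ n → R (2, e, k) → R (j, e, k) := by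
    intro e k j hj hjn h
    induction j, hj using Nat.le_induction with
    | base => exact h
    | succ j hj ih =>
      have := hR j (by omega) _ (ih (by omega))
      rwa [affineStep, if_neg (by omega), if_neg (by omega), if_pos rfl] at this
  have hdown : ∀ (e k : ℤ) (j : ℕ), 2 ≤ j → j ≤ n → R (j, e, k) → R (2, e, k) := by
    intro e k j hj hjn h
    induction j, hj using Nat.le_induction with
    | base => exact h
    | succ j hj ih =>
      have := hR j (by omega) _ h
      rw [affineStep, if_neg (by omega), if_neg (by omega), if_neg (by simp), if_pos rfl] at this
      exact ih (by omega) this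
  -- `s_1 s_0` turns `x_2 + m` into `-x_2 + m + 1`; carrying `x_2` to `x_n`, changing the sign with
  -- `s_n` and carrying it back gives `x_2 + m + 1`.
  have hstep : ∀ m : ℕ, R (2, 1, m) := by
    intro m
    induction m with
    | zero => exact ⟨1, by simp⟩
    | succ m ih =>
      have h1 := hR 1 (by omega) _ (hR 0 (by omega) _ ih)
      simp only [affineStep] at h1
      norm_num [show (1 : ℕ) ≠ n by omega] at h1
      have h2 := hR n le_rfl _ (hup _ _ n (by omega) le_rfl h1)
      rw [affineStep, if_neg (by omega), if_pos rfl, if_pos rfl] at h2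
      have h3 := hdown _ _ n (by omega) le_rfl h2
      simpa using h3
  choose u hu using hstep
  exact Infinite.of_injective u fun m m' h => by
    have h1 := hu m
    rw [h, hu m'] at h1
    simpa using h1.symm

end WeightFormula

/-! ### Calculus of acyclic matchings described by pivots. -/

/-- The symmetric difference `σ ⊻ v`. -/
def toggle (σ : Finset ℕ) (v : ℕ) : Finset ℕ := if v ∈ σ then σ.erase v else insert v σ

/-- A step `σ ▷ τ ◁ σ'` of an alternating path, for the matching on `K` described by the pivot
function `p`. -/
def PivotStep (K : Finset ℕ → Prop) (p : Finset ℕ → Option ℕ) (σ σ' : Finset ℕ) : Prop :=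
  -- The last condition `σ' ≠ σ` expresses that the edge `σ → τ` is not in the matching.
  ∃ τ v, K τ ∧ K σ ∧ K σ' ∧ IsFacet τ σ ∧ v ∉ τ ∧ p τ = some v ∧ σ' = insert v τ ∧ σ' ≠ σ

/-- The pivot function `p` describes an acyclic `w`-weighted matching on `K`, and `|σ| - w σ = c`
for all critical simplices `σ`. -/
structure IsPivotal (w : Finset ℕ → ℕ) (c : ℤ) (K : Finset ℕ → Prop) (p : Finset ℕ → Option ℕ) :
    Prop where
  toggle : ∀ σ v, K σ → p σ = some v →
    K (toggle σ v) ∧ p (toggle σ v) = some v ∧ w (toggle σ v) = w σ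
  acyclic : ∀ σ, ¬ Relation.TransGen (PivotStep K p) σ σ
  critical : ∀ σ, K σ → p σ = none → (σ.card : ℤ) - w σ = c

section Pivotal

variable {w w' : Finset ℕ → ℕ} {c c' : ℤ} {K K' : Finset ℕ → Prop} {p p' : Finset ℕ → Option ℕ}

theorem IsPivotal.congr (h : IsPivotal w c K p) (hK : ∀ σ, K σ ↔ K' σ)
    (hp : ∀ σ, K σ → p' σ = p σ) : IsPivotal w c K' p' := by
  obtain rfl : K = K' := funext fun σ => propext (hK σ)
  refine ⟨fun σ v hσ hv => ?_, fun σ hσ => h.acyclic σ (Relation.TransGen.mono ?_ _ _ hσ),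
    fun σ hσ hv => ?_⟩
  · rw [hp σ hσ] at hv
    obtain ⟨h1, h2, h3⟩ := h.toggle σ v hσ hv
    exact ⟨h1, by rw [hp _ h1, h2], h3⟩
  · rintro σ σ' ⟨τ, v, h1, h2, h3, h4, h5, h6, h7⟩
    exact ⟨τ, v, h1, h2, h3, h4, h5, by rw [← hp _ h1, h6], h7⟩
  · exact h.critical σ hσ (by rw [← hp σ hσ, hv])

theorem IsPivotal.of_isEmpty (h : ∀ σ, ¬ K σ) : IsPivotal w c K p :=
  ⟨fun σ _ hσ => absurd hσ (h σ), fun σ hσ => by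
    obtain ⟨_, _, ⟨_, _, hτ, _⟩⟩ := Relation.TransGen.tail'_iff.1 hσ
    exact h _ hτ, fun σ hσ => absurd hσ (h σ)⟩

theorem IsPivotal.of_none (hp : ∀ σ, K σ → p σ = none)
    (hc : ∀ σ, K σ → (σ.card : ℤ) - w σ = c) : IsPivotal w c K p :=
  ⟨fun σ v hσ hv => by simp [hp σ hσ] at hv, fun σ hσ => by
    obtain ⟨_, _, ⟨_, _, hτ, _, _, _, _, h, _⟩⟩ := Relation.TransGen.tail'_iff.1 hσ
    simp [hp _ hτ] at h, fun σ hσ _ => hc σ hσ⟩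

/-- Matchings whose pivots are all equal. -/
theorem IsPivotal.of_const (v : ℕ) (N : Finset ℕ → Prop)
    (hp : ∀ σ, K σ → N σ → p σ = some v) (hp' : ∀ σ, K σ → ¬ N σ → p σ = none)
    (hN : ∀ σ, v ∉ σ → (K σ ∧ N σ ↔ K (insert v σ) ∧ N (insert v σ)))
    (hw : ∀ σ, v ∉ σ → K σ → N σ → w (insert v σ) = w σ)
    (hc : ∀ σ, K σ → ¬ N σ → (σ.card : ℤ) - w σ = c) : IsPivotal w c K p := by
  have key : ∀ σ u, K σ → p σ = some u → u = v ∧ N σ := by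
    intro σ u hσ hu
    by_cases h : N σ
    · rw [hp σ hσ h] at hu
      exact ⟨(Option.some.inj hu).symm, h⟩
    · simp [hp' σ hσ h] at hu
  -- If `v ∈ σ`, then `insert v τ = σ` by cardinality and the step would go back along its own edge.
  -- So a step starts without `v` and ends with `v`, and no step can follow another.
  have step : ∀ σ σ', PivotStep K p σ σ' → v ∉ σ ∧ v ∈ σ' := by
    rintro σ σ' ⟨τ, u, h1, h2, h3, h4, h5, h6, rfl, h8⟩
    obtain ⟨rfl, -⟩ := key τ u h1 h6
    refine ⟨fun h => h8 ?_, Finset.mem_insert_self _ _⟩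
    refine Finset.eq_of_subset_of_card_le (Finset.insert_subset h h4.1) ?_
    rw [Finset.card_insert_of_notMem h5, h4.2]
  refine ⟨fun σ u hσ hu => ?_, fun σ hσ => ?_, fun σ hσ hu => ?_⟩
  · obtain ⟨rfl, h⟩ := key σ u hσ hu
    unfold ArtinMorse.toggle
    split_ifs with hm
    · have h1 := hN (σ.erase u) (Finset.notMem_erase u σ)
      have h2 := hw (σ.erase u) (Finset.notMem_erase u σ)
      rw [Finset.insert_erase hm] at h1 h2
      have h3 := h1.2 ⟨hσ, h⟩
      exact ⟨h3.1, hp _ h3.1 h3.2, (h2 h3.1 h3.2).symm⟩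
    · have h3 := (hN σ hm).1 ⟨hσ, h⟩
      exact ⟨h3.1, hp _ h3.1 h3.2, hw σ hm hσ h⟩
  · obtain ⟨ρ, hρ, -⟩ := Relation.TransGen.head'_iff.1 hσ
    obtain ⟨ρ', -, hρ'⟩ := Relation.TransGen.tail'_iff.1 hσ
    exact (step _ _ hρ).1 (step _ _ hρ').2
  · refine hc σ hσ fun h => ?_
    simp [hp σ hσ h] at hu

/-- Matchings on all of `K` with a single pivot. -/
theorem IsPivotal.of_forall (v : ℕ) (hp : ∀ σ, K σ → p σ = some v)
    (hK : ∀ σ, v ∉ σ → (K σ ↔ K (insert v σ)))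
    (hw : ∀ σ, v ∉ σ → K σ → w (insert v σ) = w σ) : IsPivotal w c K p :=
  .of_const v (fun _ => True) (fun σ h _ => hp σ h) (by simp) (by simpa using hK)
    (fun σ h h' _ => hw σ h h') (by simp)

/-- Matchings on the fibers of a monotone map combine to a matching on the whole complex. -/
theorem IsPivotal.of_fiber (φ : Finset ℕ → ℕ) (hφ : ∀ τ σ, K τ → K σ → τ ⊆ σ → φ τ ≤ φ σ)
    (h : ∀ i, IsPivotal w c (fun σ => K σ ∧ φ σ = i) p) : IsPivotal w c K p := by
  -- `τ` and its partner `σ'` lie in the same fibre, and `φ τ ≤ φ σ`. Thus `φ` does not increase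
  -- along alternating paths, and a cycle stays in one fibre.
  have step : ∀ σ σ', PivotStep K p σ σ' → φ σ' ≤ φ σ ∧
      (φ σ' = φ σ → PivotStep (fun ρ => K ρ ∧ φ ρ = φ σ) p σ σ') := by
    rintro σ σ' ⟨τ, v, h1, h2, h3, h4, h5, h6, rfl, h8⟩
    have h9 := (h (φ τ)).toggle τ v ⟨h1, rfl⟩ h6
    rw [ArtinMorse.toggle, if_neg h5] at h9
    refine ⟨h9.1.2.trans_le (hφ _ _ h1 h2 h4.1), fun he => ?_⟩
    exact ⟨τ, v, ⟨h1, h9.1.2.symm.trans he⟩, ⟨h2, rfl⟩, ⟨h3, he⟩, h4, h5, h6, rfl, h8⟩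
  have path : ∀ σ σ', Relation.TransGen (PivotStep K p) σ σ' → φ σ' ≤ φ σ ∧
      (φ σ' = φ σ → Relation.TransGen (PivotStep (fun ρ => K ρ ∧ φ ρ = φ σ) p) σ σ') := by
    intro σ σ' hσ
    induction hσ with
    | single hσ => exact ⟨(step _ _ hσ).1, fun he => .single ((step _ _ hσ).2 he)⟩
    | tail _ hρ ih =>
      obtain ⟨h1, h2⟩ := step _ _ hρ
      refine ⟨h1.trans ih.1, fun he => ?_⟩
      have h3 : φ _ = φ σ := le_antisymm ih.1 (he ▸ h1)
      exact (ih.2 h3).tail (h3 ▸ h2 (he.trans h3.symm))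
  refine ⟨fun σ v hσ hv => ?_, fun σ hσ => ?_, fun σ hσ hv => (h _).critical σ ⟨hσ, rfl⟩ hv⟩
  · obtain ⟨h1, h2⟩ := (h _).toggle σ v ⟨hσ, rfl⟩ hv
    exact ⟨h1.1, h2⟩
  · exact (h _).acyclic σ ((path σ σ hσ).2 rfl)

/-- Matchings on `K ∩ P` and `K \ P` combine to a matching on `K` if `P` is closed under passing to
larger simplices of `K`. -/
theorem IsPivotal.of_upper (P : Finset ℕ → Prop) (hP : ∀ τ σ, K τ → K σ → τ ⊆ σ → P τ → P σ)
    (h : IsPivotal w c (fun σ => K σ ∧ P σ) p) (h' : IsPivotal w c (fun σ => K σ ∧ ¬ P σ) p) :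
    IsPivotal w c K p := by
  classical
  refine .of_fiber (fun σ => if P σ then 1 else 0) (fun τ σ hτ hσ hs => ?_) fun i => ?_
  · have := hP τ σ hτ hσ hs
    split_ifs <;> simp_all
  · match i with
    | 0 => exact h'.congr (by simp) (by simp)
    | 1 => exact h.congr (by simp) (by simp)
    | i + 2 => exact .of_isEmpty fun σ hσ => by
                have := hσ.2
                split_ifs at this
                omega

/-- Transport of a matching along `σ ↦ b ∪ r(σ)`. -/
theorem IsPivotal.transport (h : IsPivotal w' c' K' p') (b : Finset ℕ) (r : ℕ ↪ ℕ) (e : ℕ)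
    (hb : ∀ σ, K' σ → ∀ x ∈ σ, r x ∉ b) (hc : c' + b.card = c + e)
    (hK : ∀ σ, K σ → ∃ ρ, K' ρ ∧ b ∪ ρ.map r = σ) (hK' : ∀ ρ, K' ρ → K (b ∪ ρ.map r))
    (hp : ∀ ρ, K' ρ → p (b ∪ ρ.map r) = (p' ρ).map r)
    (hw : ∀ ρ, K' ρ → w (b ∪ ρ.map r) = w' ρ + e) : IsPivotal w c K p := by
  have hmem : ∀ (ρ ρ' : Finset ℕ) x, K' ρ → x ∈ ρ → (r x ∈ b ∪ ρ'.map r ↔ x ∈ ρ') := fun ρ ρ' x hρ hx => by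
    simp [hb ρ hρ x hx]
  have hsub : ∀ ρ ρ' : Finset ℕ, K' ρ → (b ∪ ρ.map r ⊆ b ∪ ρ'.map r ↔ ρ ⊆ ρ') := fun ρ ρ' hρ =>
    ⟨fun hs x hx => (hmem ρ ρ' x hρ hx).1 (hs ((hmem ρ ρ x hρ hx).2 hx)), fun hs =>
      Finset.union_subset_union_right (Finset.map_subset_map.2 hs)⟩
  have hinj : ∀ ρ ρ', K' ρ → K' ρ' → b ∪ ρ.map r = b ∪ ρ'.map r → ρ = ρ' := fun ρ ρ' h h' he =>
    Finset.Subset.antisymm ((hsub _ _ h).1 he.le) ((hsub _ _ h').1 he.ge)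
  have hcard : ∀ ρ, K' ρ → (b ∪ ρ.map r).card = b.card + ρ.card := fun ρ hρ => by
    rw [Finset.card_union_of_disjoint, Finset.card_map]
    rw [Finset.disjoint_right]
    intro x hx
    obtain ⟨y, hy, rfl⟩ := Finset.mem_map.1 hx
    exact hb ρ hρ y hy
  have hins : ∀ (ρ : Finset ℕ) v, insert (r v) (b ∪ ρ.map r) = b ∪ (insert v ρ).map r :=
    fun ρ v => by rw [Finset.map_insert, Finset.union_insert]
  -- The pivot of `ρ` is a vertex of `ρ` or of its partner; the hypothesis on `b` then shows that
  -- its image is not in `b`.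
  have hsome : ∀ ρ v, K' ρ → p (b ∪ ρ.map r) = some v →
      ∃ u, p' ρ = some u ∧ r u = v ∧ ∃ ρ', K' ρ' ∧ u ∈ ρ' := by
    intro ρ v hρ hv
    rw [hp ρ hρ] at hv
    obtain ⟨u, hu, rfl⟩ := Option.map_eq_some_iff.1 hv
    have := (h.toggle ρ u hρ hu).1
    refine ⟨u, hu, rfl, ?_⟩
    unfold ArtinMorse.toggle at this
    split_ifs at this with hm
    · exact ⟨ρ, hρ, hm⟩
    · exact ⟨_, this, Finset.mem_insert_self u ρ⟩
  refine ⟨fun σ v hσ hv => ?_, fun σ hσ => ?_, fun σ hσ hv => ?_⟩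
  · obtain ⟨ρ, hρ, rfl⟩ := hK σ hσ
    obtain ⟨u, hu, rfl, ρ', hρ', huρ'⟩ := hsome ρ v hρ hv
    obtain ⟨h1, h2, h3⟩ := h.toggle ρ u hρ hu
    have htog : ArtinMorse.toggle (b ∪ ρ.map r) (r u) =
        b ∪ (ArtinMorse.toggle ρ u).map r := by
      simp only [ArtinMorse.toggle, hmem _ ρ u hρ' huρ']
      split_ifs
      · rw [Finset.erase_union_distrib, Finset.erase_eq_of_notMem (hb _ hρ' u huρ'), Finset.map_erase]
      · exact hins ρ u
    rw [htog, hp _ h1, h2, hw _ h1, hw _ hρ, h3]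
    exact ⟨hK' _ h1, rfl, rfl⟩
  · have step : ∀ ρ σ', K' ρ → PivotStep K p (b ∪ ρ.map r) σ' →
        ∃ ρ', K' ρ' ∧ b ∪ ρ'.map r = σ' ∧ PivotStep K' p' ρ ρ' := by
      rintro ρ σ' hρ ⟨τ, v, h1, h2, h3, h4, h5, h6, rfl, h8⟩
      obtain ⟨t, ht, rfl⟩ := hK τ h1
      obtain ⟨u, hu, rfl, ρ₀, hρ₀, huρ₀⟩ := hsome t v ht h6
      have hut : u ∉ t := fun h => h5 ((hmem _ _ _ hρ₀ huρ₀).2 h)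
      have hins' := (h.toggle t u ht hu).1
      rw [ArtinMorse.toggle, if_neg hut] at hins'
      rw [hins] at h8
      refine ⟨_, hins', (hins _ _).symm, t, u, ht, hρ, hins', ⟨(hsub _ _ ht).1 h4.1, ?_⟩,
        hut, hu, rfl, fun h => h8 (by rw [h])⟩
      have := h4.2
      rw [hcard _ ht, hcard _ hρ] at this
      omega
    have path : ∀ ρ σ', K' ρ → Relation.TransGen (PivotStep K p) (b ∪ ρ.map r) σ' →
        ∃ ρ', K' ρ' ∧ b ∪ ρ'.map r = σ' ∧ Relation.TransGen (PivotStep K' p') ρ ρ' := by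
      intro ρ σ' hρ hσ
      induction hσ with
      | single hσ =>
        obtain ⟨ρ', h1, h2, h3⟩ := step ρ _ hρ hσ
        exact ⟨ρ', h1, h2, .single h3⟩
      | tail _ hs ih =>
        obtain ⟨ρ', h1, rfl, h3⟩ := ih
        obtain ⟨ρ'', h4, h5, h6⟩ := step ρ' _ h1 hs
        exact ⟨ρ'', h4, h5, h3.tail h6⟩
    obtain ⟨_, hs, -⟩ := Relation.TransGen.head'_iff.1 hσ
    obtain ⟨_, _, _, hσK, _⟩ := hs
    obtain ⟨ρ, hρ, rfl⟩ := hK σ hσK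
    obtain ⟨ρ', hρ', h2, h3⟩ := path ρ _ hρ hσ
    obtain rfl := hinj _ _ hρ' hρ h2
    exact h.acyclic _ h3
  · obtain ⟨ρ, hρ, rfl⟩ := hK σ hσ
    rw [hp ρ hρ, Option.map_eq_none_iff] at hv
    have := h.critical ρ hρ hv
    rw [hcard ρ hρ, hw ρ hρ]
    push_cast
    linarith

end Pivotal

/-! ### Matchings in type `A`. -/

theorem mem_shiftDown {c x : ℕ} {σ : Finset ℕ} : x ∈ shiftDown c σ ↔ 1 ≤ x ∧ x + c ∈ σ := by
  simp only [shiftDown, Finset.mem_image, Finset.mem_filter]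
  constructor
  · rintro ⟨y, ⟨h1, h2⟩, rfl⟩
    exact ⟨by omega, by rwa [Nat.sub_add_cancel h2.le]⟩
  · rintro ⟨h1, h2⟩
    exact ⟨x + c, ⟨h2, by omega⟩, by omega⟩

theorem mem_union_map_addEmb {a x : ℕ} {b ρ : Finset ℕ} :
    x ∈ b ∪ ρ.map (addEmb a) ↔ x ∈ b ∨ a ≤ x ∧ x - a ∈ ρ := by
  simp only [Finset.mem_union, Finset.mem_map, addRightEmbedding_apply]
  constructor
  · rintro (h | ⟨y, hy, rfl⟩)
    · exact .inl h
    · exact .inr ⟨by omega, by rwa [Nat.add_sub_cancel]⟩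
  · rintro (h | ⟨h1, h2⟩)
    · exact .inl h
    · exact .inr ⟨_, h2, by omega⟩

theorem shiftDown_union_map {a : ℕ} {b ρ : Finset ℕ} (hb : ∀ x ∈ b, x < a) (h0 : 0 ∉ ρ) :
    shiftDown a (b ∪ ρ.map (addEmb a)) = ρ := by
  ext x
  rw [mem_shiftDown, mem_union_map_addEmb, Nat.add_sub_cancel]
  constructor
  · rintro ⟨h1, h | h⟩
    · have := hb _ h; omega
    · exact h.2
  · intro h
    exact ⟨Nat.one_le_iff_ne_zero.2 fun h' => h0 (h' ▸ h), .inr ⟨by omega, h⟩⟩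

theorem weightA_shiftDown (d : ℕ) {a : ℕ} {σ : Finset ℕ} (ha : a ∉ σ) :
    weightA d σ = weightA d (σ.filter (· < a)) + weightA d (shiftDown a σ) := by
  have h0 : 0 ∉ shiftDown a σ := fun h => by simpa using (mem_shiftDown.1 h).1
  rw [← weightA_map d a h0, ← weightA_union d (a := a)]
  · congr 1
    ext x
    rw [mem_union_map_addEmb, mem_shiftDown, Finset.mem_filter]
    constructor
    · intro h
      rcases lt_trichotomy x a with h1 | rfl | h1
      · exact .inl ⟨h, h1⟩
      · exact absurd h ha
      · exact .inr ⟨h1.le, by omega, by rwa [Nat.sub_add_cancel h1.le]⟩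
    · rintro (h | ⟨h1, h2, h3⟩)
      · exact h.1
      · rwa [Nat.sub_add_cancel h1] at h3
  · simp
  · intro x hx
    obtain ⟨y, hy, rfl⟩ := Finset.mem_map.1 hx
    have := (mem_shiftDown.1 hy).1
    rw [addRightEmbedding_apply]
    omega

variable {w w' : Finset ℕ → ℕ} {c c' : ℤ} {K K' : Finset ℕ → Prop} {p p' : Finset ℕ → Option ℕ}

/-- Transport of a matching to the simplices obtained by ignoring the vertices `≤ a`. -/
theorem IsPivotal.of_shiftDown (h : IsPivotal w' c' K' p') (a : ℕ) (b : Finset ℕ) (e : ℕ)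
    (hb : ∀ x ∈ b, x < a) (h0 : ∀ ρ, K' ρ → 0 ∉ ρ) (hc : c' + b.card = c + e)
    (hK : ∀ σ, K σ ↔ (∀ x, x < a → (x ∈ σ ↔ x ∈ b)) ∧ a ∉ σ ∧ K' (shiftDown a σ))
    (hp : ∀ σ, K σ → p σ = (p' (shiftDown a σ)).map (· + a))
    (hw : ∀ σ, K σ → w σ = w' (shiftDown a σ) + e) : IsPivotal w c K p := by
  have hKb : ∀ ρ, K' ρ → K (b ∪ ρ.map (addEmb a)) := fun ρ hρ => by
    refine (hK _).2 ⟨fun x hx => ?_, ?_, by rwa [shiftDown_union_map hb (h0 ρ hρ)]⟩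
    · rw [mem_union_map_addEmb]
      exact ⟨fun h => h.resolve_right fun h => by omega, .inl⟩
    · rw [mem_union_map_addEmb, Nat.sub_self]
      rintro (h | h)
      · exact lt_irrefl _ (hb _ h)
      · exact h0 ρ hρ h.2
  refine h.transport b (addEmb a) e ?_ hc (fun σ hσ => ⟨_, ((hK σ).1 hσ).2.2, ?_⟩) hKb
    (fun ρ hρ => ?_) fun ρ hρ => ?_
  · intro ρ hρ x hx hxb
    have := hb _ hxb
    rw [addRightEmbedding_apply] at this
    omega
  · obtain ⟨h1, h2, -⟩ := (hK σ).1 hσ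
    ext x
    rw [mem_union_map_addEmb, mem_shiftDown]
    rcases lt_trichotomy x a with h3 | rfl | h3
    · rw [h1 x h3]
      exact ⟨fun h => h.resolve_right fun h => by omega, .inl⟩
    · refine ⟨?_, fun h => absurd h h2⟩
      rintro (h | h)
      · exact absurd (hb _ h) (lt_irrefl _)
      · omega
    · rw [Nat.sub_add_cancel h3.le]
      refine ⟨?_, fun h => .inr ⟨h3.le, by omega, h⟩⟩
      rintro (h | h)
      · exact absurd (hb _ h) (by omega)
      · exact h.2.2
  · rw [hp _ (hKb ρ hρ), shiftDown_union_map hb (h0 ρ hρ)]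
    rfl
  · rw [hw _ (hKb ρ hρ), shiftDown_union_map hb (h0 ρ hρ)]

/-- The set `K^A_{n,f,g}`. -/
def FaceA (n f g : ℕ) (σ : Finset ℕ) : Prop :=
  (∀ i ∈ σ, 1 ≤ i ∧ i ≤ n) ∧ (∀ i, 1 ≤ i → i ≤ f → i ∈ σ) ∧
    ∀ i, n < i + g → 1 ≤ i → i ≤ n → i ∈ σ

theorem FaceA.zero_notMem {n f g : ℕ} {σ : Finset ℕ} (h : FaceA n f g σ) : 0 ∉ σ :=
  fun h0 => absurd (h.1 0 h0).1 (by omega)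

theorem FaceA.insert_iff {n f g v : ℕ} (h1 : f < v) (h2 : v + g ≤ n) {σ : Finset ℕ} (hv : v ∉ σ) :
    FaceA n f g (insert v σ) ↔ FaceA n f g σ := by
  unfold FaceA
  refine and_congr ⟨fun h i hi => h i (Finset.mem_insert_of_mem hi), fun h i hi => ?_⟩
    (and_congr ⟨fun h i hi hi' => ?_, fun h i hi hi' => Finset.mem_insert_of_mem (h i hi hi')⟩
    ⟨fun h i hi hi' hi'' => ?_, fun h i hi hi' hi'' => Finset.mem_insert_of_mem (h i hi hi' hi'')⟩)
  · rcases Finset.mem_insert.1 hi with rfl | hi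
    · omega
    · exact h i hi
  · exact (Finset.mem_insert.1 (h i hi hi')).resolve_left (by omega)
  · exact (Finset.mem_insert.1 (h i hi hi' hi'')).resolve_left (by omega)

theorem weightA_Icc {d : ℕ} (hd : 2 ≤ d) (n : ℕ) : weightA d (Finset.Icc 1 n) = (n + 1) / d := by
  have := weightA_Ioo hd (a := 0) (e := n + 1) (by omega)
  rw [Nat.sub_zero] at this
  rw [← this]
  rfl

theorem eq_Icc_of_faceA {n f g : ℕ} (h : n ≤ f + g) {σ : Finset ℕ} (hσ : FaceA n f g σ) :
    σ = Finset.Icc 1 n := by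
  ext x
  rw [Finset.mem_Icc]
  refine ⟨hσ.1 x, fun hx => ?_⟩
  by_cases hf : x ≤ f
  · exact hσ.2.1 x hx.1 hf
  · exact hσ.2.2 x (by omega) hx.1 hx.2

theorem isPivotal_pivotA_of_le {d n f g : ℕ} (hd : 2 ≤ d) {c : ℤ} (h : n ≤ f + g)
    (hc : f ≤ n → (n : ℤ) - ((n + 1) / d : ℕ) = c) :
    IsPivotal (weightA d) c (FaceA n f g) (pivotA d n f g) := by
  refine .of_none (fun σ _ => ?_) fun σ hσ => ?_
  · rw [pivotA, dif_pos (.inr h)]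
  · have hfn : f ≤ n := by
      rcases Nat.eq_zero_or_pos f with rfl | hf
      · omega
      · exact (hσ.1 f (hσ.2.1 f hf le_rfl)).2
    rw [eq_Icc_of_faceA h hσ, weightA_Icc hd, Nat.card_Icc, ← hc hfn, Nat.add_sub_cancel]

/-- Rule (d). With `e` the next gap, adding `f + 1` replaces `⌊(f+1)/d⌋ + ⌊(e-f-1)/d⌋` by `⌊e/d⌋`.
If `e ≤ n`, then `e ≤ n - g < d` because the last `g` vertices are present, and (for `f + 1 < d`)
all terms vanish. If `e = n + 1`, the larger simplex is `{1, …, n}`, and for `f + 1 < d` the value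
changes exactly when `(n + 1) mod d ≤ f`; these are the simplices left critical. For `f + 1 = d` the
two sides always agree. -/
theorem isPivotal_pivotA_of_lt {d n f g : ℕ} (hd : 2 ≤ d) {c : ℤ} (hf : f < d) (h : f + g < n)
    (hn : n < d + g)
    (hc : (n + 1) % d ≤ f → (n : ℤ) - ((n + 1) / d : ℕ) = c ∧
      (n : ℤ) - 1 - ((f + 1) / d + (n - f) / d : ℕ) = c) :
    IsPivotal (weightA d) c (FaceA n f g) (pivotA d n f g) := by
  have hp : ∀ σ, pivotA d n f g σ = if (n + 1) % d ≤ f ∧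
        (σ = Finset.Icc 1 n ∨ σ = (Finset.Icc 1 n).erase (f + 1)) then none
    else some (f + 1) := fun σ => by
    rw [pivotA, dif_neg (by omega), dif_neg (by omega), if_neg (by omega)]
  have hmem : f + 1 ∈ Finset.Icc 1 n := Finset.mem_Icc.2 (by omega)
  refine .of_const (f + 1) (fun σ => ¬ ((n + 1) % d ≤ f ∧
        (σ = Finset.Icc 1 n ∨ σ = (Finset.Icc 1 n).erase (f + 1))))
    (fun σ _ hσ => by rw [hp, if_neg hσ]) (fun σ _ hσ => by rw [hp, if_pos (not_not.1 hσ)])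
    (fun σ hσ => ?_) (fun σ hv hσ hN => ?_) fun σ hσ hN => ?_
  · rw [FaceA.insert_iff (by omega) (by omega) hσ]
    refine and_congr_right fun _ => not_congr (and_congr_right fun _ => ?_)
    have h1 : σ ≠ Finset.Icc 1 n := fun h => hσ (h ▸ hmem)
    have h2 : insert (f + 1) σ ≠ (Finset.Icc 1 n).erase (f + 1) := fun h =>
      Finset.notMem_erase (f + 1) _ (h ▸ Finset.mem_insert_self _ _)
    simp only [h1, h2, false_or, or_false]
    constructor
    · rintro rfl
      exact Finset.insert_erase hmem
    · intro h
      rw [← h, Finset.erase_insert hσ]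
  · obtain ⟨e, he, heσ, hI⟩ := exists_prefix σ (f + 1)
    have h1 := weightA_insert hd (a := 0) (v := f + 1) (e := e) (by omega) he hσ.zero_notMem hv heσ
      (fun i hi hi' => hσ.2.1 i (by omega) (by omega)) hI
    have h2 : (f + 1) / d = 0 ∨ f + 1 = d := by
      rcases Nat.lt_or_ge (f + 1) d with h | h
      · exact .inl (Nat.div_eq_of_lt h)
      · right; omega
    have h4 : e ≤ n + 1 := by
      by_contra h4
      have := hσ.1 _ (hI (n + 1) (by omega) (by omega))
      omega
    rw [Nat.sub_zero, Nat.sub_zero] at h1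
    have h3 : (f + 1) / d + (e - (f + 1)) / d = e / d := by
      rcases h2 with h2 | h2
      swap
      · rw [h2, Nat.div_self (by omega), ← Nat.sub_add_cancel (show d ≤ e by omega),
          Nat.add_div_right _ (by omega), Nat.add_sub_cancel]
        omega
      rw [h2, zero_add]
      rcases Nat.lt_or_ge e (n + 1) with h5 | h5
      · have h6 : e < d := by
          by_contra h6
          exact heσ (hσ.2.2 e (by omega) (by omega) (by omega))
        rw [Nat.div_eq_of_lt h6, Nat.div_eq_of_lt (by omega)]
      · obtain rfl : e = n + 1 := by omega
        have h6 : σ = (Finset.Icc 1 n).erase (f + 1) := by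
          ext x
          rw [Finset.mem_erase, Finset.mem_Icc]
          refine ⟨fun hx => ⟨fun h => hv (h ▸ hx), hσ.1 x hx⟩, fun hx => ?_⟩
          by_cases hxf : x ≤ f
          · exact hσ.2.1 x hx.2.1 hxf
          · exact hI x (by omega) (by omega)
        have h7 : f + 1 ≤ (n + 1) % d := by
          by_contra h7
          exact hN ⟨by omega, .inr h6⟩
        have h8 := Nat.div_add_mod (n + 1) d
        have h9 := Nat.mod_lt (n + 1) (show 0 < d by omega)
        rw [Nat.div_eq_iff (by omega)]
        rw [mul_comm] at h8
        generalize (n + 1) / d * d = q at h8 ⊢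
        omega
    omega
  · rw [not_not] at hN
    obtain ⟨hN, rfl | rfl⟩ := hN
    · rw [weightA_Icc hd, Nat.card_Icc, ← (hc hN).1, Nat.add_sub_cancel]
    · have h1 := weightA_insert hd (σ := (Finset.Icc 1 n).erase (f + 1)) (a := 0) (v := f + 1)
        (e := n + 1) (by omega) (by omega) (by simp) (by simp) (by simp)
        (fun i hi hi' => by simp only [Finset.mem_erase, Finset.mem_Icc]; omega)
        (fun i hi hi' => by simp only [Finset.mem_erase, Finset.mem_Icc]; omega)
      rw [Finset.insert_erase hmem, weightA_Icc hd, Nat.sub_zero, Nat.sub_zero,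
        Nat.add_sub_add_right] at h1
      rw [Finset.card_erase_of_mem hmem, Nat.card_Icc, ← (hc hN).2]
      omega

/-- Rule (c). If `{1, …, d-1} ⊆ σ`, toggling `d` is harmless since `⌊e/d⌋ = 1 + ⌊(e-d)/d⌋`. If
`{f+2, …, d-1}` is not contained in `σ`, toggling `f + 1` only affects a block with fewer than `d -
1` vertices, of weight `0`. In between, `f + 1` is missing, the `f` vertices before it have weight
`0`, and the rest is a smaller complex of the same kind; this explains the constant `c - f`. Both
dividing conditions are stable under enlarging `σ`. -/
theorem isPivotal_pivotA_of_ge {d n f g : ℕ} (hd : 2 ≤ d) {c : ℤ} (hf : f < d) (hn : d + g ≤ n)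
    (hc : f + 2 ≤ d → IsPivotal (weightA d) (c - f) (FaceA (n - f - 1) (d - 2 - f) g)
      (pivotA d (n - f - 1) (d - 2 - f) g)) :
    IsPivotal (weightA d) c (FaceA n f g) (pivotA d n f g) := by
  have hp : ∀ σ, pivotA d n f g σ = if Finset.Icc 1 (d - 1) ⊆ σ then some d
    else if f + 1 ∈ σ then some (f + 1)
    else if ¬ Finset.Icc (f + 2) (d - 1) ⊆ σ then some (f + 1)
    else (pivotA d (n - f - 1) (d - 2 - f) g (shiftDown (f + 1) σ)).map (· + (f + 1)) :=
    fun σ => by rw [pivotA, dif_neg (by omega), dif_neg (by omega), if_pos hn]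
  refine .of_upper (fun σ => Finset.Icc 1 (d - 1) ⊆ σ) (fun τ σ _ _ h h' => h'.trans h) ?_ ?_
  · refine .of_forall d (fun σ hσ => by rw [hp, if_pos hσ.2]) (fun σ hv => ?_) fun σ hv hσ => ?_
    · rw [FaceA.insert_iff hf hn hv, Finset.subset_insert_iff_of_notMem (by simp; omega)]
    · obtain ⟨e, he, heσ, hI⟩ := exists_prefix σ d
      have h1 := weightA_insert hd (a := 0) (v := d) (e := e) (by omega) he hσ.1.zero_notMem hv heσ
        (fun i hi hi' => hσ.2 (Finset.mem_Icc.2 (by omega))) hI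
      rw [Nat.sub_zero, Nat.sub_zero, Nat.div_self (by omega)] at h1
      have h2 : e / d = (e - d) / d + 1 := by
        rw [← Nat.add_div_right _ (by omega), Nat.sub_add_cancel he.le]
      omega
  refine .of_upper (fun σ => Finset.Icc (f + 2) (d - 1) ⊆ σ) (fun τ σ _ _ h h' => h'.trans h) ?_ ?_
  · by_cases hfd : f + 2 ≤ d
    swap
    · refine .of_isEmpty fun σ hσ => hσ.1.2 fun i hi => ?_
      rw [Finset.mem_Icc] at hi
      exact hσ.1.1.2.1 i hi.1 (by omega)
    have hnot : ∀ σ, ((FaceA n f g σ ∧ ¬ Finset.Icc 1 (d - 1) ⊆ σ) ∧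
        Finset.Icc (f + 2) (d - 1) ⊆ σ) → f + 1 ∉ σ := fun σ hσ h => by
      refine hσ.1.2 fun i hi => ?_
      rw [Finset.mem_Icc] at hi
      rcases lt_trichotomy i (f + 1) with h1 | rfl | h1
      · exact hσ.1.1.2.1 i hi.1 (by omega)
      · exact h
      · exact hσ.2 (Finset.mem_Icc.2 (by omega))
    refine (hc hfd).of_shiftDown (f + 1) (Finset.Icc 1 f) 0 (fun x hx => by rw [Finset.mem_Icc] at hx; omega)
      (fun ρ h => h.zero_notMem) (by simp) (fun σ => ⟨fun hσ => ⟨?_, hnot σ hσ, ?_⟩, ?_⟩) ?_ ?_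
    · intro x hx
      rw [Finset.mem_Icc]
      refine ⟨fun h => ⟨(hσ.1.1.1 x h).1, by omega⟩, fun h => hσ.1.1.2.1 x h.1 h.2⟩
    · refine ⟨fun i hi => ?_, fun i hi hi' => ?_, fun i hi hi' hi'' => ?_⟩
      · have h1 := mem_shiftDown.1 hi
        have := hσ.1.1.1 _ h1.2
        omega
      · exact mem_shiftDown.2 ⟨hi, hσ.2 (Finset.mem_Icc.2 (by omega))⟩
      · exact mem_shiftDown.2 ⟨hi', hσ.1.1.2.2 _ (by omega) (by omega) (by omega)⟩
    · rintro ⟨h1, h2, h3⟩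
      have h4 : Finset.Icc (f + 2) (d - 1) ⊆ σ := fun i hi => by
        rw [Finset.mem_Icc] at hi
        have := (mem_shiftDown.1 (h3.2.1 (i - (f + 1)) (by omega) (by omega))).2
        rwa [Nat.sub_add_cancel (by omega)] at this
      refine ⟨⟨⟨fun i hi => ?_, fun i hi hi' => ?_, fun i hi hi' hi'' => ?_⟩, fun h => ?_⟩, h4⟩
      · by_cases hif : i < f + 1
        · have := (h1 i hif).1 hi
          rw [Finset.mem_Icc] at this
          omega
        · have hif' : i ≠ f + 1 := fun h => h2 (h ▸ hi)
          have := h3.1 (i - (f + 1)) (mem_shiftDown.2 ⟨by omega, by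
            rwa [Nat.sub_add_cancel (by omega)]⟩)
          omega
      · exact (h1 i (by omega)).2 (Finset.mem_Icc.2 (by omega))
      · have := (mem_shiftDown.1 (h3.2.2 (i - (f + 1)) (by omega) (by omega) (by omega))).2
        rwa [Nat.sub_add_cancel (by omega)] at this
      · exact h2 (h (Finset.mem_Icc.2 (by omega)))
    · intro σ hσ
      rw [hp, if_neg hσ.1.2, if_neg (hnot σ hσ), if_neg (not_not.2 hσ.2)]
    · intro σ hσ
      rw [weightA_shiftDown d (hnot σ hσ), add_comm, add_zero]
      have h1 := weightA_Icc hd f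
      rw [Nat.div_eq_of_lt (by omega)] at h1
      convert add_zero _ using 2
      rw [← h1]
      congr 1
      ext x
      rw [Finset.mem_filter, Finset.mem_Icc]
      refine ⟨fun h => ⟨(hσ.1.1.1 x h.1).1, by omega⟩, fun h => ⟨hσ.1.1.2.1 x h.1 h.2, by omega⟩⟩
  · have hmem : f + 1 ∉ Finset.Icc (f + 2) (d - 1) := by simp
    refine .of_forall (f + 1) (fun σ hσ => ?_) (fun σ hv => ?_) fun σ hv hσ => ?_
    · rw [hp, if_neg hσ.1.2]
      split_ifs <;> first | rfl | exact absurd ‹_› hσ.2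
    · have h3 : ∀ τ, ((FaceA n f g τ ∧ ¬ Finset.Icc 1 (d - 1) ⊆ τ) ∧
        ¬ Finset.Icc (f + 2) (d - 1) ⊆ τ) ↔ FaceA n f g τ ∧ ¬ Finset.Icc (f + 2) (d - 1) ⊆ τ := by
        intro τ
        refine ⟨fun h => ⟨h.1.1, h.2⟩, fun h => ⟨⟨h.1, fun h' => h.2 (subset_trans ?_ h')⟩, h.2⟩⟩
        exact Finset.Icc_subset_Icc (by omega) le_rfl
      by_cases hfd : f + 1 = d
      · have : Finset.Icc (f + 2) (d - 1) = ∅ := by rw [Finset.Icc_eq_empty]; omega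
        simp [this]
      rw [h3, h3, FaceA.insert_iff (by omega) (by omega) hv,
        Finset.subset_insert_iff_of_notMem hmem]
    · obtain ⟨e, he, heσ, hI⟩ := exists_prefix σ (f + 1)
      have h1 := weightA_insert hd (a := 0) (v := f + 1) (e := e) (by omega) he
        hσ.1.1.zero_notMem hv heσ (fun i hi hi' => hσ.1.1.2.1 i (by omega) (by omega)) hI
      have h2 : e < d := by
        by_contra h2
        exact hσ.2 fun i hi => by
          rw [Finset.mem_Icc] at hi
          exact hI i (by omega) (by omega)
      rw [Nat.div_eq_of_lt (by omega), Nat.div_eq_of_lt (by omega),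
        Nat.div_eq_of_lt (by omega)] at h1
      omega

/-- The condition `f < d` is kept by the recursion `f ↦ d - 2 - f`, so rule (b) does not come into
play. For each family of parameters there remains only the value of the constant at the terminal
simplices and its compatibility with the recursion. -/
theorem isPivotal_pivotA {d n f g : ℕ} (hd : 2 ≤ d) {c : ℤ} (hf : f < d)
    (h₁ : f ≤ n → n ≤ f + g → (n : ℤ) - ((n + 1) / d : ℕ) = c)
    (h₂ : f + g < n → n < d + g → (n + 1) % d ≤ f → (n : ℤ) - ((n + 1) / d : ℕ) = c ∧
      (n : ℤ) - 1 - ((f + 1) / d + (n - f) / d : ℕ) = c)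
    (h₃ : d + g ≤ n → f + 2 ≤ d → IsPivotal (weightA d) (c - f) (FaceA (n - f - 1) (d - 2 - f) g)
      (pivotA d (n - f - 1) (d - 2 - f) g)) :
    IsPivotal (weightA d) c (FaceA n f g) (pivotA d n f g) := by
  rcases Nat.lt_or_ge (f + g) n with h | h
  · rcases Nat.lt_or_ge n (d + g) with h' | h'
    · exact isPivotal_pivotA_of_lt hd hf h h' (h₂ h h')
    · exact isPivotal_pivotA_of_ge hd hf h' (h₃ h')
  · exact isPivotal_pivotA_of_le hd h fun hfn => h₁ hfn h

theorem div_eq_of_le_of_lt {x h : ℕ} (q : ℕ) (h1 : q * h ≤ x) (h2 : x < q * h + h) : x / h = q :=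
  Nat.div_eq_of_lt_le h1 (by rwa [Nat.succ_mul])

theorem mod_eq_of_le_of_lt {x d : ℕ} (h1 : d ≤ x) (h2 : x < 2 * d) : x % d = x - d := by
  rw [Nat.mod_eq_sub_mod h1, Nat.mod_eq_of_lt (by omega)]

theorem div_sub_mul {x h : ℕ} (q : ℕ) (h1 : q * h ≤ x) : (x - q * h) / h = x / h - q := by
  rw [mul_comm] at h1 ⊢
  exact Nat.sub_mul_div_of_le x h q h1

/-- The recursion alternates between `f = 0` and `f = d - 2`, so both are treated in one induction;
a full turn replaces `n` by `n - 2h`. The bound `3h - 3 < n` means `f + g < n` and excludes the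
terminal case of a single simplex, which the recursion from `f = 0` never reaches. -/
theorem isPivotal_pivotA_zero_aux {h : ℕ} (hh : 1 ≤ h) (n : ℕ) :
    (h ≤ n + 1 → IsPivotal (weightA (2 * h)) ((n : ℤ) + 1 - ((n + 1) / h : ℕ))
      (FaceA n 0 (h - 1)) (pivotA (2 * h) n 0 (h - 1))) ∧
    (3 * h - 3 < n → IsPivotal (weightA (2 * h)) ((n : ℤ) + 2 - ((n + 2) / h : ℕ))
      (FaceA n (2 * h - 2) (h - 1)) (pivotA (2 * h) n (2 * h - 2) (h - 1))) := by
  induction n using Nat.strong_induction_on with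
  | _ n ih =>
    refine ⟨fun hn => ?_, fun hn => ?_⟩
    · refine isPivotal_pivotA (by omega) (by omega) (fun _ h1 => ?_) (fun h1 h2 h3 => ?_)
        fun h1 h2 => ?_
      · rw [div_eq_of_le_of_lt 0 (by omega) (by omega), div_eq_of_le_of_lt 1 (by omega) (by omega)]
        push_cast
        omega
      · obtain h4 : n + 1 = 2 * h := by
          rcases Nat.lt_or_ge (n + 1) (2 * h) with h4 | h4
          · rw [Nat.mod_eq_of_lt h4] at h3; omega
          · rw [mod_eq_of_le_of_lt h4 (by omega)] at h3; omega
        have e1 : (n + 1) / (2 * h) = 1 := div_eq_of_le_of_lt 1 (by omega) (by omega)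
        have e2 : (n + 1) / h = 2 := div_eq_of_le_of_lt 2 (by omega) (by omega)
        have e3 : (0 + 1) / (2 * h) = 0 := div_eq_of_le_of_lt 0 (by omega) (by omega)
        have e4 : (n - 0) / (2 * h) = 0 := div_eq_of_le_of_lt 0 (by omega) (by omega)
        rw [e1, e2, e3, e4]
        push_cast
        omega
      · have h3 := (ih (n - 1) (by omega)).2 (by omega)
        rw [Nat.sub_zero, Nat.sub_zero]
        convert h3 using 1
        rw [show n - 1 + 2 = n + 1 by omega]
        push_cast
        omega
    · refine isPivotal_pivotA (by omega) (by omega) (fun _ h1 => ?_) (fun h1 h2 h3 => ?_)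
        fun h1 h2 => ?_
      · omega
      · obtain h4 : n + 2 = 3 * h := by omega
        have e1 : (n + 1) / (2 * h) = 1 := div_eq_of_le_of_lt 1 (by omega) (by omega)
        have e2 : (n + 2) / h = 3 := div_eq_of_le_of_lt 3 (by omega) (by omega)
        have e3 : (2 * h - 2 + 1) / (2 * h) = 0 := div_eq_of_le_of_lt 0 (by omega) (by omega)
        have e4 : (n - (2 * h - 2)) / (2 * h) = 0 := div_eq_of_le_of_lt 0 (by omega) (by omega)
        rw [e1, e2, e3, e4]
        push_cast
        omega
      · have h3 := (ih (n - (2 * h - 2) - 1) (by omega)).1 (by omega)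
        rw [show 2 * h - 2 - (2 * h - 2) = 0 by omega]
        convert h3 using 1
        have h4 := div_sub_mul (x := n + 2) (h := h) 2 (by omega)
        have h5 : 2 ≤ (n + 2) / h := (Nat.le_div_iff_mul_le hh).2 (by omega)
        rw [show n - (2 * h - 2) - 1 + 1 = n + 2 - 2 * h by omega, h4]
        omega

/-- `K^A_{n,0,g}` with `g = d / 2 - 1`. -/
theorem isPivotal_pivotA_zero {h n : ℕ} (hh : 1 ≤ h) (hn : h ≤ n + 1) :
    IsPivotal (weightA (2 * h)) ((n : ℤ) + 1 - ((n + 1) / h : ℕ))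
      (FaceA n 0 (h - 1)) (pivotA (2 * h) n 0 (h - 1)) :=
  (isPivotal_pivotA_zero_aux hh n).1 hn

/-- The values `f = h` and `f = h - 2` are exchanged by `f ↦ d - 2 - f`. -/
theorem isPivotal_pivotA_half_aux {h : ℕ} (hh : 1 ≤ h) (n : ℕ) :
    IsPivotal (weightA (2 * h)) ((n : ℤ) + 1 - ((n + 1) / h : ℕ))
      (FaceA n h (h - 1)) (pivotA (2 * h) n h (h - 1)) ∧
    (2 ≤ h → IsPivotal (weightA (2 * h)) ((n : ℤ) + 1 - ((n + 2) / h : ℕ))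
      (FaceA n (h - 2) (h - 1)) (pivotA (2 * h) n (h - 2) (h - 1))) := by
  induction n using Nat.strong_induction_on with
  | _ n ih =>
    refine ⟨?_, fun h2 => ?_⟩
    · refine isPivotal_pivotA (by omega) (by omega) (fun _ h1 => ?_) (fun h1 h2 h3 => ?_)
        fun h1 h2 => ?_
      · rcases Nat.lt_or_ge (n + 1) (2 * h) with h4 | h4
        · rw [div_eq_of_le_of_lt 0 (by omega) (by omega), div_eq_of_le_of_lt 1 (by omega) (by omega)]
          push_cast
          omega
        · rw [div_eq_of_le_of_lt 1 (by omega) (by omega), div_eq_of_le_of_lt 2 (by omega) (by omega)]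
          push_cast
          omega
      · have e1 : (n + 1) / (2 * h) = 1 := div_eq_of_le_of_lt 1 (by omega) (by omega)
        have e2 : (n + 1) / h = 2 := div_eq_of_le_of_lt 2 (by omega) (by omega)
        have e3 : (h + 1) / (2 * h) = 0 := div_eq_of_le_of_lt 0 (by omega) (by omega)
        have e4 : (n - h) / (2 * h) = 0 := div_eq_of_le_of_lt 0 (by omega) (by omega)
        rw [e1, e2, e3, e4]
        push_cast
        omega
      · have h3 := (ih (n - h - 1) (by omega)).2 (by omega)
        rw [show 2 * h - 2 - h = h - 2 by omega]
        convert h3 using 1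
        have h4 := div_sub_mul (x := n + 1) (h := h) 1 (by omega)
        have h5 : 1 ≤ (n + 1) / h := (Nat.le_div_iff_mul_le hh).2 (by omega)
        rw [show n - h - 1 + 2 = n + 1 - 1 * h by omega, h4]
        omega
    · refine isPivotal_pivotA (by omega) (by omega) (fun h0 h1 => ?_) (fun h1 h2 h3 => ?_)
        fun h1 h2 => ?_
      · have e1 : (n + 1) / (2 * h) = 0 := div_eq_of_le_of_lt 0 (by omega) (by omega)
        have e2 : (n + 2) / h = 1 := div_eq_of_le_of_lt 1 (by omega) (by omega)
        rw [e1, e2]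
        push_cast
        omega
      · have h4 : 2 * h ≤ n + 1 := by
          by_contra h4
          rw [Nat.mod_eq_of_lt (by omega)] at h3
          omega
        rw [mod_eq_of_le_of_lt h4 (by omega)] at h3
        have e1 : (n + 1) / (2 * h) = 1 := div_eq_of_le_of_lt 1 (by omega) (by omega)
        have e2 : (n + 2) / h = 2 := div_eq_of_le_of_lt 2 (by omega) (by omega)
        have e3 : (h - 2 + 1) / (2 * h) = 0 := div_eq_of_le_of_lt 0 (by omega) (by omega)
        have e4 : (n - (h - 2)) / (2 * h) = 0 := div_eq_of_le_of_lt 0 (by omega) (by omega)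
        rw [e1, e2, e3, e4]
        push_cast
        omega
      · have h3 := (ih (n - (h - 2) - 1) (by omega)).1
        rw [show 2 * h - 2 - (h - 2) = h by omega]
        convert h3 using 1
        have h4 := div_sub_mul (x := n + 2) (h := h) 1 (by omega)
        have h5 : 1 ≤ (n + 2) / h := (Nat.le_div_iff_mul_le hh).2 (by omega)
        rw [show n - (h - 2) - 1 + 1 = n + 2 - 1 * h by omega, h4]
        omega

/-- `K^A_{n,d/2,g}` with `g = d / 2 - 1`. -/
theorem isPivotal_pivotA_half {h : ℕ} (hh : 1 ≤ h) (n : ℕ) :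
    IsPivotal (weightA (2 * h)) ((n : ℤ) + 1 - ((n + 1) / h : ℕ))
      (FaceA n h (h - 1)) (pivotA (2 * h) n h (h - 1)) :=
  (isPivotal_pivotA_half_aux hh n).1

/-- `K^A_{n,d/2-2,g}` with `g = d / 2 - 1`. -/
theorem isPivotal_pivotA_half_sub_two {h : ℕ} (hh : 2 ≤ h) (n : ℕ) :
    IsPivotal (weightA (2 * h)) ((n : ℤ) + 1 - ((n + 2) / h : ℕ))
      (FaceA n (h - 2) (h - 1)) (pivotA (2 * h) n (h - 2) (h - 1)) :=
  (isPivotal_pivotA_half_aux (by omega) n).2 hh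

/-! ### Sizes of connected components. -/

section ComponentSize

variable {Γ : SimpleGraph ℕ} {σ τ : Finset ℕ} {v : ℕ}

theorem componentSize_mono (h : τ ⊆ σ) : componentSize Γ τ v ≤ componentSize Γ σ v := by
  refine Set.ncard_le_ncard ?_ (σ.finite_toSet.subset fun u hu => hu.2.1)
  rintro u ⟨hv, hu, hr⟩
  exact ⟨h hv, h hu, hr.map (SimpleGraph.induceHomOfLE Γ (Finset.coe_subset.2 h)).toHom⟩

theorem componentSize_eq_zero (h : v ∉ σ) : componentSize Γ σ v = 0 := by
  have : {u : ℕ | ∃ (hv : v ∈ (σ : Set ℕ)) (hu : u ∈ (σ : Set ℕ)),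
    (Γ.induce (σ : Set ℕ)).Reachable ⟨v, hv⟩ ⟨u, hu⟩} = ∅ :=
    Set.eq_empty_of_forall_notMem fun u hu => h hu.1
  rw [componentSize, this, Set.ncard_empty]

/-- A set containing `v` and closed under adjacency in `σ` contains the component; conversely the
decreasing function `f` leads from any vertex of `C` back to `v` inside `C`. -/
theorem componentSize_eq {C : Finset ℕ} (hC : C ⊆ σ) (hv : v ∈ C)
    (hcl : ∀ x ∈ C, ∀ y ∈ σ, Γ.Adj x y → y ∈ C) (f : ℕ → ℕ)
    (hf : ∀ x ∈ C, x ≠ v → ∃ y ∈ C, Γ.Adj y x ∧ f y < f x) : componentSize Γ σ v = C.card := by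
  rw [componentSize, ← Set.ncard_coe_finset]
  congr 1
  ext u
  constructor
  · rintro ⟨hv', hu, hr⟩
    rw [SimpleGraph.reachable_iff_reflTransGen] at hr
    have : ∀ y : (σ : Set ℕ), Relation.ReflTransGen (Γ.induce (σ : Set ℕ)).Adj ⟨v, hv'⟩ y →
        (y : ℕ) ∈ C := by
      intro y hy
      induction hy with
      | refl => exact hv
      | tail _ h ih => exact hcl _ ih _ (Finset.mem_coe.1 (Subtype.property _)) h
    exact this _ hr
  · intro hu
    refine ⟨hC hv, hC hu, ?_⟩
    induction hk : f u using Nat.strong_induction_on generalizing u with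
    | _ k ih =>
      by_cases huv : u = v
      · subst huv
        exact SimpleGraph.Reachable.refl _
      · obtain ⟨y, hy, hadj, hlt⟩ := hf u hu huv
        refine (ih (f y) (hk ▸ hlt) y hy rfl).trans (SimpleGraph.Adj.reachable ?_)
        exact hadj

theorem componentSize_graphD {e : ℕ} (he : 4 ≤ e) (he' : e ∉ σ)
    (h : ∀ i, 0 < i → i < e → i ∈ σ) : componentSize graphD σ 1 = e - 1 := by
  -- The vertices are ranked `1, 3, 2, 4, 5, …`, since `2` is reached from `1` only through `3`.
  rw [componentSize_eq (C := Finset.Ioo 0 e) (fun x hx => ?_) (by simp; omega)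
    (fun x hx y hy hxy => ?_) (fun x => if x = 1 then 0 else if x = 3 then 1 else x)
    (fun x hx hx1 => ?_)]
  · rw [Nat.card_Ioo]; omega
  · rw [Finset.mem_Ioo] at hx
    exact h x hx.1 hx.2
  · rw [Finset.mem_Ioo] at hx ⊢
    rw [graphD, SimpleGraph.fromRel_adj] at hxy
    have : y ≠ e := fun h => he' (h ▸ hy)
    omega
  · rw [Finset.mem_Ioo] at hx
    simp only [Finset.mem_Ioo, graphD, SimpleGraph.fromRel_adj]
    rcases (show x = 2 ∨ x = 3 ∨ 4 ≤ x by omega) with rfl | rfl | h4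
    · exact ⟨3, by omega, by omega, by simp⟩
    · exact ⟨1, by omega, by omega, by simp⟩
    · refine ⟨x - 1, by omega, by omega, ?_⟩
      split_ifs <;> omega

theorem componentSize_graphAffineB {n k : ℕ} (hn : 3 ≤ n) (hk1 : 1 ≤ k) (hk : k ≤ n)
    (hle : ∀ i ∈ σ, i ≤ n) (h : ∀ i, n - k < i → i ≤ n → i ∈ σ) (hk' : n - k ∉ σ)
    (h0 : n = k + 1 → 0 ∉ σ) : componentSize graphAffineB σ n = k := by
  rw [componentSize_eq (C := Finset.Ioc (n - k) n) (fun x hx => ?_) (by simp; omega)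
    (fun x hx y hy hxy => ?_) (fun x => n - x) (fun x hx hxn => ?_)]
  · rw [Nat.card_Ioc]; omega
  · rw [Finset.mem_Ioc] at hx
    exact h x hx.1 hx.2
  · rw [Finset.mem_Ioc] at hx ⊢
    rw [graphAffineB, SimpleGraph.fromRel_adj] at hxy
    have h1 : y ≠ n - k := fun h => hk' (h ▸ hy)
    have h2 := hle y hy
    have h3 : n = k + 1 → y ≠ 0 := fun h h' => h0 h (h' ▸ hy)
    unfold ForkEdge at hxy
    omega
  · rw [Finset.mem_Ioc] at hx
    simp only [Finset.mem_Ioc, graphAffineB, SimpleGraph.fromRel_adj, ForkEdge]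
    exact ⟨x + 1, by omega, by omega, by omega⟩

theorem componentSize_graphAffineB_erase {n : ℕ} (hn : 3 ≤ n) :
    componentSize graphAffineB ((Finset.range (n + 1)).erase 1) n = n := by
  rw [componentSize_eq (C := (Finset.range (n + 1)).erase 1) subset_rfl (by simp; omega)
    (fun x hx y hy hxy => hy) (fun x => n - x) (fun x hx hxn => ?_)]
  · rw [Finset.card_erase_of_mem (by simp; omega), Finset.card_range, Nat.add_sub_cancel]
  · rw [Finset.mem_erase, Finset.mem_range] at hx
    simp only [Finset.mem_erase, Finset.mem_range, graphAffineB, SimpleGraph.fromRel_adj, ForkEdge]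
    rcases Nat.eq_zero_or_pos x with rfl | h0
    · exact ⟨2, by omega, by omega, by omega⟩
    · exact ⟨x + 1, by omega, by omega, by omega⟩

end ComponentSize

/-! ### Change of the weight in type `D`. -/

section WeightD

theorem weightA_filter_interval {d : ℕ} (hd : 2 ≤ d) {σ : Finset ℕ} {v e : ℕ} (hve : v < e)
    (he : e ∉ σ) (h : ∀ i, v < i → i < e → i ∈ σ) :
    weightA d (σ.filter (v < ·)) = (e - v) / d + weightA d (σ.filter (e < ·)) := by
  rw [weightA_interval hd (σ := σ.filter (v < ·)) hve (by simp) (by simp [he])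
    (fun i hi hi' => by simp [hi, h i hi hi'])]
  have h1 : (σ.filter (v < ·)).filter (· < v) = ∅ := by
    ext x; simp only [Finset.mem_filter, Finset.notMem_empty, iff_false]; omega
  have h2 : (σ.filter (v < ·)).filter (e < ·) = σ.filter (e < ·) := by
    ext x; simp only [Finset.mem_filter]; grind
  rw [h1, h2, weightA_empty, zero_add]

theorem weightA_shiftDown_eq (d a : ℕ) (σ : Finset ℕ) :
    weightA d (shiftDown a σ) = weightA d (σ.filter (a < ·)) := by
  have h0 : 0 ∉ shiftDown a σ := fun h => by simpa using (mem_shiftDown.1 h).1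
  rw [← weightA_map d a h0]
  congr 1
  ext x
  simp only [Finset.mem_map, addRightEmbedding_apply, Finset.mem_filter, mem_shiftDown]
  constructor
  · rintro ⟨y, hy, rfl⟩
    exact ⟨hy.2, by omega⟩
  · rintro ⟨h1, h2⟩
    exact ⟨x - a, ⟨by omega, by rwa [Nat.sub_add_cancel h2.le]⟩, by omega⟩

theorem weightD_eq (d : ℕ) {σ : Finset ℕ} {e : ℕ} (he : 3 ≤ e) (heσ : e ∉ σ)
    (h : ∀ i, 0 < i → i < e → i ∈ σ) :
    weightD d σ = weightBlockD d (e - 1) + weightA d (σ.filter (e < ·)) := by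
  rw [weightD_of_prefix d (k := e - 1) (by omega) (fun i hi hi' => h i hi (by omega))
    (by rwa [Nat.sub_add_cancel (by omega)])]
  congr 2
  ext x
  have : x ∈ σ → x ≠ e := fun h h' => heσ (h' ▸ h)
  simp only [Finset.mem_filter]
  grind

/-- The change of the weight in type `D` when a vertex `v` is added to an initial interval. -/
theorem weightD_insert {d : ℕ} (hd : 2 ≤ d) {σ : Finset ℕ} {v e : ℕ} (hv : 3 ≤ v) (hve : v < e)
    (hvσ : v ∉ σ) (he : e ∉ σ) (h1 : ∀ i, 0 < i → i < v → i ∈ σ) (h2 : ∀ i, v < i → i < e → i ∈ σ) :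
    weightD d (insert v σ) + weightBlockD d (v - 1) + (e - v) / d =
      weightD d σ + weightBlockD d (e - 1) := by
  rw [weightD_eq d hv hvσ h1, weightA_filter_interval hd hve he h2,
    weightD_eq d (e := e) (by omega) (by simp [he, hve.ne'])]
  · have : (insert v σ).filter (e < ·) = σ.filter (e < ·) := by
      ext x; simp only [Finset.mem_filter, Finset.mem_insert]; grind
    rw [this]
    ring
  · intro i hi hi'
    rw [Finset.mem_insert]
    rcases lt_trichotomy i v with h | h | h
    · exact .inr (h1 i hi h)
    · exact .inl h
    · exact .inr (h2 i h hi')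

/-- The change of the weight in type `D` when the vertex `1` is added. -/
theorem weightD_insert_one {d : ℕ} (hd : 2 ≤ d) {σ : Finset ℕ} {e : ℕ} (h0 : 0 ∉ σ) (hve : 3 ≤ e)
    (h1 : 1 ∉ σ) (he : e ∉ σ) (h2 : ∀ i, 1 < i → i < e → i ∈ σ) :
    weightD d (insert 1 σ) + (e - 1) / d = weightD d σ + weightBlockD d (e - 1) := by
  rw [weightD_of_one_notMem d (h2 2 (by omega) (by omega)) h1,
    weightD_eq d (e := e) (by omega) (by simp [he]; omega)]
  · have h3 : (insert 1 σ).filter (e < ·) = σ.filter (e < ·) := by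
      ext x; simp only [Finset.mem_filter, Finset.mem_insert]; grind
    have h4 : σ.filter (1 < ·) = σ := by
      ext x
      have h5 : x ∈ σ → x ≠ 0 := fun h h' => h0 (h' ▸ h)
      have h6 : x ∈ σ → x ≠ 1 := fun h h' => h1 (h' ▸ h)
      simp only [Finset.mem_filter]
      grind
    have h5 := weightA_filter_interval hd (v := 1) (by omega) he h2
    rw [h4] at h5
    rw [h3, h5]
    ring
  · intro i hi hi'
    rw [Finset.mem_insert]
    rcases (show i = 1 ∨ 1 < i by omega) with h | h
    · exact .inl h
    · exact .inr (h2 i h hi')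

theorem weightD_Icc (d : ℕ) {m : ℕ} (hm : 2 ≤ m) :
    weightD d (Finset.Icc 1 m) = weightBlockD d m := by
  rw [weightD_eq d (e := m + 1) (by omega) (by simp)
    (fun i hi hi' => Finset.mem_Icc.2 (by omega)), Nat.add_sub_cancel]
  have : (Finset.Icc 1 m).filter (m + 1 < ·) = ∅ := by
    ext x; simp only [Finset.mem_filter, Finset.mem_Icc, Finset.notMem_empty, iff_false]; omega
  rw [this, weightA_empty, add_zero]

theorem weightBlockD_even (h j : ℕ) :
    weightBlockD (2 * h) j = (j - 1) / h + if 2 * h ∣ j then 1 else 0 := by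
  rw [weightBlockD, weightBlockB_even]

theorem not_dvd_of_lt {d x : ℕ} (q : ℕ) (h1 : q * d < x) (h2 : x < q * d + d) : ¬ d ∣ x := by
  rintro ⟨y, rfl⟩
  rw [mul_comm] at h1
  have h3 : q < y := Nat.lt_of_mul_lt_mul_left (a := d) (by linarith)
  have h4 : y < q + 1 := Nat.lt_of_mul_lt_mul_left (a := d) (by linarith)
  omega

/-- The weight of `D_j` is `⌊(j-1)/h⌋ + [2h ∣ j]`. At an even multiple `j = qh` the bracket makes up
for the floor, which is still `q - 1`; at the odd multiple `j = qh + h` the floor is still `q` and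
the bracket is `0`. So both ends of the range belong to the even quotient, whence the convention
that `q` is even when `h ∣ k`. -/
theorem weightBlockD_of_even {h q j : ℕ} (hh : 1 ≤ h) (hq : Even q) (hq2 : 1 ≤ q) (h1 : q * h ≤ j)
    (h2 : j ≤ q * h + h) : weightBlockD (2 * h) j = q := by
  obtain ⟨r, rfl⟩ := hq
  rw [weightBlockD_even]
  rcases Nat.eq_or_lt_of_le h1 with h3 | h3
  · have h5 : (r + r) * h = (r + r - 1) * h + h := by
      rw [← Nat.succ_mul]; congr 1; omega
    rw [div_eq_of_le_of_lt (r + r - 1) (by omega) (by omega), if_pos ⟨r, by rw [← h3]; ring⟩]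
    omega
  · rw [div_eq_of_le_of_lt (r + r) (by omega) (by omega), if_neg, add_zero]
    have : (r + r) * h = r * (2 * h) := by ring
    exact not_dvd_of_lt r (by omega) (by omega)

theorem weightBlockD_of_odd {h q j : ℕ} (hq : Odd q) (h1 : q * h < j)
    (h2 : j < q * h + h) : weightBlockD (2 * h) j = q := by
  obtain ⟨r, rfl⟩ := hq
  rw [weightBlockD_even, div_eq_of_le_of_lt (2 * r + 1) (by omega) (by omega), if_neg, add_zero]
  have : (2 * r + 1) * h = r * (2 * h) + h := by ring
  exact not_dvd_of_lt r (by omega) (by omega)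

/-- The quotient `q` in the division with remainder `k = q * h + r`, where `0 < r < h` if `h ∤ k`,
and `r ∈ {0, h}` with `q` even if `h ∣ k`. -/
def evenQuotient (h k : ℕ) : ℕ := if k % h = 0 ∧ Odd (k / h) then k / h - 1 else k / h

theorem evenQuotient_mono {h k k' : ℕ} (hk : k ≤ k') : evenQuotient h k ≤ evenQuotient h k' := by
  have h1 := Nat.div_le_div_right (c := h) hk
  unfold evenQuotient
  split_ifs with h2 h3 h3
  · exact Nat.sub_le_sub_right h1 1
  · exact (Nat.sub_le _ _).trans h1
  · rcases Nat.eq_or_lt_of_le h1 with h4 | h4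
    · have h5 := Nat.div_add_mod k h
      have h6 := Nat.div_add_mod k' h
      rw [h4] at h5
      have h7 : k % h = 0 := by omega
      exact absurd ⟨h7, h4 ▸ h3.2⟩ h2
    · exact Nat.le_sub_one_of_lt h4
  · exact h1

theorem evenQuotient_eq_iff_of_even {h k q : ℕ} (hh : 1 ≤ h) (hq : Even q) :
    evenQuotient h k = q ↔ q * h ≤ k ∧ k ≤ q * h + h := by
  have h5 := Nat.div_add_mod k h
  have h6 := Nat.mod_lt k hh
  rw [mul_comm] at h5
  constructor
  · unfold evenQuotient
    split_ifs with h2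
    · obtain ⟨r, hr⟩ := h2.2
      rintro rfl
      rw [hr] at h5 ⊢
      rw [Nat.add_sub_cancel]
      rw [add_one_mul] at h5
      omega
    · rintro rfl
      omega
  · rintro ⟨h1, h2⟩
    rcases Nat.eq_or_lt_of_le h2 with h3 | h3
    · have h4 : k / h = q + 1 := div_eq_of_le_of_lt _ (by rw [h3, Nat.succ_mul])
        (by rw [Nat.succ_mul]; omega)
      rw [evenQuotient, if_pos, h4, Nat.add_sub_cancel]
      refine ⟨?_, h4 ▸ hq.add_one⟩
      rw [h3, ← Nat.succ_mul, Nat.mul_mod_left]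
    · have h4 : k / h = q := div_eq_of_le_of_lt _ h1 h3
      rw [evenQuotient, if_neg, h4]
      rintro ⟨-, h⟩
      rw [h4] at h
      exact Nat.not_even_iff_odd.2 h hq

theorem evenQuotient_eq_iff_of_odd {h k q : ℕ} (hh : 1 ≤ h) (hq : Odd q) :
    evenQuotient h k = q ↔ q * h < k ∧ k < q * h + h := by
  have h5 := Nat.div_add_mod k h
  have h6 := Nat.mod_lt k hh
  rw [mul_comm] at h5
  constructor
  · unfold evenQuotient
    split_ifs with h2
    · obtain ⟨r, hr⟩ := h2.2
      rintro rfl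
      rw [hr, Nat.add_sub_cancel] at hq
      exact absurd hq (by simp)
    · rintro rfl
      have : k % h ≠ 0 := fun h => h2 ⟨h, hq⟩
      omega
  · rintro ⟨h1, h2⟩
    have h4 : k / h = q := div_eq_of_le_of_lt _ h1.le h2
    rw [evenQuotient, if_neg, h4]
    rw [h4] at h5
    omega

end WeightD

/-! ### Matchings in type `D`. -/

theorem FaceA.mem {m s g : ℕ} {σ : Finset ℕ} (h : FaceA m s g σ) {i : ℕ} (hi : 0 < i)
    (hi' : i < s + 1) : i ∈ σ := h.2.1 i hi (by omega)

theorem FaceA.le {m s g i : ℕ} {σ : Finset ℕ} (h : FaceA m s g σ) (hi : 1 ≤ s) (his : i ≤ s) :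
    i ≤ m := by
  have := h.1 s (h.2.1 s hi le_rfl)
  omega

/-- The matching on the simplices of type `D` that contain `{1, …, s}` but not
`{1, …, s} ∪ {v, …, v + f}`, where `v = s + 1`. -/
theorem isPivotal_initial {h s f g m q : ℕ} {c c' : ℤ} {K : Finset ℕ → Prop}
    {p : Finset ℕ → Option ℕ} (hh : 1 ≤ h) (hs : 2 ≤ s) (hf : f < 2 * h)
    (hK : ∀ σ, K σ ↔ FaceA m s g σ ∧ ¬ Finset.Icc (s + 1) (s + 1 + f) ⊆ σ)
    (hp : ∀ σ, K σ → p σ = if s + 1 ∈ σ then (if s + 1 ≤ m - g then some (s + 1) else none)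
      else if m < s + 1 then none
      else if Finset.Icc (s + 2) (s + 1 + f) ⊆ σ then
        (pivotA (2 * h) (m - (s + 1)) f g (shiftDown (s + 1) σ)).map (· + (s + 1))
      else some (s + 1))
    (hq : ∀ j, s ≤ j → j ≤ s + f → weightBlockD (2 * h) j = q)
    (hc : s ≤ m → m ≤ s + f → m ≤ s + g → (m : ℤ) - q = c)
    (hA : s + 1 + g ≤ m → IsPivotal (weightA (2 * h)) c' (FaceA (m - (s + 1)) f g)
      (pivotA (2 * h) (m - (s + 1)) f g))
    (hc' : s + 1 + g ≤ m → c' + s = c + q) :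
    IsPivotal (weightD (2 * h)) c K p := by
  -- If `s + 1` is one of the last `g` vertices or exceeds `m`, the only possible simplex is `{1, …,
  -- m}`, which is critical.
  by_cases hm : s + 1 + g ≤ m
  swap
  · have hσ : ∀ σ, K σ → σ = Finset.Icc 1 m ∧ s ≤ m ∧ m < s + 1 + f := by
      intro σ hσ
      obtain ⟨h1, h2⟩ := (hK σ).1 hσ
      have h3 := eq_Icc_of_faceA (by omega) h1
      refine ⟨h3, h1.le (by omega) le_rfl, ?_⟩
      by_contra h4
      refine h2 fun x hx => ?_
      rw [Finset.mem_Icc] at hx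
      rw [h3, Finset.mem_Icc]
      omega
    refine .of_none (fun σ h1 => ?_) fun σ h1 => ?_
    · obtain ⟨h2, h3, h4⟩ := hσ σ h1
      rw [hp σ h1]
      by_cases h5 : s + 1 ∈ σ
      · rw [if_pos h5, if_neg]
        rw [h2, Finset.mem_Icc] at h5
        omega
      · rw [if_neg h5, if_pos]
        rw [h2, Finset.mem_Icc] at h5
        omega
    · obtain ⟨rfl, h3, h4⟩ := hσ σ h1
      rw [weightD_Icc _ (by omega), hq m h3 (by omega), Nat.card_Icc, Nat.add_sub_cancel,
        ← hc h3 (by omega) (by omega)]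
  -- If the next `f` vertices are present, `s + 1` must be missing, and the vertices beyond it form
  -- a complex of type `A`. Otherwise the next gap `e` is at most `s + 1 + f`: adding `s + 1` turns
  -- `D_s` into `D_(e-1)`, still of weight `q`, and the absorbed block of type `A` had weight `0`.
  refine .of_upper (fun σ => Finset.Icc (s + 2) (s + 1 + f) ⊆ σ)
    (fun τ σ _ _ h h' => h'.trans h) ?_ ?_
  · have hnot : ∀ σ, K σ ∧ Finset.Icc (s + 2) (s + 1 + f) ⊆ σ → s + 1 ∉ σ := fun σ hσ h1 => by
      refine ((hK σ).1 hσ.1).2 fun x hx => ?_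
      rw [Finset.mem_Icc] at hx
      rcases Nat.eq_or_lt_of_le hx.1 with rfl | h2
      · exact h1
      · exact hσ.2 (Finset.mem_Icc.2 (by omega))
    refine (hA hm).of_shiftDown (s + 1) (Finset.Icc 1 s) q
      (fun x hx => by rw [Finset.mem_Icc] at hx; omega) (fun ρ hρ => hρ.zero_notMem)
      (by simpa using hc' hm) (fun σ => ⟨fun hσ => ⟨fun x hx => ?_, hnot σ hσ, ?_⟩, ?_⟩) ?_ ?_
    · have h1 := ((hK σ).1 hσ.1).1
      rw [Finset.mem_Icc]
      exact ⟨fun h => ⟨(h1.1 x h).1, by omega⟩, fun h => h1.2.1 x h.1 h.2⟩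
    · have h1 := ((hK σ).1 hσ.1).1
      refine ⟨fun i hi => ?_, fun i hi hi' => ?_, fun i hi hi' hi'' => ?_⟩
      · rw [mem_shiftDown] at hi
        have := h1.1 _ hi.2
        omega
      · exact mem_shiftDown.2 ⟨hi, hσ.2 (Finset.mem_Icc.2 (by omega))⟩
      · exact mem_shiftDown.2 ⟨hi', h1.2.2 _ (by omega) (by omega) (by omega)⟩
    · rintro ⟨h1, h2, h3⟩
      refine ⟨(hK σ).2 ⟨⟨fun i hi => ?_, fun i hi hi' => ?_, fun i hi hi' hi'' => ?_⟩, fun h => ?_⟩,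
        fun i hi => ?_⟩
      · by_cases his : i < s + 1
        · have := (h1 i his).1 hi
          rw [Finset.mem_Icc] at this
          omega
        · have his' : i ≠ s + 1 := fun h => h2 (h ▸ hi)
          have := h3.1 (i - (s + 1)) (mem_shiftDown.2 ⟨by omega, by
            rwa [Nat.sub_add_cancel (by omega)]⟩)
          omega
      · exact (h1 i (by omega)).2 (Finset.mem_Icc.2 (by omega))
      · have := (mem_shiftDown.1 (h3.2.2 (i - (s + 1)) (by omega) (by omega) (by omega))).2
        rwa [Nat.sub_add_cancel (by omega)] at this
      · exact h2 (h (Finset.mem_Icc.2 (by omega)))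
      · rw [Finset.mem_Icc] at hi
        have := (mem_shiftDown.1 (h3.2.1 (i - (s + 1)) (by omega) (by omega))).2
        rwa [Nat.sub_add_cancel (by omega)] at this
    · intro σ hσ
      rw [hp σ hσ.1, if_neg (hnot σ hσ), if_neg (by omega), if_pos hσ.2]
    · intro σ hσ
      have h1 := ((hK σ).1 hσ.1).1
      rw [weightD_eq _ (by omega) (hnot σ hσ) (fun i hi hi' => h1.mem hi hi'),
        weightA_shiftDown_eq, Nat.add_sub_cancel, hq s le_rfl (by omega), add_comm]
  · refine .of_forall (s + 1) (fun σ hσ => ?_) (fun σ hv => ?_) fun σ hv hσ => ?_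
    · rw [hp σ hσ.1, if_pos (show s + 1 ≤ m - g by omega), if_neg (show ¬ m < s + 1 by omega),
        if_neg hσ.2, ite_self]
    · have h1 : ∀ τ, (K τ ∧ ¬ Finset.Icc (s + 2) (s + 1 + f) ⊆ τ) ↔
          FaceA m s g τ ∧ ¬ Finset.Icc (s + 2) (s + 1 + f) ⊆ τ := by
        intro τ
        rw [hK]
        refine ⟨fun h => ⟨h.1.1, h.2⟩, fun h => ⟨⟨h.1, fun h' => h.2 (subset_trans ?_ h')⟩, h.2⟩⟩
        exact Finset.Icc_subset_Icc (by omega) le_rfl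
      rw [h1, h1, FaceA.insert_iff (by omega) hm hv, Finset.subset_insert_iff_of_notMem (by simp)]
    · obtain ⟨e, he, heσ, hI⟩ := exists_prefix σ (s + 1)
      have h1 := weightD_insert (d := 2 * h) (by omega) (by omega) he hv heσ
        (fun i hi hi' => ((hK σ).1 hσ.1).1.mem hi hi') hI
      have h2 : e ≤ s + 1 + f := by
        by_contra h2
        exact hσ.2 fun i hi => by
          rw [Finset.mem_Icc] at hi
          exact hI i (by omega) (by omega)
      rw [hq _ (by omega) (by omega), hq _ (by omega) (by omega), Nat.div_eq_of_lt (by omega)] at h1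
      omega

/-- The last rule in type `D`. -/
noncomputable def pivotDInitial (h m g : ℕ) (σ : Finset ℕ) : Option ℕ :=
  let q := evenQuotient h (componentSize graphD σ 1)
  let v := if Even q then q * h + 1 else q * h + 2
  if v ∈ σ then (if v ≤ m - g then some v else none)
  else if m < v then none
  else if Even q ∧ Finset.Icc (q * h + 2) ((q + 1) * h + 1) ⊆ σ then
    (pivotA (2 * h) (m - q * h - 1) h g (shiftDown (q * h + 1) σ)).map (· + (q * h + 1))
  else if Odd q ∧ Finset.Icc (q * h + 3) ((q + 1) * h) ⊆ σ then
    (pivotA (2 * h) (m - q * h - 2) (h - 2) g (shiftDown (q * h + 2) σ)).map (· + (q * h + 2))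
  else some v

/-- All simplices contain `{1, …, max (h+1) 4}`, so the component of `1` is the interval up to the
first gap, and its quotient `q` is monotone in `σ`. On the fibre of `q`, `isPivotal_initial` applies
with `s = qh`, `f = h` for `q` even and with `s = qh + 1`, `f = h - 2` for `q` odd, these being the
ranges in which the weight of `D_j` is constant. The other quotients have empty fibres. -/
theorem isPivotal_pivotDInitial {h m : ℕ} (hh : 1 ≤ h) :
    IsPivotal (weightD (2 * h)) ((m : ℤ) - (m / h : ℕ)) (FaceA m (max (h + 1) 4) (h - 1))
      (pivotDInitial h m (h - 1)) := by
  have hk : ∀ {σ e}, FaceA m (max (h + 1) 4) (h - 1) σ → e ∉ σ → (∀ i, 0 < i → i < e → i ∈ σ) →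
      0 < e → h + 2 ≤ e ∧ 5 ≤ e ∧ componentSize graphD σ 1 = e - 1 := by
    intro σ e hσ he hI he0
    have h1 : max (h + 1) 4 < e := by
      by_contra h1
      exact he (hσ.2.1 e he0 (by omega))
    have h2 := le_max_left (h + 1) 4
    have h3 := le_max_right (h + 1) 4
    exact ⟨by omega, by omega, componentSize_graphD (by omega) he hI⟩
  refine .of_fiber (fun σ => evenQuotient h (componentSize graphD σ 1))
    (fun τ σ _ _ hs => evenQuotient_mono (componentSize_mono hs)) fun q => ?_
  rcases Nat.even_or_odd q with hq | hq
  · by_cases hq4 : 4 ≤ q * h ∧ h + 1 ≤ q * h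
    swap
    · refine .of_isEmpty fun σ hσ => ?_
      obtain ⟨e, he0, he, hI⟩ := exists_prefix σ 0
      obtain ⟨h1, h2, h3⟩ := hk hσ.1 he hI he0
      have h4 := hσ.2
      simp only [h3] at h4
      rw [evenQuotient_eq_iff_of_even hh hq] at h4
      obtain ⟨r, rfl⟩ := hq
      have : r = 0 ∨ r = 1 ∨ 2 ≤ r := by omega
      rcases this with rfl | rfl | hr
      · omega
      · omega
      · have : 4 * h ≤ (r + r) * h := Nat.mul_le_mul_right h (by omega)
        omega
    have hq1 : 1 ≤ q := by
      rcases Nat.eq_zero_or_pos q with rfl | hq1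
      · omega
      · exact hq1
    refine isPivotal_initial (m := m) (s := q * h) (f := h) (g := h - 1) (q := q) hh (by omega) (by omega)
      (fun σ => ⟨fun hσ => ?_, fun hσ => ?_⟩) (fun σ hσ => ?_)
      (fun j hj hj' => weightBlockD_of_even hh hq hq1 hj hj') (fun h1 h2 h3 => ?_)
      (fun _ => isPivotal_pivotA_half hh _) fun h1 => ?_
    · obtain ⟨e, he0, he, hI⟩ := exists_prefix σ 0
      obtain ⟨h1, h2, h3⟩ := hk hσ.1 he hI he0
      have h4 := hσ.2
      simp only [h3] at h4
      rw [evenQuotient_eq_iff_of_even hh hq] at h4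
      refine ⟨⟨hσ.1.1, fun i hi hi' => hI i (by omega) (by omega), hσ.1.2.2⟩, fun h => he (h ?_)⟩
      rw [Finset.mem_Icc]
      omega
    · obtain ⟨e, he0, he, hI⟩ := exists_prefix σ 0
      have h1 : FaceA m (max (h + 1) 4) (h - 1) σ :=
        ⟨hσ.1.1, fun i hi hi' => hσ.1.2.1 i hi (hi'.trans (max_le (by omega) (by omega))),
          hσ.1.2.2⟩
      obtain ⟨-, -, h3⟩ := hk h1 he hI he0
      refine ⟨h1, ?_⟩
      rw [h3, evenQuotient_eq_iff_of_even hh hq]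
      constructor
      · by_contra h4
        exact he (hσ.1.2.1 e he0 (by omega))
      · by_contra h4
        refine hσ.2 fun i hi => ?_
        rw [Finset.mem_Icc] at hi
        exact hI i (by omega) (by omega)
    · have h1 := hσ.2
      have hq' : ¬ Odd q := Nat.not_odd_iff_even.2 hq
      rw [pivotDInitial]
      simp only [h1, hq, hq', true_and, false_and, if_false, if_true]
      rw [show (q + 1) * h + 1 = q * h + 1 + h by ring, show m - q * h - 1 = m - (q * h + 1) by omega]
    · rw [div_eq_of_le_of_lt q h1 (by omega)]
    · have h2 := div_sub_mul q (show q * h ≤ m by omega)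
      have h3 : q ≤ m / h := (Nat.le_div_iff_mul_le hh).2 (by omega)
      rw [show m - (q * h + 1) + 1 = m - q * h by omega, h2]
      omega
  · by_cases hq4 : 4 ≤ q * h + 1 ∧ 2 ≤ h
    swap
    · refine .of_isEmpty fun σ hσ => ?_
      obtain ⟨e, he0, he, hI⟩ := exists_prefix σ 0
      obtain ⟨h1, h2, h3⟩ := hk hσ.1 he hI he0
      have h4 := hσ.2
      simp only [h3] at h4
      rw [evenQuotient_eq_iff_of_odd hh hq] at h4
      obtain ⟨r, rfl⟩ := hq
      rcases Nat.eq_zero_or_pos r with rfl | hr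
      · omega
      · have : 3 * h ≤ (2 * r + 1) * h := Nat.mul_le_mul_right h (by omega)
        omega
    have hq1 : h ≤ q * h := Nat.le_mul_of_pos_left h hq.pos
    refine isPivotal_initial (m := m) (s := q * h + 1) (f := h - 2) (g := h - 1) (q := q) hh (by omega)
      (by omega) (fun σ => ⟨fun hσ => ?_, fun hσ => ?_⟩) (fun σ hσ => ?_)
      (fun j hj hj' => weightBlockD_of_odd hq (by omega) (by omega)) (fun h1 h2 h3 => ?_)
      (fun _ => isPivotal_pivotA_half_sub_two hq4.2 _) fun h1 => ?_
    · obtain ⟨e, he0, he, hI⟩ := exists_prefix σ 0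
      obtain ⟨h1, h2, h3⟩ := hk hσ.1 he hI he0
      have h4 := hσ.2
      simp only [h3] at h4
      rw [evenQuotient_eq_iff_of_odd hh hq] at h4
      refine ⟨⟨hσ.1.1, fun i hi hi' => hI i (by omega) (by omega), hσ.1.2.2⟩, fun h => he (h ?_)⟩
      rw [Finset.mem_Icc]
      omega
    · obtain ⟨e, he0, he, hI⟩ := exists_prefix σ 0
      have h1 : FaceA m (max (h + 1) 4) (h - 1) σ :=
        ⟨hσ.1.1, fun i hi hi' => hσ.1.2.1 i hi (hi'.trans (max_le (by omega) (by omega))),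
          hσ.1.2.2⟩
      obtain ⟨-, -, h3⟩ := hk h1 he hI he0
      refine ⟨h1, ?_⟩
      rw [h3, evenQuotient_eq_iff_of_odd hh hq]
      constructor
      · by_contra h4
        exact he (hσ.1.2.1 e he0 (by omega))
      · by_contra h4
        refine hσ.2 fun i hi => ?_
        rw [Finset.mem_Icc] at hi
        exact hI i (by omega) (by omega)
    · have h1 := hσ.2
      have hq' : ¬ Even q := Nat.not_even_iff_odd.2 hq
      rw [pivotDInitial]
      simp only [h1, hq, hq', true_and, false_and, if_false]
      rw [show (q + 1) * h = q * h + 1 + 1 + (h - 2) by rw [add_one_mul]; omega,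
        show m - q * h - 2 = m - (q * h + 1 + 1) by omega]
    · rw [div_eq_of_le_of_lt q (by omega) (by omega)]
    · have h2 := div_sub_mul q (show q * h ≤ m by omega)
      have h3 : q ≤ m / h := (Nat.le_div_iff_mul_le hh).2 (by omega)
      rw [show m - (q * h + 1 + 1) + 2 = m - q * h by omega, h2]
      omega

/-- The relabelling `1, 2, 3, … ↦ 1, 3, 4, …`. -/
def relabelDInv : ℕ ↪ ℕ where
  toFun i := if 2 ≤ i then i + 1 else i
  inj' i j hij := by
    simp only at hij
    split_ifs at hij <;> omega

theorem relabelDInv_apply (i : ℕ) : relabelDInv i = if 2 ≤ i then i + 1 else i := rfl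

theorem relabelD_relabelDInv (i : ℕ) : relabelD (relabelDInv i) = i := by
  simp only [relabelD, relabelDInv_apply]
  split_ifs <;> omega

theorem image_relabelD_map (ρ : Finset ℕ) : (ρ.map relabelDInv).image relabelD = ρ := by
  rw [Finset.map_eq_image, Finset.image_image]
  exact (Finset.image_congr fun i _ => relabelD_relabelDInv i).trans Finset.image_id

theorem relabelDInv_relabelD {i : ℕ} (h2 : i ≠ 2) : relabelDInv (relabelD i) = i := by
  simp only [relabelD, relabelDInv_apply]
  split_ifs <;> omega

theorem map_image_relabelD {σ : Finset ℕ} (h2 : 2 ∉ σ) :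
    (σ.image relabelD).map relabelDInv = σ := by
  rw [Finset.map_eq_image, Finset.image_image]
  conv_rhs => rw [← Finset.image_id (s := σ)]
  refine Finset.image_congr fun i hi => ?_
  exact relabelDInv_relabelD (fun h => h2 (h ▸ hi))

/-- Without the vertex `2` the diagram is the path `1, 3, 4, …`. The bound on `m` keeps `2` out of
the last `g` vertices. -/
theorem isPivotal_relabelD {d m g : ℕ} {c : ℤ} {K : Finset ℕ → Prop} {p : Finset ℕ → Option ℕ}
    (hm : g + 2 ≤ m)
    (hA : IsPivotal (weightA d) c (FaceA (m - 1) 0 g) (pivotA d (m - 1) 0 g))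
    (hK : ∀ σ, K σ ↔ FaceA m 0 g σ ∧ 2 ∉ σ)
    (hp : ∀ σ, K σ → p σ = (pivotA d (m - 1) 0 g (σ.image relabelD)).map
      fun p => if p = 1 then 1 else p + 1) : IsPivotal (weightD d) c K p := by
  have hmem : ∀ (ρ : Finset ℕ) i, relabelDInv i ∈ ρ.map relabelDInv ↔ i ∈ ρ := fun ρ i => by simp
  have h2 : ∀ ρ : Finset ℕ, 2 ∉ ρ.map relabelDInv := fun ρ h => by
    obtain ⟨i, -, hi⟩ := Finset.mem_map.1 h
    simp only [relabelDInv_apply] at hi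
    split_ifs at hi <;> omega
  have hge : ∀ i, 2 ≤ i → relabelDInv i = i + 1 := fun i hi => by simp [relabelDInv_apply, hi]
  have hF : ∀ ρ, FaceA m 0 g (ρ.map relabelDInv) ↔ FaceA (m - 1) 0 g ρ := by
    intro ρ
    constructor
    · intro h
      refine ⟨fun i hi => ?_, fun i hi hi' => by omega, fun i hi hi' hi'' => ?_⟩
      · have h1 := h.1 _ ((hmem ρ i).2 hi)
        simp only [relabelDInv_apply] at h1
        split_ifs at h1 <;> omega
      · rw [← hmem, hge i (by omega)]
        exact h.2.2 _ (by omega) (by omega) (by omega)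
    · intro h
      refine ⟨fun i hi => ?_, fun i hi hi' => by omega, fun i hi hi' hi'' => ?_⟩
      · obtain ⟨j, hj, rfl⟩ := Finset.mem_map.1 hi
        have h1 := h.1 j hj
        simp only [relabelDInv_apply]
        split_ifs <;> omega
      · have h1 := (hmem ρ (i - 1)).2 (h.2.2 (i - 1) (by omega) (by omega) (by omega))
        rwa [hge _ (by omega), Nat.sub_add_cancel hi'] at h1
  refine hA.transport ∅ relabelDInv 0 (by simp) (by simp) (fun σ hσ => ?_) (fun ρ hρ => ?_)
    (fun ρ hρ => ?_) fun ρ hρ => ?_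
  · obtain ⟨h1, h3⟩ := (hK σ).1 hσ
    have h4 := map_image_relabelD h3
    refine ⟨σ.image relabelD, ?_, by rw [h4, Finset.empty_union]⟩
    rw [← hF, h4]
    exact h1
  · rw [Finset.empty_union]
    exact (hK _).2 ⟨(hF ρ).2 hρ, h2 ρ⟩
  · rw [Finset.empty_union, hp _ ((hK _).2 ⟨(hF ρ).2 hρ, h2 ρ⟩), image_relabelD_map]
    cases hu : pivotA d (m - 1) 0 g ρ with
    | none => rfl
    | some u =>
      -- The relabelling in the rule and `relabelDInv` differ only at `0`.
      have hu0 : u ≠ 0 := by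
        rintro rfl
        have h1 := (hA.toggle ρ 0 hρ hu).1
        rw [toggle, if_neg hρ.zero_notMem] at h1
        exact h1.zero_notMem (Finset.mem_insert_self _ _)
      simp only [Option.map_some, relabelDInv_apply, Option.some.injEq]
      split_ifs <;> omega
  · rw [Finset.empty_union, weightD_of_two_notMem d (h2 ρ), image_relabelD_map, add_zero]

theorem weightBlockD_eq_zero {h j : ℕ} (h1 : 1 ≤ j) (h2 : j ≤ h) : weightBlockD (2 * h) j = 0 := by
  rw [weightBlockD_even, Nat.div_eq_of_lt (by omega), if_neg]
  exact fun h3 => by have := Nat.le_of_dvd h1 h3; omega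

/-- Since the next gap satisfies `e - 1 ≤ h`, the block `{2, …, e-1}` of type `A` and the block `{1,
…, e-1}` of type `D` both have weight `0`, so `1` can be toggled. `Q` collects conditions that do
not involve `1`. -/
theorem isPivotal_one {h m g : ℕ} {c : ℤ} {K : Finset ℕ → Prop} {p : Finset ℕ → Option ℕ}
    (hm : g + 1 ≤ m) (Q : Finset ℕ → Prop) (hK : ∀ σ, K σ ↔ FaceA m 0 g σ ∧ Q σ)
    (hQ : ∀ σ, Q σ ↔ Q (insert 1 σ)) (hp : ∀ σ, K σ → p σ = some 1)
    (he : ∀ σ, Q σ → ∃ e, 3 ≤ e ∧ e ≤ h + 1 ∧ e ∉ σ ∧ ∀ i, 1 < i → i < e → i ∈ σ) :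
    IsPivotal (weightD (2 * h)) c K p := by
  refine .of_forall 1 hp (fun σ hσ => ?_) fun σ h1 hσ => ?_
  · rw [hK, hK, FaceA.insert_iff (by omega) (by omega) hσ, hQ]
  · obtain ⟨h2, h3⟩ := (hK σ).1 hσ
    obtain ⟨e, he1, he2, he3, he4⟩ := he σ h3
    have := weightD_insert_one (d := 2 * h) (by omega) h2.zero_notMem he1 h1 he3 he4
    rwa [weightBlockD_eq_zero (by omega) (by omega), Nat.div_eq_of_lt (by omega)] at this

theorem pivotD_eq {h m : ℕ} (hh : 1 ≤ h) (hm : h ≤ m) (σ : Finset ℕ) :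
    pivotD (2 * h) m (h - 1) σ =
      if 2 ∉ σ then (pivotA (2 * h) (m - 1) 0 (h - 1) (σ.image relabelD)).map
        fun p => if p = 1 then 1 else p + 1
      else if 2 * h = 2 ∧ ¬ {1, 2, 3, 4} ⊆ σ then
        if {1, 2, 4} ⊆ σ then (if 5 ≤ m - (h - 1) then some 5 else none)
        else (if 3 ≤ m - (h - 1) then some 3 else none)
      else if 4 ≤ 2 * h ∧ 3 ∉ σ then some 1
      else if 2 * h = 4 ∧ 4 ∉ σ then
        (pivotA (2 * h) (m - 4) 0 (h - 1) (shiftDown 4 σ)).map (· + 4)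
      else if 6 ≤ 2 * h ∧ 4 ∉ σ then some 1
      else if 4 ≤ 2 * h ∧ 1 ∉ σ then
        if Finset.Icc 2 (h + 1) ⊆ σ then
          (pivotA (2 * h) (m - 1) (max h 3) (h - 1) (shiftDown 1 σ)).map (· + 1)
        else some 1
      else pivotDInitial h m (h - 1) σ := by
  rw [pivotD]
  simp only [show 2 * h / 2 = h by omega, if_neg (show ¬ m ≤ h - 1 by omega)]
  rfl

/-- Type `D`, `d = 2`, `2 ∈ σ`. -/
theorem isPivotal_pivotD_two_mem_of_eq {m : ℕ} {K : Finset ℕ → Prop}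
    {p : Finset ℕ → Option ℕ} (hK : ∀ σ, K σ ↔ FaceA m 0 0 σ ∧ 2 ∈ σ)
    (hp : ∀ σ, K σ → p σ = if ¬ {1, 2, 3, 4} ⊆ σ then
        if {1, 2, 4} ⊆ σ then (if 5 ≤ m then some 5 else none)
        else (if 3 ≤ m then some 3 else none)
      else pivotDInitial 1 m 0 σ) :
    IsPivotal (weightD 2) 0 K p := by
  have hsub4 : ∀ σ : Finset ℕ, {1, 2, 3, 4} ⊆ σ ↔ 1 ∈ σ ∧ 2 ∈ σ ∧ 3 ∈ σ ∧ 4 ∈ σ := fun σ => by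
    simp [Finset.insert_subset_iff]
  have hsub3 : ∀ σ : Finset ℕ, {1, 2, 4} ⊆ σ ↔ 1 ∈ σ ∧ 2 ∈ σ ∧ 4 ∈ σ := fun σ => by
    simp [Finset.insert_subset_iff]
  have hF : ∀ σ, FaceA m 0 0 σ ↔ ∀ i ∈ σ, 1 ≤ i ∧ i ≤ m := fun σ =>
    ⟨fun h => h.1, fun h => ⟨h, fun i hi hi' => by omega, fun i hi hi' hi'' => by omega⟩⟩
  have hins : ∀ {σ v}, 0 < v → v ≤ m → v ∉ σ → (FaceA m 0 0 (insert v σ) ↔ FaceA m 0 0 σ) :=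
    fun h1 h2 h3 => FaceA.insert_iff h1 h2 h3
  refine .of_upper (fun σ => {1, 2, 3, 4} ⊆ σ) (fun τ σ _ _ h h' => h'.trans h) ?_ ?_
  · have h1 := isPivotal_pivotDInitial (h := 1) (m := m) le_rfl
    rw [Nat.div_one, sub_self] at h1
    refine h1.congr (fun σ => ?_) fun σ hσ => ?_
    · rw [hK, hsub4]
      constructor
      · intro h
        have h2 : ∀ i, 0 < i → i < 5 → i ∈ σ := fun i hi hi' => h.mem hi hi'
        exact ⟨⟨(hF σ).2 h.1, h2 2 (by omega) (by omega)⟩, h2 1 (by omega) (by omega),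
          h2 2 (by omega) (by omega), h2 3 (by omega) (by omega), h2 4 (by omega) (by omega)⟩
      · rintro ⟨⟨h, -⟩, h1, h2, h3, h4⟩
        refine ⟨h.1, fun i hi hi' => ?_, h.2.2⟩
        have : i ≤ 4 := hi'
        interval_cases i <;> assumption
    · have h2 : ∀ i, 0 < i → i < 5 → i ∈ σ := fun i hi hi' => hσ.mem hi hi'
      rw [hp σ ((hK σ).2 ⟨(hF σ).2 hσ.1, h2 2 (by omega) (by omega)⟩), if_neg]
      rw [hsub4, not_not]
      exact ⟨h2 1 (by omega) (by omega),
          h2 2 (by omega) (by omega), h2 3 (by omega) (by omega), h2 4 (by omega) (by omega)⟩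
  refine .of_upper (fun σ => {1, 2, 4} ⊆ σ) (fun τ σ _ _ h h' => h'.trans h) ?_ ?_
  · have key : ∀ σ, (K σ ∧ ¬ {1, 2, 3, 4} ⊆ σ) ∧ {1, 2, 4} ⊆ σ ↔
        FaceA m 0 0 σ ∧ 1 ∈ σ ∧ 2 ∈ σ ∧ 3 ∉ σ ∧ 4 ∈ σ := by
      intro σ
      rw [hK, hsub3, hsub4]
      tauto
    have hp' : ∀ σ, (K σ ∧ ¬ {1, 2, 3, 4} ⊆ σ) ∧ {1, 2, 4} ⊆ σ →
        p σ = if 5 ≤ m then some 5 else none := fun σ hσ => by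
      rw [hp σ hσ.1.1, if_pos hσ.1.2, if_pos hσ.2]
    by_cases hm : 5 ≤ m
    · refine .of_forall 5 (fun σ hσ => by rw [hp' σ hσ, if_pos hm]) (fun σ hσ => ?_) fun σ hv hσ => ?_
      · rw [key, key, hins (by omega) hm hσ]
        simp
      · obtain ⟨h0, h1, h2, h3, h4⟩ := (key σ).1 hσ
        have h12 : ∀ i, 0 < i → i < 3 → i ∈ σ := fun i hi hi' => by interval_cases i <;> assumption
        rw [weightD_eq 2 (e := 3) le_rfl h3 h12, weightD_eq 2 (e := 3) le_rfl (by simp [h3])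
          fun i hi hi' => Finset.mem_insert_of_mem (h12 i hi hi')]
        obtain ⟨e, he, heσ, hI⟩ := exists_prefix σ 5
        -- The gaps `3` and `5` are at distance `d = 2`, so `⌊(e-3)/2⌋ = 1 + ⌊(e-5)/2⌋` and adding
        -- `5` does not change the weight.
        have h5 := weightA_insert le_rfl (σ := σ.filter (3 < ·)) (a := 3) (v := 5) (e := e)
          (by omega) he (by simp) (by simp [hv]) (by simp [heσ])
          (fun i hi hi' => by
            obtain rfl : i = 4 := by omega
            simpa using h4)
          (fun i hi hi' => by simp only [Finset.mem_filter]; exact ⟨hI i hi hi', by omega⟩)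
        have h6 : (insert 5 σ).filter (3 < ·) = insert 5 (σ.filter (3 < ·)) := by
          rw [Finset.filter_insert, if_pos (by omega)]
        rw [h6]
        omega
    · refine .of_none (fun σ hσ => by rw [hp' σ hσ, if_neg hm]) fun σ hσ => ?_
      obtain ⟨h0, h1, h2, h3, h4⟩ := (key σ).1 hσ
      obtain rfl : σ = {1, 2, 4} := by
        ext x
        simp only [Finset.mem_insert, Finset.mem_singleton]
        refine ⟨fun hx => ?_, ?_⟩
        · have := h0.1 x hx
          have : x ≠ 3 := fun h => h3 (h ▸ hx)
          omega
        · rintro (rfl | rfl | rfl) <;> assumption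
      rw [weightD_eq 2 (e := 3) le_rfl h3 fun i hi hi' => by interval_cases i <;> assumption]
      decide
  · have key : ∀ σ, (K σ ∧ ¬ {1, 2, 3, 4} ⊆ σ) ∧ ¬ {1, 2, 4} ⊆ σ ↔
        FaceA m 0 0 σ ∧ 2 ∈ σ ∧ ¬ (1 ∈ σ ∧ 4 ∈ σ) := by
      intro σ
      rw [hK, hsub3, hsub4]
      tauto
    have hp' : ∀ σ, (K σ ∧ ¬ {1, 2, 3, 4} ⊆ σ) ∧ ¬ {1, 2, 4} ⊆ σ →
        p σ = if 3 ≤ m then some 3 else none := fun σ hσ => by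
      rw [hp σ hσ.1.1, if_pos hσ.1.2, if_neg hσ.2]
    by_cases hm : 3 ≤ m
    · refine .of_forall 3 (fun σ hσ => by rw [hp' σ hσ, if_pos hm]) (fun σ hσ => ?_) fun σ hv hσ => ?_
      · rw [key, key, hins (by omega) hm hσ]
        simp
      · obtain ⟨h0, h2, h14⟩ := (key σ).1 hσ
        by_cases h1 : 1 ∈ σ
        · have h4 : 4 ∉ σ := fun h => h14 ⟨h1, h⟩
          -- Adding `3` turns `D_2` into `D_3`, and both have weight `2`.
          have := weightD_insert (d := 2) (v := 3) (e := 4) le_rfl le_rfl (by omega) hv h4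
            (fun i hi hi' => by interval_cases i <;> assumption) (fun i hi hi' => by omega)
          have e1 : weightBlockD 2 (3 - 1) = 2 := by decide
          have e2 : weightBlockD 2 (4 - 1) = 2 := by decide
          rw [e1, e2] at this
          omega
        · rw [weightD_of_one_notMem _ h2 h1, weightD_of_one_notMem _ (by simp [h2]) (by simp [h1])]
          obtain ⟨e, he, heσ, hI⟩ := exists_prefix σ 3
          have := weightA_insert le_rfl (a := 1) (v := 3) (e := e) (by omega) he h1 hv heσ
            (fun i hi hi' => by
              obtain rfl : i = 2 := by omega
              exact h2) hI
          omega
    · refine .of_none (fun σ hσ => by rw [hp' σ hσ, if_neg hm]) fun σ hσ => ?_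
      obtain ⟨h0, h2, -⟩ := (key σ).1 hσ
      have hσ' : σ ⊆ {1, 2} := fun x hx => by
        have := h0.1 x hx
        simp only [Finset.mem_insert, Finset.mem_singleton]
        omega
      by_cases h1 : 1 ∈ σ
      · obtain rfl : σ = {1, 2} := by
          refine Finset.Subset.antisymm hσ' fun x hx => ?_
          simp only [Finset.mem_insert, Finset.mem_singleton] at hx
          rcases hx with rfl | rfl <;> assumption
        have := weightD_Icc 2 (m := 2) le_rfl
        rw [show Finset.Icc 1 2 = ({1, 2} : Finset ℕ) from rfl] at this
        rw [this]
        decide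
      · obtain rfl : σ = {2} := by
          refine Finset.Subset.antisymm (fun x hx => ?_) (by simpa using h2)
          have := hσ' hx
          simp only [Finset.mem_insert, Finset.mem_singleton] at this ⊢
          exact this.resolve_left fun h => h1 (h ▸ hx)
        rw [weightD_of_one_notMem _ h2 h1]
        decide

/-- For `h ≥ 3` this is the case `f = h`. For `h = 2` one has `f = 3 = d - 1`: there is no
recursion, and only the single simplices for `m = 4` and `m = 5` have to be checked. -/
theorem isPivotal_pivotA_max {h m : ℕ} (hh : 2 ≤ h) (hm : 1 ≤ m) :
    IsPivotal (weightA (2 * h)) ((m : ℤ) - (m / h : ℕ)) (FaceA (m - 1) (max h 3) (h - 1))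
      (pivotA (2 * h) (m - 1) (max h 3) (h - 1)) := by
  rcases Nat.eq_or_lt_of_le hh with rfl | h3
  · rw [show max 2 3 = 3 from rfl]
    refine isPivotal_pivotA (by omega) (by omega) (fun h1 h2 => ?_) (fun h1 h2 => by omega)
      fun h1 h2 => by omega
    obtain rfl | rfl : m = 4 ∨ m = 5 := by omega
    · norm_num
    · norm_num
  · rw [max_eq_left (by omega)]
    convert isPivotal_pivotA_half (h := h) (by omega) (m - 1) using 1
    rw [Nat.sub_add_cancel hm]
    push_cast [hm]
    ring

theorem weightA_shiftDown_one (d : ℕ) {σ : Finset ℕ} (h0 : 0 ∉ σ) (h1 : 1 ∉ σ) :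
    weightA d (shiftDown 1 σ) = weightA d σ := by
  rw [weightA_shiftDown_eq, Finset.filter_true_of_mem]
  intro x hx
  have : x ≠ 0 := fun h => h0 (h ▸ hx)
  have : x ≠ 1 := fun h => h1 (h ▸ hx)
  omega

/-- Type `D`, `d = 4`, `{2, 3} ⊆ σ`, `4 ∉ σ`. -/
theorem isPivotal_pivotD_four_notMem {m : ℕ} {K : Finset ℕ → Prop} {p : Finset ℕ → Option ℕ}
    (hK : ∀ σ, K σ ↔ FaceA m 0 1 σ ∧ 2 ∈ σ ∧ 3 ∈ σ ∧ 4 ∉ σ)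
    (hp : ∀ σ, K σ → p σ = (pivotA 4 (m - 4) 0 1 (shiftDown 4 σ)).map (· + 4)) :
    IsPivotal (weightD 4) ((m : ℤ) - (m / 2 : ℕ)) K p := by
  rcases (show m ≤ 2 ∨ m = 4 ∨ m = 3 ∨ 5 ≤ m by omega) with hm | rfl | rfl | hm
  · refine .of_isEmpty fun σ hσ => ?_
    rw [hK] at hσ
    have := hσ.1.1 3 hσ.2.2.1
    omega
  · refine .of_isEmpty fun σ hσ => ?_
    rw [hK] at hσ
    exact hσ.2.2.2 (hσ.1.2.2 4 (by omega) (by omega) le_rfl)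
  · refine .of_none (fun σ hσ => ?_) fun σ hσ => ?_
    · rw [hp σ hσ, pivotA, dif_pos (by omega), Option.map_none]
    · obtain ⟨h0, h2, h3, h4⟩ := (hK σ).1 hσ
      by_cases h1 : 1 ∈ σ
      · obtain rfl : σ = Finset.Icc 1 3 := by
          ext x
          rw [Finset.mem_Icc]
          refine ⟨h0.1 x, fun hx => ?_⟩
          obtain ⟨hx1, hx2⟩ := hx
          interval_cases x <;> assumption
        rw [weightD_Icc 4 (by omega)]
        decide
      · obtain rfl : σ = Finset.Icc 2 3 := by
          ext x
          rw [Finset.mem_Icc]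
          refine ⟨fun hx => ?_, fun hx => ?_⟩
          · have := h0.1 x hx
            have : x ≠ 1 := fun h => h1 (h ▸ hx)
            omega
          · obtain ⟨hx1, hx2⟩ := hx
            interval_cases x <;> assumption
        rw [weightD_of_one_notMem 4 h2 h1]
        decide
  · have hA := isPivotal_pivotA_half_sub_two (h := 2) le_rfl (m - 4)
    have hF : ∀ σ b : Finset ℕ, (∀ x ∈ b, 1 ≤ x ∧ x < 4) → (∀ x, x < 4 → (x ∈ σ ↔ x ∈ b)) → 4 ∉ σ →
        (FaceA m 0 1 σ ↔ FaceA (m - 4) (2 - 2) (2 - 1) (shiftDown 4 σ)) := by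
      intro σ b hb h1 h2
      constructor
      · intro h
        refine ⟨fun i hi => ?_, fun i hi hi' => by omega, fun i hi hi' hi'' => ?_⟩
        · rw [mem_shiftDown] at hi
          have := h.1 _ hi.2
          omega
        · exact mem_shiftDown.2 ⟨hi', h.2.2 _ (by omega) (by omega) (by omega)⟩
      · intro h
        refine ⟨fun i hi => ?_, fun i hi hi' => by omega, fun i hi hi' hi'' => ?_⟩
        · by_cases hi4 : i < 4
          · have := hb i ((h1 i hi4).1 hi)
            omega
          · have : i ≠ 4 := fun h => h2 (h ▸ hi)
            have := h.1 (i - 4) (mem_shiftDown.2 ⟨by omega, by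
              rwa [Nat.sub_add_cancel (by omega)]⟩)
            omega
        · have := (mem_shiftDown.1 (h.2.2 (i - 4) (by omega) (by omega) (by omega))).2
          rwa [Nat.sub_add_cancel (by omega)] at this
    have hdiv : (m - 4 + 2) / 2 + 1 = m / 2 := by omega
    -- The part before the gap is `{1, 2, 3}` of type `D_3`, with weight `1`, or `{2, 3}` of type
    -- `A_2`, with weight `0`; the cardinality minus the weight is `2` in both cases.
    refine .of_upper (fun σ => 1 ∈ σ) (fun τ σ _ _ h h' => h h') ?_ ?_
    · refine hA.of_shiftDown 4 {1, 2, 3} 1 (by simp) (fun ρ hρ => hρ.zero_notMem)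
        (by rw [show ({1, 2, 3} : Finset ℕ).card = 3 from rfl]; omega)
        (fun σ => ⟨?_, ?_⟩) (fun σ hσ => hp σ hσ.1) fun σ hσ => ?_
      · rintro ⟨h, h1⟩
        obtain ⟨h0, h2, h3, h4⟩ := (hK σ).1 h
        have hb : ∀ x, x < 4 → (x ∈ σ ↔ x ∈ ({1, 2, 3} : Finset ℕ)) := by
          intro x hx
          have := h0.zero_notMem
          interval_cases x <;> simp [*]
        exact ⟨hb, h4, (hF σ _ (by simp) hb h4).1 h0⟩
      · rintro ⟨hb, h4, h⟩
        exact ⟨(hK σ).2 ⟨(hF σ _ (by simp) hb h4).2 h, (hb 2 (by omega)).2 (by simp),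
          (hb 3 (by omega)).2 (by simp), h4⟩, (hb 1 (by omega)).2 (by simp)⟩
      · obtain ⟨h0, h2, h3, h4⟩ := (hK σ).1 hσ.1
        have h1 := hσ.2
        rw [weightD_eq 4 (e := 4) (by omega) h4 fun i hi hi' => by interval_cases i <;> assumption,
          weightA_shiftDown_eq, add_comm, show weightBlockD 4 (4 - 1) = 1 by decide]
    · refine hA.of_shiftDown 4 {2, 3} 0 (by simp) (fun ρ hρ => hρ.zero_notMem)
        (by rw [show ({2, 3} : Finset ℕ).card = 2 from rfl]; omega)
        (fun σ => ⟨?_, ?_⟩) (fun σ hσ => hp σ hσ.1) fun σ hσ => ?_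
      · rintro ⟨h, h1⟩
        obtain ⟨h0, h2, h3, h4⟩ := (hK σ).1 h
        have hb : ∀ x, x < 4 → (x ∈ σ ↔ x ∈ ({2, 3} : Finset ℕ)) := by
          intro x hx
          have := h0.zero_notMem
          interval_cases x <;> simp [*]
        exact ⟨hb, h4, (hF σ _ (by simp) hb h4).1 h0⟩
      · rintro ⟨hb, h4, h⟩
        exact ⟨(hK σ).2 ⟨(hF σ _ (by simp) hb h4).2 h, (hb 2 (by omega)).2 (by simp),
          (hb 3 (by omega)).2 (by simp), h4⟩, fun h1 => by simpa using (hb 1 (by omega)).1 h1⟩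
      · obtain ⟨h0, h2, h3, h4⟩ := (hK σ).1 hσ.1
        have h1 := hσ.2
        have h5 : σ.filter (· < 4) = {2, 3} := by
          ext x
          simp only [Finset.mem_filter, Finset.mem_insert, Finset.mem_singleton]
          constructor
          · rintro ⟨hx, hx4⟩
            have := h0.1 x hx
            have : x ≠ 1 := fun h => h1 (h ▸ hx)
            omega
          · rintro (rfl | rfl)
            · exact ⟨h2, by omega⟩
            · exact ⟨h3, by omega⟩
        rw [weightD_of_one_notMem 4 h2 h1, weightA_shiftDown 4 h4, h5, add_comm]
        rfl

/-- Type `D`, `d ≥ 4`, `{2, 3, 4} ⊆ σ`. -/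
theorem isPivotal_pivotD_four_mem {h m : ℕ} (hh : 2 ≤ h) (hm : h ≤ m) {K : Finset ℕ → Prop}
    {p : Finset ℕ → Option ℕ} (hK : ∀ σ, K σ ↔ FaceA m 0 (h - 1) σ ∧ 2 ∈ σ ∧ 3 ∈ σ ∧ 4 ∈ σ)
    (hp : ∀ σ, K σ → p σ =
      if 1 ∉ σ then
        if Finset.Icc 2 (h + 1) ⊆ σ then
          (pivotA (2 * h) (m - 1) (max h 3) (h - 1) (shiftDown 1 σ)).map (· + 1)
        else some 1
      else pivotDInitial h m (h - 1) σ) :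
    IsPivotal (weightD (2 * h)) ((m : ℤ) - (m / h : ℕ)) K p := by
  have hmax : ∀ σ : Finset ℕ, (∀ i, 2 ≤ i → i ≤ max (h + 1) 4 → i ∈ σ) ↔
      Finset.Icc 2 (h + 1) ⊆ σ ∧ 2 ∈ σ ∧ 3 ∈ σ ∧ 4 ∈ σ := by
    intro σ
    constructor
    · intro h1
      have h2 := le_max_right (h + 1) 4
      refine ⟨fun i hi => ?_, h1 2 (by omega) (by omega), h1 3 (by omega) (by omega),
        h1 4 (by omega) (by omega)⟩
      rw [Finset.mem_Icc] at hi
      exact h1 i hi.1 (hi.2.trans (le_max_left _ _))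
    · rintro ⟨h1, h2, h3, h4⟩ i hi hi'
      rcases le_max_iff.1 hi' with h5 | h5
      · exact h1 (Finset.mem_Icc.2 ⟨hi, h5⟩)
      · interval_cases i <;> assumption
  refine .of_upper (fun σ => Finset.Icc 2 (h + 1) ⊆ σ) (fun τ σ _ _ h h' => h'.trans h) ?_ ?_
  · refine .of_upper (fun σ => 1 ∈ σ) (fun τ σ _ _ h h' => h h') ?_ ?_
    · have key : ∀ σ, FaceA m (max (h + 1) 4) (h - 1) σ ↔
          (K σ ∧ Finset.Icc 2 (h + 1) ⊆ σ) ∧ 1 ∈ σ := by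
        intro σ
        rw [hK]
        constructor
        · intro hσ
          obtain ⟨h1, h2⟩ := (hmax σ).1 fun i hi hi' => hσ.2.1 i (by omega) hi'
          have h3 := le_max_right (h + 1) 4
          exact ⟨⟨⟨⟨hσ.1, fun i hi hi' => by omega, hσ.2.2⟩, h2⟩, h1⟩, hσ.2.1 1 le_rfl (by omega)⟩
        · rintro ⟨⟨⟨h1, h2⟩, h3⟩, h4⟩
          refine ⟨h1.1, fun i hi hi' => ?_, h1.2.2⟩
          rcases Nat.eq_or_lt_of_le hi with rfl | hi
          · exact h4
          · exact (hmax σ).2 ⟨h3, h2⟩ i hi hi'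
      refine (isPivotal_pivotDInitial (by omega)).congr key fun σ hσ => ?_
      have h1 := (key σ).1 hσ
      rw [hp σ h1.1.1, if_neg (not_not.2 h1.2)]
    · have hmax' : ∀ σ : Finset ℕ, (∀ i, 1 ≤ i → i ≤ max h 3 → i ∈ shiftDown 1 σ) ↔
          Finset.Icc 2 (h + 1) ⊆ σ ∧ 2 ∈ σ ∧ 3 ∈ σ ∧ 4 ∈ σ := by
        intro σ
        rw [← hmax]
        have h2 : max (h + 1) 4 = max h 3 + 1 := (Nat.add_max_add_right h 3 1)
        constructor
        · intro h1 i hi hi'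
          have := (mem_shiftDown.1 (h1 (i - 1) (by omega) (by omega))).2
          rwa [Nat.sub_add_cancel (by omega)] at this
        · intro h1 i hi hi'
          exact mem_shiftDown.2 ⟨hi, h1 _ (by omega) (by omega)⟩
      refine (isPivotal_pivotA_max (m := m) hh (by omega)).of_shiftDown 1 ∅ 0 (by simp)
        (fun ρ hρ => hρ.zero_notMem) (by simp) (fun σ => ⟨?_, ?_⟩) (fun σ hσ => ?_) fun σ hσ => ?_
      · rintro ⟨⟨h1, h2⟩, h3⟩
        obtain ⟨h4, h5⟩ := (hK σ).1 h1
        refine ⟨fun x hx => ?_, h3, fun i hi => ?_, (hmax' σ).2 ⟨h2, h5⟩,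
          fun i hi hi' hi'' => ?_⟩
        · obtain rfl : x = 0 := by omega
          simp [h4.zero_notMem]
        · rw [mem_shiftDown] at hi
          have := h4.1 _ hi.2
          omega
        · exact mem_shiftDown.2 ⟨hi', h4.2.2 _ (by omega) (by omega) (by omega)⟩
      · rintro ⟨h1, h2, h3⟩
        obtain ⟨h4, h5⟩ := (hmax' σ).1 h3.2.1
        have h0 : 0 ∉ σ := fun h => by simpa using (h1 0 (by omega)).1 h
        refine ⟨⟨(hK σ).2 ⟨⟨fun i hi => ?_, fun i hi hi' => by omega, fun i hi hi' hi'' => ?_⟩, h5⟩,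
          h4⟩, h2⟩
        · have h6 : i ≠ 0 := fun h => h0 (h ▸ hi)
          have h7 : i ≠ 1 := fun h => h2 (h ▸ hi)
          have := h3.1 (i - 1) (mem_shiftDown.2 ⟨by omega, by
            rwa [Nat.sub_add_cancel (by omega)]⟩)
          omega
        · have := (mem_shiftDown.1 (h3.2.2 (i - 1) (by omega) (by omega) (by omega))).2
          rwa [Nat.sub_add_cancel (by omega)] at this
      · rw [hp σ hσ.1.1, if_pos hσ.2, if_pos hσ.1.2]
      · obtain ⟨h4, h5⟩ := (hK σ).1 hσ.1.1
        rw [weightD_of_one_notMem _ h5.1 hσ.2, weightA_shiftDown_one _ h4.zero_notMem hσ.2, add_zero]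
  · have hpre : ∀ σ : Finset ℕ, (2 ∈ σ ∧ 3 ∈ σ ∧ 4 ∈ σ) ∧ ¬ Finset.Icc 2 (h + 1) ⊆ σ →
        ∃ e, 5 ≤ e ∧ e ≤ h + 1 ∧ e ∉ σ ∧ ∀ i, 1 < i → i < e → i ∈ σ := by
      rintro σ ⟨⟨h2, h3, h4⟩, h5⟩
      obtain ⟨e, he, heσ, hI⟩ := exists_prefix σ 1
      refine ⟨e, ?_, ?_, heσ, hI⟩
      · have : e ≠ 2 := fun h => heσ (h ▸ h2)
        have : e ≠ 3 := fun h => heσ (h ▸ h3)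
        have : e ≠ 4 := fun h => heσ (h ▸ h4)
        omega
      · by_contra h6
        refine h5 fun i hi => ?_
        rw [Finset.mem_Icc] at hi
        exact hI i (by omega) (by omega)
    -- Here `{2, …, h + 1}` is incomplete. If `1 ∈ σ`, its component has at most `h` vertices, so `q
    -- = 0` and the last rule also toggles `qh + 1 = 1`.
    refine isPivotal_one (m := m) (g := h - 1) (by omega)
      (fun σ => (2 ∈ σ ∧ 3 ∈ σ ∧ 4 ∈ σ) ∧ ¬ Finset.Icc 2 (h + 1) ⊆ σ)
      (fun σ => by rw [hK, and_assoc]) (fun σ => ?_) (fun σ hσ => ?_) fun σ hσ => ?_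
    · rw [Finset.subset_insert_iff_of_notMem (by simp)]
      simp
    · rw [hp σ hσ.1]
      by_cases h1 : 1 ∈ σ
      swap
      · rw [if_pos h1, if_neg hσ.2]
      obtain ⟨e, he5, heh, he, hI⟩ := hpre σ ⟨((hK σ).1 hσ.1).2, hσ.2⟩
      have hk := componentSize_graphD (by omega) he fun i hi hi' => by
        rcases Nat.eq_or_lt_of_le hi with rfl | hi
        · exact h1
        · exact hI i hi hi'
      have hq := (evenQuotient_eq_iff_of_even (h := h) (k := e - 1) (q := 0) (by omega) (by simp)).2
        (by omega)
      rw [if_neg (not_not.2 h1), pivotDInitial, hk, hq]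
      simp [h1]
      omega
    · obtain ⟨e, he5, heh, he, hI⟩ := hpre σ hσ
      exact ⟨e, by omega, heh, he, hI⟩

/-- Type `D`, `d ≥ 4`, `2 ∈ σ`. -/
theorem isPivotal_pivotD_two_mem {h m : ℕ} (hh : 2 ≤ h) (hm : h ≤ m) {K : Finset ℕ → Prop}
    {p : Finset ℕ → Option ℕ} (hK : ∀ σ, K σ ↔ FaceA m 0 (h - 1) σ ∧ 2 ∈ σ)
    (hp : ∀ σ, K σ → p σ =
      if 3 ∉ σ then some 1
      else if 2 * h = 4 ∧ 4 ∉ σ then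
        (pivotA (2 * h) (m - 4) 0 (h - 1) (shiftDown 4 σ)).map (· + 4)
      else if 4 ∉ σ then some 1
      else if 1 ∉ σ then
        if Finset.Icc 2 (h + 1) ⊆ σ then
          (pivotA (2 * h) (m - 1) (max h 3) (h - 1) (shiftDown 1 σ)).map (· + 1)
        else some 1
      else pivotDInitial h m (h - 1) σ) :
    IsPivotal (weightD (2 * h)) ((m : ℤ) - (m / h : ℕ)) K p := by
  refine .of_upper (fun σ => 3 ∈ σ) (fun τ σ _ _ h h' => h h') ?_ ?_
  swap
  · refine isPivotal_one (m := m) (g := h - 1) (by omega) (fun σ => 2 ∈ σ ∧ 3 ∉ σ)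
      (fun σ => by rw [hK, and_assoc]) (fun σ => by simp) (fun σ hσ => by rw [hp σ hσ.1, if_pos hσ.2])
      fun σ hσ => ⟨3, le_rfl, by omega, hσ.2, fun i hi hi' => ?_⟩
    obtain rfl : i = 2 := by omega
    exact hσ.1
  refine .of_upper (fun σ => 4 ∈ σ) (fun τ σ _ _ h h' => h h') ?_ ?_
  swap
  · rcases Nat.eq_or_lt_of_le hh with rfl | h3
    · refine isPivotal_pivotD_four_notMem (fun σ => ?_) fun σ hσ => ?_
      · rw [hK]
        tauto
      · rw [hp σ hσ.1.1, if_neg (not_not.2 hσ.1.2), if_pos ⟨rfl, hσ.2⟩]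
    · refine isPivotal_one (m := m) (g := h - 1) (by omega) (fun σ => 2 ∈ σ ∧ 3 ∈ σ ∧ 4 ∉ σ)
        (fun σ => by rw [hK]; tauto) (fun σ => by simp)
        (fun σ hσ => by
          rw [hp σ hσ.1.1, if_neg (not_not.2 hσ.1.2), if_neg (by omega), if_pos hσ.2])
        fun σ hσ => ⟨4, by omega, by omega, hσ.2.2, fun i hi hi' => ?_⟩
      obtain rfl | rfl : i = 2 ∨ i = 3 := by omega
      · exact hσ.1
      · exact hσ.2.1
  refine isPivotal_pivotD_four_mem hh hm (fun σ => by rw [hK]; tauto) fun σ hσ => ?_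
  rw [hp σ hσ.1.1, if_neg (not_not.2 hσ.1.2), if_neg fun h => h.2 hσ.2, if_neg (not_not.2 hσ.2)]

/-- Type `D`: the set `K^D_{m,g}` with `g = d / 2 - 1`. -/
theorem isPivotal_pivotD {h : ℕ} (hh : 1 ≤ h) (m : ℕ) :
    IsPivotal (weightD (2 * h)) ((m : ℤ) - (m / h : ℕ)) (FaceA m 0 (h - 1))
      (pivotD (2 * h) m (h - 1)) := by
  rcases Nat.lt_or_ge m h with hm | hm
  · refine .of_none (fun σ _ => ?_) fun σ hσ => ?_
    · rw [pivotD]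
      simp only [if_pos (show m ≤ h - 1 by omega)]
    · rw [eq_Icc_of_faceA (by omega) hσ, Nat.card_Icc, Nat.div_eq_of_lt hm, Nat.add_sub_cancel]
      rcases (show m = 0 ∨ m = 1 ∨ 2 ≤ m by omega) with rfl | rfl | hm2
      · rw [weightD_of_two_notMem _ (by simp)]
        simp [weightA_empty]
      · rw [weightD_of_two_notMem _ (by simp), show (Finset.Icc 1 1).image relabelD = Finset.Icc 1 1
          from rfl, weightA_Icc (by omega), Nat.div_eq_of_lt (by omega)]
      · rw [weightD_Icc _ hm2, weightBlockD_eq_zero (by omega) (by omega)]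
  refine .of_upper (fun σ => 2 ∈ σ) (fun τ σ _ _ h h' => h h') ?_ ?_
  · rcases Nat.eq_or_lt_of_le hh with rfl | hh2
    · have h1 := isPivotal_pivotD_two_mem_of_eq (m := m) (p := pivotD (2 * 1) m (1 - 1))
        (fun σ => Iff.rfl) fun σ hσ => ?_
      · convert h1 using 1
        rw [Nat.div_one, sub_self]
      · rw [pivotD_eq le_rfl hm, if_neg (not_not.2 hσ.2)]
        by_cases h4 : {1, 2, 3, 4} ⊆ σ
        · simp [h4]
        · simp [h4]
    · refine isPivotal_pivotD_two_mem hh2 hm (fun σ => Iff.rfl) fun σ hσ => ?_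
      rw [pivotD_eq hh hm, if_neg (not_not.2 hσ.2), if_neg (by omega)]
      simp only [show 4 ≤ 2 * h by omega, true_and]
      by_cases h3 : 3 ∈ σ
      swap
      · rw [if_pos h3, if_pos h3]
      rw [if_neg (not_not.2 h3), if_neg (not_not.2 h3)]
      by_cases h4 : 4 ∈ σ
      · simp [h4]
      · rcases Nat.eq_or_lt_of_le hh2 with rfl | hh3
        · simp [h4]
        · have e1 : ¬ 2 * h = 4 := by omega
          have e2 : 6 ≤ 2 * h := by omega
          simp only [e1, e2, h4, false_and, not_false_eq_true, and_self, if_true, if_false]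
  · have hp : ∀ σ, FaceA m 0 (h - 1) σ ∧ 2 ∉ σ → pivotD (2 * h) m (h - 1) σ =
        (pivotA (2 * h) (m - 1) 0 (h - 1) (σ.image relabelD)).map
          fun p => if p = 1 then 1 else p + 1 := fun σ hσ => by
      rw [pivotD_eq hh hm, if_pos hσ.2]
    -- If `m = h ≥ 2`, the vertex `2` is among the last `h - 1` vertices and cannot be missing; for
    -- `m = h = 1` only `∅` and `{1}` occur.
    rcases (show h + 1 ≤ m ∨ (m = h ∧ 2 ≤ m) ∨ (m = 1 ∧ h = 1) by omega) with h1 | h1 | ⟨rfl, rfl⟩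
    · refine isPivotal_relabelD (by omega) ?_ (fun σ => Iff.rfl) hp
      convert isPivotal_pivotA_zero hh (show h ≤ m - 1 + 1 by omega) using 1
      rw [Nat.sub_add_cancel (by omega)]
      push_cast [show 1 ≤ m by omega]
      ring
    · exact .of_isEmpty fun σ hσ => hσ.2 (hσ.1.2.2 2 (by omega) (by omega) (by omega))
    · refine .of_none (fun σ hσ => ?_) fun σ hσ => ?_
      · rw [hp σ hσ, pivotA, dif_pos (by omega), Option.map_none]
      · have h1 : σ ⊆ {1} := fun x hx => by
          have := hσ.1.1 x hx
          rw [Finset.mem_singleton]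
          omega
        rw [weightD_of_two_notMem _ hσ.2]
        rcases Finset.subset_singleton_iff.1 h1 with rfl | rfl <;> decide

/-! ### Matchings in type `B̃`. -/

/-- A missing vertex `a` separates the vertices below it from those above it, except that for `a =
2` the vertices `1` and `3` are still joined. -/
theorem weightD_gap {d : ℕ} {ρ : Finset ℕ} {a : ℕ} (h0 : 0 ∉ ρ) (ha1 : 1 ≤ a)
    (ha : a ∉ ρ) (h2 : a = 2 → 1 ∉ ρ) :
    weightD d ρ = weightD d (ρ.filter (· < a)) + weightA d (ρ.filter (a < ·)) := by
  by_cases h1 : 1 ∈ ρ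
  swap
  · have h1' : 1 ∉ ρ.filter (· < a) := by simp [h1]
    have key : ∀ τ : Finset ℕ, 0 ∉ τ → 1 ∉ τ → weightD d τ = weightA d τ := by
      intro τ hτ0 hτ1
      by_cases hτ2 : 2 ∈ τ
      · exact weightD_of_one_notMem d hτ2 hτ1
      · rw [weightD_of_two_notMem d hτ2, ← weightA_shiftDown_one d hτ0 hτ1]
        congr 1
        ext x
        rw [mem_shiftDown, Finset.mem_image]
        constructor
        · rintro ⟨y, hy, rfl⟩
          have : y ≠ 1 := fun h => hτ1 (h ▸ hy)
          have : y ≠ 0 := fun h => hτ0 (h ▸ hy)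
          rw [relabelD, if_neg (by omega), Nat.sub_add_cancel (by omega)]
          exact ⟨by omega, hy⟩
        · rintro ⟨hx, hx'⟩
          exact ⟨x + 1, hx', by rw [relabelD, if_neg (by omega), Nat.add_sub_cancel]⟩
    rw [key ρ h0 h1, key _ (by simp [h0]) h1', weightA_gap d ha]
  have ha3 : 3 ≤ a := by
    have : a ≠ 1 := fun h => ha (h ▸ h1)
    have : a ≠ 2 := fun h => h2 h h1
    omega
  by_cases hρ2 : 2 ∈ ρ
  · obtain ⟨e, he, heρ, hI⟩ := exists_prefix ρ 2
    have hI' : ∀ i, 0 < i → i < e → i ∈ ρ := fun i hi hi' => by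
      rcases (show i = 1 ∨ i = 2 ∨ 2 < i by omega) with rfl | rfl | h
      · exact h1
      · exact hρ2
      · exact hI i h hi'
    have hea : e ≤ a := by
      by_contra h
      exact ha (hI' a ha1 (by omega))
    rw [weightD_eq d (by omega) heρ hI', weightD_eq d (e := e) (by omega) (by simp [heρ])
      (fun i hi hi' => Finset.mem_filter.2 ⟨hI' i hi hi', by omega⟩), add_assoc,
      weightA_gap d (a := a) (by simp [ha])]
    congr 3
    · rw [Finset.filter_filter, Finset.filter_filter]
      simp only [and_comm]
    · rw [Finset.filter_filter]
      ext x
      simp only [Finset.mem_filter]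
      grind
  · rw [weightD_of_two_notMem d hρ2, weightD_of_two_notMem d (by simp [hρ2]),
      weightA_gap d (a := a - 1)]
    · have hne : ∀ x ∈ ρ, x ≠ 0 ∧ x ≠ 2 ∧ x ≠ a := fun x hx =>
        ⟨fun h => h0 (h ▸ hx), fun h => hρ2 (h ▸ hx), fun h => ha (h ▸ hx)⟩
      congr 1
      · congr 1
        ext x
        simp only [Finset.mem_filter, Finset.mem_image]
        constructor
        · rintro ⟨⟨y, hy, rfl⟩, hlt⟩
          refine ⟨y, ⟨hy, ?_⟩, rfl⟩
          have := hne y hy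
          rw [relabelD] at hlt
          split_ifs at hlt <;> omega
        · rintro ⟨y, ⟨hy, hlt⟩, rfl⟩
          refine ⟨⟨y, hy, rfl⟩, ?_⟩
          have := hne y hy
          rw [relabelD]
          split_ifs <;> omega
      · rw [← weightA_map d 1 (by simp)]
        congr 1
        ext x
        simp only [Finset.mem_filter, Finset.mem_image, mem_map_addEmb_one]
        constructor
        · rintro ⟨hx, ⟨y, hy, hyx⟩, hlt⟩
          rw [relabelD] at hyx
          split_ifs at hyx with hy1
          · omega
          · obtain rfl : y = x := by omega
            exact ⟨hy, by omega⟩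
        · rintro ⟨hx, hlt⟩
          exact ⟨by omega, ⟨x, hx, by rw [relabelD, if_neg (by omega)]⟩, by omega⟩
    · rw [Finset.mem_image]
      rintro ⟨y, hy, hya⟩
      rw [relabelD] at hya
      split_ifs at hya with hy1
      · omega
      · obtain rfl : y = a := by omega
        exact ha hy

/-- The set `{0, 2, 3, …, n}`. -/
abbrev typeB (n : ℕ) : Finset ℕ := (Finset.range (n + 1)).erase 1

theorem mem_typeB {n i : ℕ} : i ∈ typeB n ↔ i ≤ n ∧ i ≠ 1 := by
  rw [Finset.mem_erase, Finset.mem_range]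
  omega

theorem eq_typeB_of_subset {n : ℕ} {σ : Finset ℕ} (hσ : σ ⊂ Finset.range (n + 1))
    (h : typeB n ⊆ σ) : σ = typeB n := by
  refine Finset.Subset.antisymm (fun i hi => Finset.mem_erase.2 ⟨?_, hσ.1 hi⟩) h
  rintro rfl
  refine hσ.2 fun j hj => ?_
  by_cases hj1 : j = 1
  · exact hj1 ▸ hi
  · exact h (Finset.mem_erase.2 ⟨hj1, hj⟩)

theorem card_typeB {n : ℕ} (hn : 1 ≤ n) : (typeB n).card = n := by
  rw [Finset.card_erase_of_mem (by simp; omega), Finset.card_range, Nat.add_sub_cancel]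

theorem weightB_typeB (d n : ℕ) : weightB d n (typeB n) = weightBlockB d n := by
  rw [weightB, if_pos subset_rfl]

theorem weightB_typeB_erase {d n m : ℕ} (hd : 2 ≤ d) (hm : 2 ≤ m) (hmn : m ≤ n) :
    weightB d n ((typeB n).erase m) = weightBlockB d (n - m) + m / d := by
  rw [weightB_of_suffix d (k := n - m)]
  · rw [weightD_map_zero_Ioo hd (b := m - 1) (by omega) fun j => ?_,
      Nat.sub_add_cancel (by omega)]
    rw [Finset.mem_filter, Finset.mem_erase, mem_typeB]
    omega
  · exact fun h => Finset.notMem_erase m _ (h (mem_typeB.2 ⟨hmn, by omega⟩))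
  · intro i hi hi'
    rw [Finset.mem_erase, mem_typeB]
    omega
  · rw [Finset.mem_erase]
    omega
  · omega

/-- Adding a vertex `m` to a simplex that contains all the vertices `> m`: the run of consecutive
vertices below `m` joins the component of `n`. -/
theorem weightB_insert {d n m : ℕ} (hd : 2 ≤ d) (hmn : m ≤ n) {σ : Finset ℕ}
    (hσ : insert m σ ⊂ Finset.range (n + 1)) (hm : m ∉ σ) (h : ∀ i, m < i → i ≤ n → i ∈ σ)
    (hB : insert m σ ≠ typeB n) :
    ∃ a, 1 ≤ a ∧ a ≤ m ∧ a - 1 ∉ σ ∧ (∀ i, a ≤ i → i < m → i ∈ σ) ∧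
      weightB d n (insert m σ) + (m + 1 - a) / d + weightBlockB d (n - m) =
        weightB d n σ + weightBlockB d (n + 1 - a) := by
  obtain ⟨a, ham, hI, ha⟩ := exists_run_start (Finset.mem_insert_self m σ)
  have hI' : ∀ i, a ≤ i → i ≤ n → i ∈ insert m σ := fun i hi hi' => by
    rcases Nat.lt_or_ge m i with h1 | h1
    · exact Finset.mem_insert_of_mem (h i h1 hi')
    · exact hI i hi h1
  have ha1 : 1 ≤ a := by
    by_contra ha1
    exact hσ.2 fun i hi => hI' i (by omega) (by rw [Finset.mem_range] at hi; omega)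
  have ha' : a - 1 ∉ σ := fun h => ha ha1 (Finset.mem_insert_of_mem h)
  have hB1 : ¬ typeB n ⊆ insert m σ := fun h1 => hB (eq_typeB_of_subset hσ h1)
  refine ⟨a, ha1, ham, ha', fun i hi hi' =>
    (Finset.mem_insert.1 (hI i hi hi'.le)).resolve_left (by omega), ?_⟩
  rw [weightB_of_suffix d (k := n + 1 - a) hB1 (fun i hi hi' => hI' i (by omega) hi')
    (by rw [show n - (n + 1 - a) = a - 1 by omega]; exact ha ha1) (by omega),
    weightB_of_suffix d (k := n - m) (fun h => hB1 (h.trans (Finset.subset_insert m σ)))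
    (fun i hi hi' => h i (by omega) hi') (by rwa [show n - (n - m) = m by omega]) (by omega),
    show n - (n + 1 - a) = a - 1 by omega, show n - (n - m) = m by omega]
  have h3 := weightD_gap (d := d) (ρ := (σ.filter (· < m)).map (addEmb 1)) (a := a) (by simp) ha1
    (by rw [mem_map_addEmb_one, Finset.mem_filter]; exact fun h => ha' h.2.1) (fun h2 h1 => by
      rw [mem_map_addEmb_one, Finset.mem_filter] at h1
      refine hB1 fun i hi => ?_
      rw [mem_typeB] at hi
      rcases Nat.eq_zero_or_pos i with rfl | hi0
      · exact Finset.mem_insert_of_mem h1.2.1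
      · exact hI' i (by omega) hi.1)
  have h4 : ((σ.filter (· < m)).map (addEmb 1)).filter (a < ·) = Finset.Ioo a (m + 1) := by
    ext x
    rw [Finset.mem_filter, mem_map_addEmb_one, Finset.mem_filter, Finset.mem_Ioo]
    constructor
    · omega
    · intro hx
      refine ⟨⟨by omega, ?_, by omega⟩, hx.1⟩
      exact (Finset.mem_insert.1 (hI (x - 1) (by omega) (by omega))).resolve_left (by omega)
  have h5 : ((σ.filter (· < m)).map (addEmb 1)).filter (· < a) =
      ((insert m σ).filter (· < a - 1)).map (addEmb 1) := by
    ext x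
    simp only [Finset.mem_filter, mem_map_addEmb_one, Finset.mem_insert]
    constructor
    · rintro ⟨⟨h6, h7, h8⟩, h9⟩
      have : x - 1 ≠ a - 1 := fun h => ha' (h ▸ h7)
      exact ⟨h6, .inr h7, by omega⟩
    · rintro ⟨h6, h7 | h7, h8⟩
      · omega
      · exact ⟨⟨h6, h7, by omega⟩, by omega⟩
  rw [h4, h5, weightA_Ioo hd (by omega)] at h3
  rw [h3]
  ring

/-- For `d` odd, `B_k` and `A_(k-1)` both have weight `⌊k/d⌋`, so adding `n` to a block of type `A`
ending at `n - 1` preserves the weight. Only `{0, …, n-1}` has no partner, as the full set is not in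
the complex; it is of type `D_n` and weight `⌊n/d⌋`. -/
theorem isPivotal_pivotAffineBOdd {d n : ℕ} (hd : 2 ≤ d) (hn : 3 ≤ n) (hodd : Odd d) :
    IsPivotal (weightB d n) ((n : ℤ) - (n / d : ℕ)) (· ⊂ Finset.range (n + 1))
      (pivotAffineBOdd n) := by
  have hins : insert n (Finset.range n) = Finset.range (n + 1) := by
    rw [Finset.range_add_one]
  refine .of_const n (fun σ => σ ≠ Finset.range n) (fun σ _ hσ => by rw [pivotAffineBOdd, if_neg hσ])
    (fun σ _ hσ => by rw [pivotAffineBOdd, if_pos (not_not.1 hσ)]) (fun σ hσ => ?_)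
    (fun σ hnσ hσ hN => ?_) fun σ _ hσ => ?_
  · have h1 : insert n σ ≠ Finset.range n := fun h => by
      have := h ▸ Finset.mem_insert_self n σ
      simp at this
    have h2 : insert n σ = Finset.range (n + 1) ↔ σ = Finset.range n := by
      rw [← hins]
      refine ⟨fun h => ?_, fun h => h ▸ rfl⟩
      rw [← Finset.erase_insert hσ, h, Finset.erase_insert (by simp)]
    have h3 : σ ⊂ Finset.range (n + 1) ↔ insert n σ ⊆ Finset.range (n + 1) := by
      refine ⟨fun h => Finset.insert_subset (by simp) h.1, fun h =>
        ⟨(Finset.subset_insert _ _).trans h, fun h' => hσ (h' (by simp))⟩⟩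
    rw [h3, Finset.ssubset_iff_subset_ne]
    simp only [Ne, h1, h2, not_false_eq_true, and_true]
  · have hins' : insert n σ ⊂ Finset.range (n + 1) := by
      refine Finset.ssubset_iff_subset_ne.2 ⟨Finset.insert_subset (by simp) hσ.1, fun h => hN ?_⟩
      rw [← Finset.erase_insert hnσ, h, Finset.range_add_one, Finset.erase_insert (by simp)]
    by_cases hB : insert n σ = typeB n
    · have h1 : σ = (typeB n).erase n := by rw [← hB, Finset.erase_insert hnσ]
      rw [hB, h1, weightB_typeB, weightB_typeB_erase hd (by omega) le_rfl, Nat.sub_self,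
        show weightBlockB d 0 = 0 from rfl, weightBlockB_odd hodd, zero_add]
    · obtain ⟨a, ha, ham, -, -, h1⟩ := weightB_insert hd le_rfl hins' hnσ (fun i hi hi' => by omega) hB
      rw [Nat.sub_self, show weightBlockB d 0 = 0 from rfl, weightBlockB_odd hodd] at h1
      omega
  · rw [not_not.1 hσ, Finset.card_range]
    have h1 := weightB_of_suffix d (n := n) (σ := Finset.range n) (k := 0)
      (fun h => by simpa using h (mem_typeB.2 ⟨le_rfl, by omega⟩)) (fun i hi hi' => by omega)
      (by simp) (by omega)
    rw [Nat.sub_zero, Finset.filter_true_of_mem (fun x hx => Finset.mem_range.1 hx),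
      weightD_map_range d (by omega), weightBlockD,
      show weightBlockB d 0 = 0 from rfl, weightBlockB_odd hodd, zero_add] at h1
    have h2 := Nat.succ_div (a := n - 1) (b := d)
    rw [Nat.sub_add_cancel (by omega)] at h2
    rw [h1, h2]

/-- Only in `{0, 2, …, n}` does the component of `n` pass through `2` to `0` without containing `1`;
in the other proper subsets it is a final interval. -/
theorem exists_componentSize {n : ℕ} (hn : 3 ≤ n) {σ : Finset ℕ} (hσ : σ ⊂ Finset.range (n + 1))
    (hB : σ ≠ typeB n) : ∃ k ≤ n, componentSize graphAffineB σ n = k ∧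
      (∀ i, n - k < i → i ≤ n → i ∈ σ) ∧ n - k ∉ σ := by
  by_cases hnσ : n ∈ σ
  swap
  · exact ⟨0, by omega, componentSize_eq_zero hnσ, fun i hi hi' => by omega, hnσ⟩
  obtain ⟨a, han, hI, ha⟩ := exists_run_start hnσ
  have ha1 : 1 ≤ a := by
    by_contra ha1
    exact hσ.2 fun i hi => hI i (by omega) (by rw [Finset.mem_range] at hi; omega)
  refine ⟨n + 1 - a, by omega, ?_, fun i hi hi' => hI i (by omega) hi', ?_⟩
  · refine componentSize_graphAffineB hn (by omega) (by omega) (fun i hi => ?_)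
      (fun i hi hi' => hI i (by omega) hi') ?_ fun h h0 => ?_
    · have := hσ.1 hi
      rw [Finset.mem_range] at this
      omega
    · rw [show n - (n + 1 - a) = a - 1 by omega]
      exact ha ha1
    · refine hB (eq_typeB_of_subset hσ fun i hi => ?_)
      rw [mem_typeB] at hi
      rcases Nat.eq_zero_or_pos i with rfl | hi0
      · exact h0
      · exact hI i (by omega) hi.1
  · rw [show n - (n + 1 - a) = a - 1 by omega]
    exact ha ha1

section Fiber

variable {n h q m : ℕ} {σ : Finset ℕ}

/-- With `k` the component size, `qh ≤ k < qh + h` means that all vertices above `m` are present but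
not the `h` vertices ending at `m` as well. The condition `h ≤ m` excludes an interval beginning at
`0` or below. -/
theorem componentSize_div_eq_iff (hn : 3 ≤ n) (hh : 1 ≤ h) (hm : q * h + m = n)
    (hσ : σ ⊂ Finset.range (n + 1)) (hB : σ ≠ typeB n) :
    componentSize graphAffineB σ n / h = q ↔ (∀ i, m < i → i ≤ n → i ∈ σ) ∧
      ¬ (h ≤ m ∧ Finset.Icc (m + 1 - h) m ⊆ σ) := by
  obtain ⟨k, hk, hc, hI, hk'⟩ := exists_componentSize hn hσ hB
  rw [hc]
  constructor
  · rintro h1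
    rw [Nat.div_eq_iff (by omega)] at h1
    refine ⟨fun i hi hi' => hI i (by omega) hi', fun h2 => hk' ?_⟩
    rcases Nat.lt_or_ge m (n - k) with h3 | h3
    · omega
    · exact h2.2 (Finset.mem_Icc.2 (by omega))
  · rintro ⟨h1, h2⟩
    refine div_eq_of_le_of_lt q ?_ ?_
    · by_contra h3
      exact hk' (h1 _ (by omega) (by omega))
    · by_contra h3
      exact h2 ⟨by omega, fun i hi => by
        rw [Finset.mem_Icc] at hi
        exact hI i (by omega) (by omega)⟩

/-- As the component of `n` is a final interval, its remainder modulo `h` is positive exactly when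
`m ∈ σ`; the rules can then be read off from membership alone. -/
theorem pivotAffineBEven_eq (hn : 3 ≤ n) (hm : q * h + m = n)
    (hσ : σ ⊂ Finset.range (n + 1)) (hB : σ ≠ typeB n)
    (hq : componentSize graphAffineB σ n / h = q) :
    pivotAffineBEven (2 * h) n σ = if m ∈ σ then some m
      else if h ≤ m + 1 ∧ Finset.Ico (m + 1 - h) m ⊆ σ then
        (pivotD (2 * h) m (h - 1) ((σ.filter (· < m)).image (· + 1))).map (· - 1)
      else if σ.card = n then none
      else if m = h ∧ σ = (typeB n).erase m then none else some m := by
  obtain ⟨k, hk, hc, hI, hk'⟩ := exists_componentSize hn hσ hB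
  rw [hc] at hq
  have h1 := Nat.div_add_mod k h
  rw [hq, mul_comm] at h1
  rw [pivotAffineBEven]
  simp only [show 2 * h / 2 = h by omega, hc, hq, show n - q * h = m by omega, hB, false_and,
    if_false]
  by_cases h2 : 1 ≤ k % h
  · rw [if_pos h2, if_pos (hI m (by omega) (by omega))]
  · have h3 : m ∉ σ := by rwa [show n - k = m by omega] at hk'
    have h4 : n = (q + 1) * h ↔ m = h := by rw [add_one_mul]; omega
    rw [if_neg h2, if_neg h3]
    simp only [h4]

theorem pivotAffineBEven_typeB (hn : 3 ≤ n) (hm : q * h + m = n)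
    (hq : n / h = q) :
    pivotAffineBEven (2 * h) n (typeB n) = if m ≤ 1 then none else some m := by
  have h1 := Nat.div_add_mod n h
  rw [hq, mul_comm] at h1
  rw [pivotAffineBEven]
  simp only [show 2 * h / 2 = h by omega, componentSize_graphAffineB_erase hn, hq,
    show n - q * h = m by omega, show n % h = m by omega, true_and, card_typeB (show 1 ≤ n by omega)]
  rcases (show m = 0 ∨ m = 1 ∨ 2 ≤ m by omega) with rfl | rfl | h2
  · rw [if_neg (show ¬ 1 ≤ 0 by omega), if_pos (show 0 ≤ 1 by omega)]
    have h3 : ∀ τ, pivotD (2 * h) 0 (h - 1) τ = none := fun τ => by rw [pivotD]; simp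
    rw [h3]
    simp
  · simp
  · rw [if_pos (by omega), if_neg (by omega), if_neg (by omega)]

end Fiber

/-- The relabelling `1, …, m ↦ 0, …, m - 1`, extended to a permutation of the natural numbers. -/
def cycleDown (m : ℕ) : ℕ ↪ ℕ where
  toFun i := if i = 0 then m else if i ≤ m then i - 1 else i
  inj' i j hij := by
    simp only at hij
    split_ifs at hij <;> omega

theorem cycleDown_apply (m i : ℕ) :
    cycleDown m i = if i = 0 then m else if i ≤ m then i - 1 else i := rfl

theorem mem_union_map_cycleDown {m n g : ℕ} {ρ : Finset ℕ} (hρ : FaceA m 0 g ρ)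
    {x : ℕ} : x ∈ Finset.Ioc m n ∪ ρ.map (cycleDown m) ↔
      (m < x ∧ x ≤ n) ∨ (x < m ∧ x + 1 ∈ ρ) := by
  rw [Finset.mem_union, Finset.mem_Ioc, Finset.mem_map]
  refine or_congr_right ⟨?_, fun h => ⟨x + 1, h.2, ?_⟩⟩
  · rintro ⟨y, hy, rfl⟩
    have := hρ.1 y hy
    rw [cycleDown_apply, if_neg (by omega), if_pos (by omega), Nat.sub_add_cancel (by omega)]
    exact ⟨by omega, hy⟩
  · rw [cycleDown_apply, if_neg (by omega), if_pos (by omega), Nat.add_sub_cancel]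

/-- The vertices above `m` form a block `B_(qh)` of weight `q` separated from the rest by the gap
`m`, and the rest is a copy of the complex of type `D`. The constants agree because `⌊n/h⌋ = q +
⌊m/h⌋`. -/
theorem isPivotal_relabel_end {n h q m : ℕ} (hh : 1 ≤ h) (hm : q * h + m = n)
    (hm2 : 2 ≤ m) {K : Finset ℕ → Prop} {p : Finset ℕ → Option ℕ}
    (hK : ∀ σ, K σ ↔ (∀ i ∈ σ, i ≤ n) ∧ (∀ i, m < i → i ≤ n → i ∈ σ) ∧ m ∉ σ ∧ h ≤ m + 1 ∧
      Finset.Ico (m + 1 - h) m ⊆ σ)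
    (hp : ∀ σ, K σ → p σ =
      (pivotD (2 * h) m (h - 1) ((σ.filter (· < m)).image (· + 1))).map (· - 1)) :
    IsPivotal (weightB (2 * h) n) ((n : ℤ) - (n / h : ℕ)) K p := by
  by_cases hhm : h ≤ m + 1
  swap
  · exact .of_isEmpty fun σ hσ => hhm ((hK σ).1 hσ).2.2.2.1
  have hmem := fun {ρ} (hρ : FaceA m 0 (h - 1) ρ) {x} =>
    mem_union_map_cycleDown (n := n) (x := x) hρ
  have hKF : ∀ ρ, FaceA m 0 (h - 1) ρ → K (Finset.Ioc m n ∪ ρ.map (cycleDown m)) := by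
    intro ρ hρ
    refine (hK _).2 ⟨fun i hi => ?_, fun i hi hi' => (hmem hρ).2 (.inl ⟨hi, hi'⟩), fun h => ?_, hhm,
      fun i hi => ?_⟩
    · have := (hmem hρ).1 hi
      omega
    · have := (hmem hρ).1 h
      omega
    · rw [Finset.mem_Ico] at hi
      exact (hmem hρ).2 (.inr ⟨hi.2, hρ.2.2 _ (by omega) (by omega) (by omega)⟩)
  have himage : ∀ ρ, FaceA m 0 (h - 1) ρ →
      ((Finset.Ioc m n ∪ ρ.map (cycleDown m)).filter (· < m)).image (· + 1) = ρ := by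
    intro ρ hρ
    ext x
    simp only [Finset.mem_image, Finset.mem_filter, hmem hρ]
    constructor
    · rintro ⟨y, ⟨h1, h2⟩, rfl⟩
      exact (h1.resolve_left (by omega)).2
    · intro hx
      have := hρ.1 x hx
      refine ⟨x - 1, ⟨.inr ⟨by omega, ?_⟩, by omega⟩, by omega⟩
      rwa [Nat.sub_add_cancel (by omega)]
  have hdiv : n / h = q + m / h := by
    rw [← hm, add_comm, Nat.add_mul_div_right _ _ hh, add_comm]
  have hD := isPivotal_pivotD hh m
  refine hD.transport (Finset.Ioc m n) (cycleDown m) q (fun ρ hρ x hx => ?_) ?_ (fun σ hσ => ?_) hKF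
    (fun ρ hρ => ?_) fun ρ hρ => ?_
  · have := hρ.1 x hx
    rw [cycleDown_apply, if_neg (by omega), if_pos (by omega), Finset.mem_Ioc]
    omega
  · rw [Nat.card_Ioc, hdiv]
    omega
  · obtain ⟨h1, h2, h3, -, h4⟩ := (hK σ).1 hσ
    have hρ : FaceA m 0 (h - 1) ((σ.filter (· < m)).image (· + 1)) := by
      refine ⟨fun i hi => ?_, fun i hi hi' => by omega, fun i hi hi' hi'' => ?_⟩
      · obtain ⟨y, hy, rfl⟩ := Finset.mem_image.1 hi
        have := (Finset.mem_filter.1 hy).2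
        omega
      · exact Finset.mem_image.2 ⟨i - 1, Finset.mem_filter.2
          ⟨h4 (Finset.mem_Ico.2 (by omega)), by omega⟩, by omega⟩
    refine ⟨_, hρ, ?_⟩
    ext x
    rw [hmem hρ, Finset.mem_image]
    constructor
    · rintro (h5 | ⟨h5, y, hy, hyx⟩)
      · exact h2 x h5.1 h5.2
      · obtain rfl : y = x := by omega
        exact (Finset.mem_filter.1 hy).1
    · intro hx
      rcases lt_trichotomy x m with h5 | rfl | h5
      · exact .inr ⟨h5, x, Finset.mem_filter.2 ⟨hx, h5⟩, rfl⟩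
      · exact absurd hx h3
      · exact .inl ⟨h5, h1 x hx⟩
  · rw [hp _ (hKF ρ hρ), himage ρ hρ]
    cases hu : pivotD (2 * h) m (h - 1) ρ with
    | none => rfl
    | some u =>
      have hu0 : 1 ≤ u ∧ u ≤ m := by
        have h1 := (hD.toggle ρ u hρ hu).1
        rw [toggle] at h1
        split_ifs at h1 with h2
        · exact hρ.1 u h2
        · exact h1.1 u (Finset.mem_insert_self u ρ)
      rw [Option.map_some, Option.map_some, cycleDown_apply, if_neg (by omega), if_pos hu0.2]
  · have hnot : m ∉ Finset.Ioc m n ∪ ρ.map (cycleDown m) := ((hK _).1 (hKF ρ hρ)).2.2.1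
    rw [weightB_of_suffix _ (k := q * h) (fun h1 => hnot (h1 (mem_typeB.2 (by omega))))
      (fun i hi hi' => (hmem hρ).2 (.inl (by omega))) (by rwa [show n - q * h = m by omega])
      (by omega), weightBlockB_even, Nat.mul_div_cancel _ hh, show n - q * h = m by omega, add_comm]
    congr 2
    conv_rhs => rw [← himage ρ hρ]
    rw [Finset.map_eq_image]
    rfl

/-- The simplices with a given quotient `q`, in the case not reduced to type `D`. -/
theorem isPivotal_pivotAffineBEven_const {n h q m : ℕ} (hn : 3 ≤ n) (hh : 1 ≤ h)
    (hm : q * h + m = n) (hm1 : 1 ≤ m) {K : Finset ℕ → Prop} {p : Finset ℕ → Option ℕ}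
    (hK : ∀ σ, K σ ↔ σ ⊂ Finset.range (n + 1) ∧ (∀ i, m < i → i ≤ n → i ∈ σ) ∧
      ¬ (h ≤ m + 1 ∧ Finset.Ico (m + 1 - h) m ⊆ σ) ∧ (σ = typeB n → m < h))
    (hp : ∀ σ, K σ → σ ≠ typeB n → p σ = if m ∈ σ then some m
      else if σ.card = n then none
      else if m = h ∧ σ = (typeB n).erase m then none else some m)
    (hp' : K (typeB n) → p (typeB n) = if m ≤ 1 then none else some m) :
    IsPivotal (weightB (2 * h) n) ((n : ℤ) - (n / h : ℕ)) K p := by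
  have hmB : m ∈ typeB n ↔ 2 ≤ m := by rw [mem_typeB]; omega
  have hq : m < h → n / h = q := fun h1 => div_eq_of_le_of_lt q (by omega) (by omega)
  have hpK : ∀ σ, K σ → p σ = if m ∈ σ then some m
      else if σ.card = n then none
      else if m = h ∧ σ = (typeB n).erase m then none else some m := by
    intro σ hσ
    by_cases hB : σ = typeB n
    · subst hB
      rw [hp' hσ]
      simp only [hmB, card_typeB (show 1 ≤ n by omega), if_true]
      by_cases h2 : 2 ≤ m
      · rw [if_neg (by omega), if_pos h2]
      · rw [if_pos (by omega), if_neg h2]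
    · exact hp σ hσ hB
  have hproper : ∀ σ, m ∉ σ → (insert m σ ⊂ Finset.range (n + 1) ↔
      σ ⊂ Finset.range (n + 1) ∧ σ.card ≠ n) := by
    intro σ hσ
    constructor
    · intro h1
      refine ⟨(Finset.subset_insert m σ).trans_ssubset h1, fun h2 => ?_⟩
      have := Finset.card_lt_card h1
      rw [Finset.card_insert_of_notMem hσ, Finset.card_range] at this
      omega
    · rintro ⟨h1, h2⟩
      refine Finset.ssubset_iff_subset_ne.2
        ⟨Finset.insert_subset (Finset.mem_range.2 (by omega)) h1.1, fun h3 => h2 ?_⟩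
      have := congrArg Finset.card h3
      rw [Finset.card_insert_of_notMem hσ, Finset.card_range] at this
      omega
  have hBcard : ∀ σ, m ∉ σ → σ = typeB n → σ.card = n := fun σ _ h2 => by
    rw [h2, card_typeB (by omega)]
  have herase : ∀ σ, m ∉ σ → insert m σ = typeB n → σ = (typeB n).erase m := fun σ h1 h2 => by
    rw [← h2, Finset.erase_insert h1]
  have hIco : ∀ σ : Finset ℕ, Finset.Ico (m + 1 - h) m ⊆ insert m σ ↔
      Finset.Ico (m + 1 - h) m ⊆ σ :=
    fun σ => Finset.subset_insert_iff_of_notMem (by simp)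
  -- In the range from `m + 1 - h` to `m - 1` only the vertex `1` can be missing, so it must lie in
  -- this range.
  have hlarge : ¬ (h ≤ m + 1 ∧ Finset.Ico (m + 1 - h) m ⊆ (typeB n).erase m) → m ≤ h := by
    intro h1
    by_contra h2
    refine h1 ⟨by omega, fun i hi => ?_⟩
    rw [Finset.mem_Ico] at hi
    rw [Finset.mem_erase, mem_typeB]
    omega
  refine .of_const m (fun σ => ¬ (σ.card = n ∧ m ∉ σ) ∧ ¬ (m = h ∧ σ = (typeB n).erase m))
    (fun σ hσ hN => ?_) (fun σ hσ hN => ?_) (fun σ hσ => ?_) (fun σ hmσ hσ hN => ?_)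
    fun σ hσ hN => ?_
  · rw [hpK σ hσ]
    by_cases h1 : m ∈ σ
    · rw [if_pos h1]
    · rw [if_neg h1, if_neg fun h2 => hN.1 ⟨h2, h1⟩, if_neg hN.2]
  · rw [hpK σ hσ]
    have h1 : m ∉ σ := fun h1 => hN ⟨fun h2 => h2.2 h1, fun h2 =>
      Finset.notMem_erase m (typeB n) (h2.2 ▸ h1)⟩
    rw [if_neg h1]
    by_cases h2 : σ.card = n
    · rw [if_pos h2]
    · rw [if_neg h2, if_pos]
      by_contra h3
      exact hN ⟨fun h => h2 h.1, h3⟩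
  · rw [hK, hK, hproper σ hσ, hIco]
    have h1 : (∀ i, m < i → i ≤ n → i ∈ insert m σ) ↔ ∀ i, m < i → i ≤ n → i ∈ σ :=
      forall_congr' fun i => forall_congr' fun hi => by
        rw [Finset.mem_insert, or_iff_right (by omega)]
    rw [h1]
    constructor
    · rintro ⟨⟨h2, h3, h4, h5⟩, h6, h7⟩
      refine ⟨⟨⟨h2, fun h8 => h6 ⟨h8, hσ⟩⟩, h3, h4, fun h8 => ?_⟩, fun h8 =>
        h8.2 (Finset.mem_insert_self m σ), fun h8 =>
        Finset.notMem_erase m (typeB n) (h8.2 ▸ Finset.mem_insert_self m σ)⟩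
      have h9 := herase σ hσ h8
      have h10 := hlarge (h9 ▸ h4)
      have : m ≠ h := fun h11 => h7 ⟨h11, h9⟩
      omega
    · rintro ⟨⟨⟨h2, h3⟩, h4, h5, h6⟩, -⟩
      refine ⟨⟨h2, h4, h5, fun h7 => absurd (hBcard σ hσ h7) h3⟩, fun h7 => h3 h7.1, ?_⟩
      rintro ⟨h7, h8⟩
      by_cases hm2 : 2 ≤ m
      · have h9 : insert m σ = typeB n := by rw [h8, Finset.insert_erase (hmB.2 hm2)]
        have := h6 h9
        omega
      · exact h3 (hBcard σ hσ (by rw [h8, Finset.erase_eq_of_notMem (by rw [hmB]; exact hm2)]))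
  · obtain ⟨h1, h2, h3, h4⟩ := (hK σ).1 hσ
    have h5 : insert m σ ⊂ Finset.range (n + 1) :=
      (hproper σ hmσ).2 ⟨h1, fun h => hN.1 ⟨h, hmσ⟩⟩
    by_cases hB : insert m σ = typeB n
    · have h6 := herase σ hmσ hB
      have h7 : 2 ≤ m := hmB.1 (hB ▸ Finset.mem_insert_self m σ)
      have h8 := hlarge (h6 ▸ h3)
      have h9 : m < h := by
        have : m ≠ h := fun h => hN.2 ⟨h, h6⟩
        omega
      rw [hB, h6, weightB_typeB, weightB_typeB_erase (by omega) h7 (by omega),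
        weightBlockB_even, weightBlockB_even, hq h9, show n - m = q * h by omega,
        Nat.mul_div_cancel _ hh, Nat.div_eq_of_lt (by omega), add_zero]
    -- Adding `m` turns `B_(qh)` into `B_k` with `k = qh + (m + 1 - a)` and `m + 1 - a < h`, which
    -- still has weight `q`; the absorbed block of type `A` had weight `0`.
    · obtain ⟨a, ha1, ham, ha, hI, hw⟩ :=
        weightB_insert (d := 2 * h) (by omega) (by omega) h5 hmσ h2 hB
      have h6 : m + 1 - a < h := by
        by_contra h6
        exact h3 ⟨by omega, fun i hi => by
          rw [Finset.mem_Ico] at hi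
          exact hI i (by omega) hi.2⟩
      rw [weightBlockB_even, weightBlockB_even, Nat.div_eq_of_lt (by omega),
        show n - m = q * h by omega, Nat.mul_div_cancel _ hh,
        div_eq_of_le_of_lt (x := n + 1 - a) q (by omega) (by omega)] at hw
      omega
  · obtain ⟨h1, h2, h3, h4⟩ := (hK σ).1 hσ
    by_cases hB : σ = typeB n
    · rw [hB, card_typeB (by omega), weightB_typeB, weightBlockB_even]
    rw [not_and_or, not_not, not_not] at hN
    -- Two kinds of critical simplices remain. All vertices except `m`: type `B_(qh) × D_m` with `m
    -- < h`, so the weight is `q = ⌊n/h⌋`. And `{0, 2, …, n} \ {m}` with `m = h`: type `B_(qh) ×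
    -- A_(h-1)`, of weight `q`, where both the cardinality and the weight fall one short of `n` and
    -- `⌊n/h⌋`.
    rcases hN with ⟨hN, hmσ⟩ | ⟨hN, hN'⟩
    · have h5 : σ = (Finset.range (n + 1)).erase m := by
        refine Finset.eq_of_subset_of_card_le (Finset.subset_erase.2 ⟨h1.1, hmσ⟩) ?_
        rw [Finset.card_erase_of_mem (Finset.mem_range.2 (by omega)), Finset.card_range, hN]
        omega
      have hmem : ∀ i, i ∈ σ ↔ i ≠ m ∧ i ≤ n := fun i => by
        rw [h5, Finset.mem_erase, Finset.mem_range]; omega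
      have hm2 : 2 ≤ m := by
        by_contra hm2
        refine hB ?_
        rw [h5, show m = 1 by omega]
      have hmh : m + 1 < h := by
        by_contra h6
        refine h3 ⟨by omega, fun i hi => ?_⟩
        rw [Finset.mem_Ico] at hi
        rw [hmem]
        omega
      rw [hN, weightB_of_suffix _ (k := q * h) (fun h => hmσ (h (hmB.2 hm2)))
        (fun i hi hi' => (hmem i).2 (by omega)) (by rwa [show n - q * h = m by omega]) (by omega),
        show n - q * h = m by omega, weightBlockB_even, Nat.mul_div_cancel _ hh, hq (by omega)]
      have h6 : σ.filter (· < m) = Finset.range m := by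
        ext i
        rw [Finset.mem_filter, hmem, Finset.mem_range]
        omega
      rw [h6, weightD_map_range _ hm2, weightBlockD_eq_zero (by omega) (by omega), add_zero]
    · have hm2 : 2 ≤ m := by
        by_contra hm2
        exact hB (by rw [hN', Finset.erase_eq_of_notMem (by rw [hmB]; exact hm2)])
      rw [hN', Finset.card_erase_of_mem (hmB.2 hm2), card_typeB (by omega),
        weightB_typeB_erase (by omega) hm2 (by omega), weightBlockB_even,
        show n - m = q * h by omega, Nat.mul_div_cancel _ hh, Nat.div_eq_of_lt (by omega),
        div_eq_of_le_of_lt (x := n) (q + 1) (by rw [add_one_mul]; omega) (by rw [add_one_mul]; omega)]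
      push_cast [show 1 ≤ n by omega]
      ring

/-- The quotient `q` of the component size of `n` by `h` is monotone in `σ`. In its fibre the
simplices containing the `h - 1` vertices before `m` form an upper set, handled by type `D`; on the
others the pivot is constantly `m`. Small `m` is separated because `{0, 2, …, n}` interferes there.
-/
theorem isPivotal_pivotAffineBEven {n h : ℕ} (hn : 3 ≤ n) (hh : 1 ≤ h) :
    IsPivotal (weightB (2 * h) n) ((n : ℤ) - (n / h : ℕ)) (· ⊂ Finset.range (n + 1))
      (pivotAffineBEven (2 * h) n) := by
  refine .of_fiber (fun σ => componentSize graphAffineB σ n / h)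
    (fun τ σ _ _ hs => Nat.div_le_div_right (componentSize_mono hs)) fun q => ?_
  by_cases hqn : q * h ≤ n
  swap
  · refine .of_isEmpty fun σ hσ => hqn ?_
    have h1 : componentSize graphAffineB σ n ≤ n := by
      by_cases hB : σ = typeB n
      · rw [hB, componentSize_graphAffineB_erase hn]
      · obtain ⟨k, hk, hc, -⟩ := exists_componentSize hn hσ.1 hB
        omega
    have h2 := hσ.2
    rw [← h2]
    exact (Nat.div_mul_le_self _ _).trans h1
  obtain ⟨m, hm⟩ : ∃ m, q * h + m = n := ⟨n - q * h, by omega⟩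
  have hBq : ∀ {σ}, σ = typeB n → componentSize graphAffineB σ n / h = q →
      n / h = q ∧ m < h := fun {σ} h1 h2 => by
    rw [h1, componentSize_graphAffineB_erase hn] at h2
    have h3 := Nat.div_add_mod n h
    have h4 := Nat.mod_lt n hh
    rw [h2, mul_comm] at h3
    exact ⟨h2, by omega⟩
  rcases Nat.eq_zero_or_pos m with rfl | hm1
  -- For `m = 0` the fibre can contain only `{1, …, n}` and `{0, 2, …, n}`, both critical.
  · have h0 : ∀ {σ}, σ ⊂ Finset.range (n + 1) → σ ≠ typeB n →
        componentSize graphAffineB σ n / h = q → σ = Finset.Icc 1 n := by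
      intro σ h1 h2 h3
      have h4 := ((componentSize_div_eq_iff hn hh hm h1 h2).1 h3).1
      refine (Finset.eq_of_subset_of_card_le (fun i hi => h4 i ?_ ?_) ?_).symm
      · exact (Finset.mem_Icc.1 hi).1
      · exact (Finset.mem_Icc.1 hi).2
      · have := Finset.card_lt_card h1
        rw [Finset.card_range] at this
        rw [Nat.card_Icc]
        omega
    refine .of_none (fun σ hσ => ?_) fun σ hσ => ?_
    · by_cases hB : σ = typeB n
      · rw [hB, pivotAffineBEven_typeB hn hm (hBq hB hσ.2).1, if_pos (by omega)]
      · have h1 := h0 hσ.1 hB hσ.2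
        have h3 : ∀ τ, pivotD (2 * h) 0 (h - 1) τ = none := fun τ => by rw [pivotD]; simp
        rw [pivotAffineBEven_eq hn hm hσ.1 hB hσ.2, h3, if_neg (by simp [h1]), Option.map_none]
        simp [h1]
    · by_cases hB : σ = typeB n
      · rw [hB, card_typeB (by omega), weightB_typeB, weightBlockB_even]
      · rw [h0 hσ.1 hB hσ.2, weightB_of_suffix _ (k := n)
          (fun h => by simpa using h (mem_typeB.2 (⟨by omega, by omega⟩ : 0 ≤ n ∧ 0 ≠ 1)))
          (fun i hi hi' => Finset.mem_Icc.2 (by omega)) (by simp) le_rfl, Nat.sub_self,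
          weightBlockB_even, Nat.card_Icc]
        simp [weightD_empty]
  refine .of_upper (fun σ => h ≤ m + 1 ∧ Finset.Ico (m + 1 - h) m ⊆ σ)
    (fun τ σ _ _ hs h1 => ⟨h1.1, h1.2.trans hs⟩) ?_ ?_
  · rcases Nat.eq_or_lt_of_le hm1 with rfl | hm2
    -- For `m = 1` there are only `{0, 2, …, n}` and, when `h = 1`, also `{2, …, n}`.
    · have hcases : ∀ σ, (σ ⊂ Finset.range (n + 1) ∧ componentSize graphAffineB σ n / h = q) ∧
          h ≤ 1 + 1 ∧ Finset.Ico (1 + 1 - h) 1 ⊆ σ → σ ≠ typeB n → h = 1 ∧ σ = Finset.Icc 2 n := by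
        rintro σ ⟨⟨h1, h2⟩, h3, h4⟩ hB
        have h5 := (componentSize_div_eq_iff hn hh hm h1 hB).1 h2
        have h0 : 0 ∉ σ := fun h0 => hB (eq_typeB_of_subset h1 fun i hi => by
          rw [mem_typeB] at hi
          rcases Nat.eq_zero_or_pos i with rfl | hi0
          · exact h0
          · exact h5.1 i (by omega) hi.1)
        have hh1 : h = 1 := by
          by_contra hh1
          exact h0 (h4 (Finset.mem_Ico.2 (by omega)))
        subst hh1
        refine ⟨rfl, ?_⟩
        have h6 : 1 ∉ σ := fun h6 => h5.2 ⟨le_rfl, by simpa using h6⟩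
        ext i
        rw [Finset.mem_Icc]
        refine ⟨fun hi => ?_, fun hi => h5.1 i (by omega) hi.2⟩
        have := Finset.mem_range.1 (h1.1 hi)
        have : i ≠ 0 := fun h => h0 (h ▸ hi)
        have : i ≠ 1 := fun h => h6 (h ▸ hi)
        omega
      refine .of_none (fun σ hσ => ?_) fun σ hσ => ?_
      · by_cases hB : σ = typeB n
        · rw [hB, pivotAffineBEven_typeB hn hm (hBq hB hσ.1.2).1, if_pos (by omega)]
        · obtain ⟨rfl, h2⟩ := hcases σ hσ hB
          rw [pivotAffineBEven_eq hn hm hσ.1.1 hB hσ.1.2, if_neg (by simp [h2]), if_pos hσ.2]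
          have h3 : (σ.filter (· < 1)).image (· + 1) = ∅ := by
            rw [h2]
            ext i
            simp only [Finset.mem_image, Finset.mem_filter, Finset.mem_Icc]
            simp
          rw [h3, pivotD_eq le_rfl le_rfl, if_pos (by simp), pivotA, dif_pos (by omega)]
          rfl
      · by_cases hB : σ = typeB n
        · rw [hB, card_typeB (by omega), weightB_typeB, weightBlockB_even]
        · obtain ⟨rfl, h2⟩ := hcases σ hσ hB
          rw [h2, weightB_of_suffix _ (k := n - 1)
            (fun h => by simpa using h (mem_typeB.2 (⟨by omega, by omega⟩ : 0 ≤ n ∧ 0 ≠ 1)))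
            (fun i hi hi' => Finset.mem_Icc.2 (by omega))
            (by rw [Finset.mem_Icc]; omega) (by omega), weightBlockB_even, Nat.card_Icc]
          have h3 : (Finset.Icc 2 n).filter (· < n - (n - 1)) = ∅ := by
            ext i
            simp only [Finset.mem_filter, Finset.mem_Icc, Finset.notMem_empty, iff_false]
            omega
          rw [h3, Finset.map_empty, weightD_empty, Nat.div_one, Nat.div_one]
          push_cast [show 1 ≤ n by omega]
          ring
    · have hnotB : ∀ {σ}, componentSize graphAffineB σ n / h = q →
          h ≤ m + 1 ∧ Finset.Ico (m + 1 - h) m ⊆ σ → σ ≠ typeB n := by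
        intro σ h1 h2 hB
        have h3 := (hBq hB h1).2
        have h4 := h2.2 (Finset.mem_Ico.2 (⟨by omega, by omega⟩ : m + 1 - h ≤ 1 ∧ 1 < m))
        rw [hB] at h4
        simp at h4
      have hmσ : ∀ {σ}, (σ ⊂ Finset.range (n + 1) ∧ componentSize graphAffineB σ n / h = q) ∧
          h ≤ m + 1 ∧ Finset.Ico (m + 1 - h) m ⊆ σ → m ∉ σ := by
        rintro σ ⟨⟨h1, h2⟩, h3⟩ h4
        have h5 := (componentSize_div_eq_iff hn hh hm h1 (hnotB h2 h3)).1 h2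
        have h6 : ∀ i, m + 1 - h ≤ i → i ≤ m → i ∈ σ := fun i hi hi' => by
          rcases Nat.eq_or_lt_of_le hi' with rfl | hi'
          · exact h4
          · exact h3.2 (Finset.mem_Ico.2 ⟨hi, hi'⟩)
        by_cases h7 : h ≤ m
        · exact h5.2 ⟨h7, fun i hi => h6 i (Finset.mem_Icc.1 hi).1 (Finset.mem_Icc.1 hi).2⟩
        · refine h1.2 fun i hi => ?_
          rcases Nat.lt_or_ge m i with h8 | h8
          · exact h5.1 i h8 (by rw [Finset.mem_range] at hi; omega)
          · exact h6 i (by omega) h8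
      refine isPivotal_relabel_end hh hm hm2 (fun σ => ⟨fun hσ => ?_, fun hσ => ?_⟩) fun σ hσ => ?_
      · refine ⟨fun i hi => ?_, ?_, hmσ hσ, hσ.2⟩
        · have := Finset.mem_range.1 (hσ.1.1.1 hi)
          omega
        · exact ((componentSize_div_eq_iff hn hh hm hσ.1.1 (hnotB hσ.1.2 hσ.2)).1 hσ.1.2).1
      · obtain ⟨h1, h2, h3, h4⟩ := hσ
        have h5 : σ ⊂ Finset.range (n + 1) :=
          ⟨fun i hi => by have := h1 i hi; rw [Finset.mem_range]; omega,
            fun h => h3 (h (Finset.mem_range.2 (by omega)))⟩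
        refine ⟨⟨h5, (componentSize_div_eq_iff hn hh hm h5 ?_).2 ⟨h2, fun h6 => h3 (h6.2 ?_)⟩⟩, h4⟩
        · intro hB
          exact h3 (hB ▸ mem_typeB.2 (by omega))
        · exact Finset.mem_Icc.2 (by omega)
      · rw [pivotAffineBEven_eq hn hm hσ.1.1 (hnotB hσ.1.2 hσ.2) hσ.1.2, if_neg (hmσ hσ),
          if_pos hσ.2]
  · refine isPivotal_pivotAffineBEven_const hn hh hm hm1 (fun σ => ⟨fun hσ => ?_, fun hσ => ?_⟩)
      (fun σ hσ hB => ?_) fun hB => ?_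
    · refine ⟨hσ.1.1, ?_, hσ.2, fun hB => (hBq hB hσ.1.2).2⟩
      by_cases hB : σ = typeB n
      · intro i hi hi'
        rw [hB, mem_typeB]
        omega
      · exact ((componentSize_div_eq_iff hn hh hm hσ.1.1 hB).1 hσ.1.2).1
    · obtain ⟨h1, h2, h3, h4⟩ := hσ
      refine ⟨⟨h1, ?_⟩, h3⟩
      by_cases hB : σ = typeB n
      · rw [hB, componentSize_graphAffineB_erase hn]
        have := h4 hB
        exact div_eq_of_le_of_lt q (by omega) (by omega)
      · refine (componentSize_div_eq_iff hn hh hm h1 hB).2 ⟨h2, fun h5 => h3 ⟨by omega, ?_⟩⟩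
        exact fun i hi => h5.2 (Finset.Ico_subset_Icc_self hi)
    · rw [pivotAffineBEven_eq hn hm hσ.1.1 hB hσ.1.2, if_neg hσ.2]
    · exact pivotAffineBEven_typeB hn hm (hBq rfl hB.1.2).1

/-! ### From pivots to matchings on the complex of finite parabolic subgroups. -/

section Final

variable {n : ℕ}

/-- The vertices of a simplex as natural numbers. -/
def vertices (σ : Finset (Fin (n + 1))) : Finset ℕ := σ.map Fin.valEmbedding

theorem mem_vertices {σ : Finset (Fin (n + 1))} {i : Fin (n + 1)} :
    (i : ℕ) ∈ vertices σ ↔ i ∈ σ :=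
  Finset.mem_map' Fin.valEmbedding

theorem vertices_subset_range (σ : Finset (Fin (n + 1))) : vertices σ ⊆ Finset.range (n + 1) := by
  intro i hi
  obtain ⟨j, -, rfl⟩ := Finset.mem_map.1 hi
  exact Finset.mem_range.2 j.2

theorem vertices_injective : Function.Injective (vertices (n := n)) := Finset.map_injective _

theorem card_vertices (σ : Finset (Fin (n + 1))) : (vertices σ).card = σ.card := Finset.card_map _

theorem toFin_vertices (σ : Finset (Fin (n + 1))) : toFin n (vertices σ) = σ := by
  ext i
  rw [mem_toFin, mem_vertices]

theorem vertices_toFin {σ : Finset ℕ} (hσ : σ ⊆ Finset.range (n + 1)) :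
    vertices (toFin n σ) = σ := by
  ext i
  constructor
  · intro hi
    obtain ⟨j, hj, rfl⟩ := Finset.mem_map.1 hi
    exact mem_toFin.1 hj
  · intro hi
    have := Finset.mem_range.1 (hσ hi)
    exact mem_vertices (i := ⟨i, this⟩).2 (mem_toFin.2 hi)

theorem vertices_erase (σ : Finset (Fin (n + 1))) (v : Fin (n + 1)) :
    vertices (σ.erase v) = (vertices σ).erase v := Finset.map_erase _ _ _

theorem vertices_insert (σ : Finset (Fin (n + 1))) (v : Fin (n + 1)) :
    vertices (insert v σ) = insert (v : ℕ) (vertices σ) := Finset.map_insert _ _ _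

theorem IsFacet.vertices {τ σ : Finset (Fin (n + 1))} (h : IsFacet τ σ) :
    IsFacet (vertices τ) (vertices σ) :=
  ⟨Finset.map_subset_map.2 h.1, by rw [card_vertices, card_vertices, h.2]⟩

theorem isFacet_erase {B : Type*} [DecidableEq B] {σ : Finset B} {v : B} (hv : v ∈ σ) :
    IsFacet (σ.erase v) σ :=
  ⟨Finset.erase_subset _ _, (Finset.card_erase_add_one hv).symm⟩

/-- The set of edges of the matching that is described by a pivot function. -/
def pivotMatching (K : Set (Finset (Fin (n + 1)))) (p : Finset ℕ → Option ℕ) :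
    Set (Finset (Fin (n + 1)) × Finset (Fin (n + 1))) :=
  {e | e.1 ∈ K ∧ e.2 ∈ K ∧ ∃ v ∈ e.1, e.2 = e.1.erase v ∧
    (p (vertices e.1) = some (v : ℕ) ∨ p (vertices e.2) = some (v : ℕ))}

variable {w : Finset ℕ → ℕ} {c : ℤ} {p : Finset ℕ → Option ℕ} {K : Set (Finset (Fin (n + 1)))}
  {v : Finset (Fin (n + 1)) → ℕ}

/-- Toggling preserves the pivot, so the two endpoints of an edge have the same pivot, and also the
same weight. -/
theorem mem_pivotMatching (h : IsPivotal w c (· ⊂ Finset.range (n + 1)) p)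
    (hK : ∀ σ, σ ∈ K ↔ vertices σ ⊂ Finset.range (n + 1))
    {e : Finset (Fin (n + 1)) × Finset (Fin (n + 1))} :
    e ∈ pivotMatching K p ↔ e.1 ∈ K ∧ e.2 ∈ K ∧ ∃ v ∈ e.1, e.2 = e.1.erase v ∧
      p (vertices e.1) = some (v : ℕ) ∧ p (vertices e.2) = some (v : ℕ) ∧
      w (vertices e.1) = w (vertices e.2) := by
  refine and_congr_right fun h1 => and_congr_right fun h2 => exists_congr fun v =>
    and_congr_right fun hv => and_congr_right fun he => ⟨?_, fun h => .inl h.1⟩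
  have t1 : toggle (vertices e.1) v = vertices e.2 := by
    rw [toggle, if_pos (mem_vertices.2 hv), he, vertices_erase]
  have t2 : toggle (vertices e.2) v = vertices e.1 := by
    rw [toggle, if_neg (fun h => by rw [mem_vertices, he] at h; exact Finset.notMem_erase v _ h),
      ← vertices_insert, he, Finset.insert_erase hv]
  rintro (h3 | h3)
  · obtain ⟨-, h4, h5⟩ := h.toggle _ _ ((hK _).1 h1) h3
    rw [t1] at h4 h5
    exact ⟨h3, h4, h5.symm⟩
  · obtain ⟨-, h4, h5⟩ := h.toggle _ _ ((hK _).1 h2) h3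
    rw [t2] at h4 h5
    exact ⟨h4, h3, h5⟩

theorem isMatching_pivotMatching (h : IsPivotal w c (· ⊂ Finset.range (n + 1)) p)
    (hK : ∀ σ, σ ∈ K ↔ vertices σ ⊂ Finset.range (n + 1)) :
    IsMatching K (pivotMatching K p) := by
  have key : ∀ e ∈ pivotMatching K p, ∀ ρ, (e.1 = ρ ∨ e.2 = ρ) → ∃ v : Fin (n + 1),
      p (vertices ρ) = some (v : ℕ) ∧ e = if v ∈ ρ then (ρ, ρ.erase v) else (insert v ρ, ρ) := by
    rintro ⟨σ, τ⟩ he ρ hρ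
    obtain ⟨-, -, v, hv, h3, h4, h5, -⟩ := (mem_pivotMatching h hK).1 he
    simp only at hv h3 h4 h5 hρ
    refine ⟨v, ?_⟩
    rcases hρ with rfl | rfl
    · exact ⟨h4, by rw [if_pos hv, h3]⟩
    · refine ⟨h5, ?_⟩
      rw [if_neg (by rw [h3]; exact Finset.notMem_erase v σ), h3, Finset.insert_erase hv]
  refine ⟨fun e he => ?_, fun ρ _ e he e' he' h1 h2 => ?_⟩
  · obtain ⟨h1, h2, v, hv, h3, -⟩ := (mem_pivotMatching h hK).1 he
    exact ⟨h1, h2, h3 ▸ isFacet_erase hv⟩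
  · obtain ⟨v, hv, h3⟩ := key e he ρ h1
    obtain ⟨v', hv', h4⟩ := key e' he' ρ h2
    obtain rfl : v = v' := Fin.ext (Option.some.inj (hv.symm.trans hv'))
    rw [h3, h4]

theorem isAcyclic_pivotMatching (h : IsPivotal w c (· ⊂ Finset.range (n + 1)) p)
    (hK : ∀ σ, σ ∈ K ↔ vertices σ ⊂ Finset.range (n + 1)) :
    IsAcyclic (pivotMatching K p) := by
  have step : ∀ ρ ρ', (∃ τ, AltStep (pivotMatching K p) ρ (ρ', τ)) → ρ' ∈ K ∧
      (ρ ∈ K → PivotStep (· ⊂ Finset.range (n + 1)) p (vertices ρ) (vertices ρ')) := by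
    rintro ρ ρ' ⟨τ, h1, h2, h3⟩
    obtain ⟨h4, h5, v, hv, h6, h7, h8, -⟩ := (mem_pivotMatching h hK).1 h3
    simp only at h1 h2 h4 h5 h6 h7 h8 hv
    refine ⟨h4, fun hρ => ⟨vertices τ, v, (hK _).1 h5, (hK _).1 hρ, (hK _).1 h4, h1.vertices, ?_, h8,
      ?_, fun h9 => h2 (vertices_injective h9 ▸ h3)⟩⟩
    · rw [mem_vertices, h6]
      exact Finset.notMem_erase v ρ'
    · rw [← vertices_insert, h6, Finset.insert_erase hv]
  intro σ hσ
  have hσK : σ ∈ K := by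
    obtain ⟨_, -, h1⟩ := Relation.TransGen.tail'_iff.1 hσ
    exact (step _ _ h1).1
  refine h.acyclic (vertices σ) ?_
  have path : ∀ ρ, Relation.TransGen (fun ρ ρ' => ∃ τ, AltStep (pivotMatching K p) ρ (ρ', τ)) σ ρ →
      ρ ∈ K ∧ Relation.TransGen (PivotStep (· ⊂ Finset.range (n + 1)) p) (vertices σ)
        (vertices ρ) := by
    intro ρ hρ
    induction hρ with
    | single h1 => exact ⟨(step _ _ h1).1, .single ((step _ _ h1).2 hσK)⟩
    | tail _ h1 ih => exact ⟨(step _ _ h1).1, ih.2.tail ((step _ _ h1).2 ih.1)⟩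
  exact (path σ hσ).2

theorem isCritical_pivotMatching_iff (h : IsPivotal w c (· ⊂ Finset.range (n + 1)) p)
    (hK : ∀ σ, σ ∈ K ↔ vertices σ ⊂ Finset.range (n + 1)) {σ : Finset (Fin (n + 1))} :
    IsCritical K (pivotMatching K p) σ ↔ σ ∈ K ∧ p (vertices σ) = none := by
  refine and_congr_right fun hσ => ⟨fun h1 => ?_, fun h1 e he => ?_⟩
  · by_contra h2
    obtain ⟨u, hu⟩ := Option.ne_none_iff_exists'.1 h2
    obtain ⟨h3, h4, -⟩ := h.toggle _ _ ((hK σ).1 hσ) hu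
    have hun : u < n + 1 := by
      rw [toggle] at h3
      split_ifs at h3 with h5
      · exact Finset.mem_range.1 (vertices_subset_range σ h5)
      · exact Finset.mem_range.1 (h3.1 (Finset.mem_insert_self u _))
    lift u to Fin (n + 1) using hun
    by_cases huσ : u ∈ σ
    · rw [toggle, if_pos (mem_vertices.2 huσ), ← vertices_erase] at h3
      exact (h1 (σ, σ.erase u) ⟨hσ, (hK _).2 h3, u, huσ, rfl, .inl hu⟩).1 rfl
    · rw [toggle, if_neg (fun h => huσ (mem_vertices.1 h)), ← vertices_insert] at h3
      exact (h1 (insert u σ, σ) ⟨(hK _).2 h3, hσ, u, Finset.mem_insert_self u σ,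
        (Finset.erase_insert huσ).symm, .inr hu⟩).2 rfl
  · obtain ⟨-, -, v, -, -, h4, h5, -⟩ := (mem_pivotMatching h hK).1 he
    constructor
    · rintro rfl
      rw [h1] at h4
      simp at h4
    · rintro rfl
      rw [h1] at h5
      simp at h5

/-- Every descent lowers the cardinality by one, every ascent raises it by one, and there is one
more descent than ascents. -/
theorem IsAltPath.card_eq {B : Type*} {E : Set (Finset B × Finset B)}
    (hE : ∀ e ∈ E, IsFacet e.2 e.1) {σ τ : Finset B} {l : List (Finset B × Finset B)}
    (h : IsAltPath E σ l τ) : σ.card = τ.card + 1 := by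
  induction l generalizing σ with
  | nil => exact h.1.2
  | cons e l ih =>
    obtain ⟨⟨h1, -, h2⟩, h3⟩ := h
    rw [h1.2, ← (hE e h2).2, ih h3]

/-- A weighted acyclic matching is precise if the difference of the dimension and the weight is
the same for all critical simplices. -/
theorem isPrecise_of_card_sub {B : Type*} [LinearOrder B] {K : Set (Finset B)}
    {v : Finset B → ℕ} {E : Set (Finset B × Finset B)} (hE : IsMatching K E) (hac : IsAcyclic E)
    (hw : IsWeighted v E) {c : ℤ} (hc : ∀ σ, IsCritical K E σ → (σ.card : ℤ) - v σ = c) :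
    IsPrecise K v E := by
  refine ⟨hac, hw, fun σ τ hσ hτ h => ?_⟩
  -- A non-zero incidence number needs at least one alternating path, whence `|σ| = |τ| + 1`; the
  -- common value `c` turns this into the equation for the weights.
  obtain ⟨l, hl, -⟩ := exists_ne_zero_of_finsum_mem_ne_zero h
  have h1 := IsAltPath.card_eq (fun e he => (hE.1 e he).2.2) hl
  have h2 := hc σ hσ
  have h3 := hc τ hτ
  omega

variable {W : Type*} [Group W] (cs : CoxeterSystem (affineB n) W)

/-- Finiteness for proper subsets comes with the computation of the weight, and does not depend on
`d`, which is taken to be `2`; the full set is excluded by the translations. -/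
theorem mem_finiteComplex_iff (hn : 3 ≤ n) (σ : Finset (Fin (n + 1))) :
    σ ∈ finiteComplex cs ↔ vertices σ ⊂ Finset.range (n + 1) := by
  constructor
  · intro h
    refine Finset.ssubset_iff_subset_ne.2 ⟨vertices_subset_range σ, fun h1 => ?_⟩
    have h2 := infinite_parabolic_univ cs hn
    rw [← h1, toFin_vertices] at h2
    exact h2.not_finite h
  · intro h
    have h1 := (hasWeight_weightB cs le_rfl hn _ h).1
    rwa [toFin_vertices] at h1

theorem weight_eq_weightB {d : ℕ} (hd : 2 ≤ d) (hn : 3 ≤ n) {σ : Finset (Fin (n + 1))}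
    (hσ : σ ∈ finiteComplex cs) : weight cs d σ = weightB d n (vertices σ) := by
  have h1 := (hasWeight_weightB cs hd hn _ ((mem_finiteComplex_iff cs hn σ).1 hσ)).weight_eq
  rwa [toFin_vertices] at h1

theorem isPivotal_matching {d : ℕ} (hd : 2 ≤ d) (hn : 3 ≤ n) {c : ℤ}
    (h : IsPivotal (weightB d n) c (· ⊂ Finset.range (n + 1)) p) :
    IsMatching (finiteComplex cs) (pivotMatching (finiteComplex cs) p) ∧
    IsAcyclic (pivotMatching (finiteComplex cs) p) ∧
    IsWeighted (weight cs d) (pivotMatching (finiteComplex cs) p) ∧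
    (∀ σ, IsCritical (finiteComplex cs) (pivotMatching (finiteComplex cs) p) σ →
      (σ.card : ℤ) - weight cs d σ = c) ∧
    IsPrecise (finiteComplex cs) (weight cs d) (pivotMatching (finiteComplex cs) p) := by
  have hK := mem_finiteComplex_iff cs hn
  have h1 := isMatching_pivotMatching h hK
  have h2 := isAcyclic_pivotMatching h hK
  have h3 : IsWeighted (weight cs d) (pivotMatching (finiteComplex cs) p) := by
    intro e he
    obtain ⟨h4, h5, -, -, -, -, -, h6⟩ := (mem_pivotMatching h hK).1 he
    rw [weight_eq_weightB cs hd hn h4, weight_eq_weightB cs hd hn h5, h6]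
  have h4 : ∀ σ, IsCritical (finiteComplex cs) (pivotMatching (finiteComplex cs) p) σ →
      (σ.card : ℤ) - weight cs d σ = c := by
    intro σ hσ
    have h5 := (isCritical_pivotMatching_iff h hK).1 hσ
    rw [weight_eq_weightB cs hd hn h5.1, ← card_vertices]
    exact h.critical _ ((hK σ).1 h5.1) h5.2
  exact ⟨h1, h2, h3, h4, isPrecise_of_card_sub h1 h2 h3 h4⟩

theorem affineBMatching_of_odd {d : ℕ} (hd : Odd d) (K : Set (Finset (Fin (n + 1)))) :
    affineBMatching d n K = pivotMatching K (pivotAffineBOdd n) := by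
  simp only [affineBMatching, if_pos hd]
  rfl

theorem affineBMatching_of_even {d : ℕ} (hd : Even d) (K : Set (Finset (Fin (n + 1)))) :
    affineBMatching d n K = pivotMatching K (pivotAffineBEven d n) := by
  simp only [affineBMatching, if_neg (Nat.not_odd_iff_even.2 hd)]
  rfl

theorem existsUnique_isCritical_odd {d : ℕ} (hd : 2 ≤ d) (hn : 3 ≤ n) (hodd : Odd d) :
    ∃! σ, IsCritical (finiteComplex cs)
      (pivotMatching (finiteComplex cs) (pivotAffineBOdd n)) σ := by
  have hK := mem_finiteComplex_iff cs hn
  have h1 : ∀ σ, IsCritical (finiteComplex cs)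
      (pivotMatching (finiteComplex cs) (pivotAffineBOdd n)) σ ↔
      vertices σ = Finset.range n := by
    intro σ
    rw [isCritical_pivotMatching_iff (isPivotal_pivotAffineBOdd hd hn hodd) hK, hK,
      pivotAffineBOdd]
    constructor
    · rintro ⟨-, h2⟩
      by_contra h3
      simp [h3] at h2
    · intro h2
      rw [if_pos h2, h2]
      exact ⟨Finset.range_add_one (n := n) ▸ Finset.ssubset_insert (by simp), rfl⟩
  have h2 : vertices (toFin n (Finset.range n)) = Finset.range n :=
    vertices_toFin (Finset.range_subset_range.2 (Nat.le_succ n))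
  exact ⟨toFin n (Finset.range n), (h1 _).2 h2, fun σ hσ =>
    vertices_injective (((h1 σ).1 hσ).trans h2.symm)⟩

end Final

end ArtinMorse

theorem lemma8p1 {W : Type*} [Group W] (n d : ℕ) (hn : 3 ≤ n) (hd : 2 ≤ d)
    (cs : CoxeterSystem (ArtinMorse.affineB n) W)
    (K : Set (Finset (Fin (n + 1)))) (hK : K = ArtinMorse.finiteComplex cs)
    (E : Set (Finset (Fin (n + 1)) × Finset (Fin (n + 1))))
    (hE : E = ArtinMorse.affineBMatching d n K) :
    ArtinMorse.IsMatching K E ∧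
    ArtinMorse.IsAcyclic E ∧
    ArtinMorse.IsWeighted (ArtinMorse.weight cs d) E ∧
    (Odd d →
      (∃! σ, ArtinMorse.IsCritical K E σ) ∧
      ∀ σ, ArtinMorse.IsCritical K E σ →
        (σ.card : ℤ) - (ArtinMorse.weight cs d σ : ℤ) = (n : ℤ) - ((n / d : ℕ) : ℤ)) ∧
    (Even d →
      ∀ σ, ArtinMorse.IsCritical K E σ →
        (σ.card : ℤ) - (ArtinMorse.weight cs d σ : ℤ) = (n : ℤ) - ((n / (d / 2) : ℕ) : ℤ)) ∧
    ArtinMorse.IsPrecise K (ArtinMorse.weight cs d) E := by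
  subst hK hE
  rcases Nat.even_or_odd d with heven | hodd
  · obtain ⟨h, rfl⟩ := heven.exists_two_nsmul
    rw [nsmul_eq_mul, Nat.cast_ofNat] at *
    rw [ArtinMorse.affineBMatching_of_even heven]
    obtain ⟨h1, h2, h3, h4, h5⟩ := ArtinMorse.isPivotal_matching cs hd hn
      (ArtinMorse.isPivotal_pivotAffineBEven hn (by omega))
    rw [Nat.mul_div_cancel_left _ (by omega)]
    exact ⟨h1, h2, h3, fun hodd => absurd heven (Nat.not_even_iff_odd.2 hodd), fun _ => h4, h5⟩
  · rw [ArtinMorse.affineBMatching_of_odd hodd]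
    obtain ⟨h1, h2, h3, h4, h5⟩ := ArtinMorse.isPivotal_matching cs hd hn
      (ArtinMorse.isPivotal_pivotAffineBOdd hd hn hodd)
    exact ⟨h1, h2, h3, fun _ => ⟨ArtinMorse.existsUnique_isCritical_odd cs hd hn hodd, h4⟩,
      fun heven => absurd heven (Nat.not_even_iff_odd.2 hodd), h5⟩
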